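/- **Theorem (Satake isomorphism).** Let $(V,\omega)$ be a finite dimensional complex symplectic vector space and let $\Gamma\subset Sp(V)$ be a finite group. Let $S$ be the set of symplectic reflections in $\Gamma$, i.e. of those $s\in\Gamma$ with $\mathrm{rk}(\mathrm{Id}-s)=2$. For $s\in S$ let $\omega_s$ be the skew-symmetric form on $V$ that coincides with $\omega$ on $\mathrm{Im}(\mathrm{Id}-s)$ and has radical $\mathrm{Ker}(\mathrm{Id}-s)$. For $t\in\mathbb C$ and a conjugation-invariant function $c:S\to\mathbb C$, let $$\mathsf H_{t,c}=(TV\#\Gamma)\Big/\Big\langle x\otimes y-y\otimes x-t\,\omega(x,y)\,1-\sum_{s\in S}c_s\,\omega_s(x,y)\,s\Big\rangle_{x,y\in V}$$ be the symplectic reflection algebra, where $TV$ is the tensor algebra and $\#$ denotes the smash product. Put $\mathbf e=\frac1{|\Gamma|}\sum_{g\in\Gamma}g$ and let $\mathsf Z_{0,c}$ be the centre of $\mathsf H_{0,c}$. Let $\mathcal H_c$ be the $\mathbb C[t]$-algebra defined by the same presentation with $t$ an indeterminate, so that $\mathcal H_c/t\mathcal H_c=\mathsf H_{0,c}$ and $\mathbf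 e\mathcal H_c\mathbf e/t\,\mathbf e\mathcal H_c\mathbf e=\mathbf e\mathsf H_{0,c}\mathbf e$. Then, for every $c$: 1. There is a well-defined Poisson bracket on $\mathsf Z_{0,c}$ given by $\{z,w\}=t^{-1}(\tilde z\tilde w-\tilde w\tilde z)\bmod t$, where $\tilde z,\tilde w\in\mathcal H_c$ are arbitrary lifts of $z,w$. 2. The algebra $\mathbf e\mathsf H_{0,c}\mathbf e$ (with unit $\mathbf e$) is commutative and carries a well-defined Poisson bracket given by $\{u,v\}=t^{-\mathbf m}(\tilde u\tilde v-\tilde v\tilde u)\bmod t$, where $\tilde u,\tilde v\in\mathbf e\mathcal H_c\mathbf e$ are arbitrary lifts of $u,v$, and $\mathbf m\ge1$ is the greatest integer such that all commutators in $\mathbf e\mathcal H_c\mathbf e$ lie in $t^{\mathbf m}\,\mathbf e\mathcal H_c\mathbf e$; the bracket is zero if there is no greatest such integer. 3. The map $\mathsf Z_{0,c}\to\mathbf e\mathsf H_{0,c}\mathbf e$, $z\mapsto z\cdot\mathbf e$, is an isomorphism of Poisson algebras: it is an isomorphism of $\mathbb C$-algebras and satisfies $\{z,w\}\cdot\mathbf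 e=\{z\cdot\mathbf e,w\cdot\mathbf e\}$ for all $z,w\in\mathsf Z_{0,c}$. -/

import Mathlib

noncomputable section

/-! ### Poisson brackets coming from deformations -/

/-- The corner `e R e` of a `k`-algebra `R` is a `k`-algebra with unit `e`. -/
instance IsIdempotentElem.Corner.instAlgebra {k R : Type*} [CommRing k] [Ring R] [Algebra k R]
    {e : R} (he : IsIdempotentElem e) : Algebra k he.Corner :=
  letI : SMul k he.Corner := ⟨fun r a ↦ ⟨r • a.1, by
    obtain ⟨b, hb⟩ := a.2
    exact ⟨r • b, by simp only [mul_smul_comm, smul_mul_assoc, ← hb]⟩⟩⟩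
  letI : Module k he.Corner :=
    { one_smul := fun a ↦ Subtype.ext (one_smul k a.1)
      mul_smul := fun r s a ↦ Subtype.ext (mul_smul r s a.1)
      smul_zero := fun r ↦ Subtype.ext (smul_zero r)
      smul_add := fun r a b ↦ Subtype.ext (smul_add r a.1 b.1)
      add_smul := fun r s a ↦ Subtype.ext (add_smul r s a.1)
      zero_smul := fun a ↦ Subtype.ext (zero_smul k a.1) }
  Algebra.ofModule (fun r a b ↦ Subtype.ext (smul_mul_assoc r a.1 b.1))
    (fun r a b ↦ Subtype.ext (mul_smul_comm r a.1 b.1))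

/-- The ring homomorphism `e R e → f(e) S f(e)` induced by a ring homomorphism `f : R → S`. -/
def cornerMap {R S : Type*} [Ring R] [Ring S] (f : R →+* S) {e : R} {e' : S}
    (he : IsIdempotentElem e) (he' : IsIdempotentElem e') (h : f e = e') :
    he.Corner →+* he'.Corner where
  toFun a := ⟨f a.1, by
    obtain ⟨b, hb⟩ := a.2
    exact ⟨f b, by simp only [← hb, map_mul, h]⟩⟩
  map_one' := Subtype.ext h
  map_mul' a b := Subtype.ext (map_mul f a.1 b.1)
  map_zero' := Subtype.ext (map_zero f)
  map_add' a b := Subtype.ext (map_add f a.1 b.1)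

/-- The structure of a Poisson algebra on an associative unital `k`-algebra `A`. -/
structure PoissonStructure (k A : Type*) [CommRing k] [Ring A] [Algebra k A] where
  /-- the underlying algebra is commutative -/
  commutative : ∀ a b : A, a * b = b * a
  /-- the Poisson bracket -/
  bracket : A →ₗ[k] A →ₗ[k] A
  alternating : ∀ a, bracket a a = 0
  jacobi : ∀ a b c, bracket a (bracket b c) + bracket b (bracket c a) + bracket c (bracket a b) = 0
  leibniz : ∀ a b c, bracket a (b * c) = bracket a b * c + b * bracket a c

/-- `B` is the bracket induced on the commutative algebra `A = 𝒜 / τ𝒜` by its deformation `𝒜`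
with deformation parameter `τ`; here `π : 𝒜 → A` is the reduction map.

If the largest `m` such that all commutators of `𝒜` are divisible by `τ ^ m` is finite, then
`B (π u) (π v)` is the reduction of `τ⁻ᵐ (u v - v u)`, for arbitrary `u v : 𝒜`. If all commutators
are divisible by all powers of `τ`, then `B = 0`. -/
def IsDeformationBracket {𝒜 A : Type*} [Ring 𝒜] [Ring A] (τ : 𝒜) (π : 𝒜 →+* A)
    (B : A → A → A) : Prop :=
  (∃ m : ℕ, 1 ≤ m ∧
    (∀ u v : 𝒜, τ ^ m ∣ u * v - v * u) ∧
    (∃ u v : 𝒜, ¬ τ ^ (m + 1) ∣ u * v - v * u) ∧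
    ∀ u v d : 𝒜, u * v - v * u = τ ^ m * d → B (π u) (π v) = π d) ∨
  ((∀ (m : ℕ) (u v : 𝒜), τ ^ m ∣ u * v - v * u) ∧ ∀ a b : A, B a b = 0)

/-- `B` is the Hayashi bracket induced on the centre of the (possibly non-commutative) algebra
`A = 𝒜 / τ𝒜` by its deformation `𝒜` with deformation parameter `τ`; here `π : 𝒜 → A` is the
reduction map. The bracket of two central elements is the reduction of `τ⁻¹ (u v - v u)`, where
`u` and `v` are arbitrary lifts of them to `𝒜`. -/
def IsHayashiBracket {k 𝒜 A : Type*} [CommRing k] [Ring 𝒜] [Ring A] [Algebra k A]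
    (τ : 𝒜) (π : 𝒜 →+* A)
    (B : Subalgebra.center k A → Subalgebra.center k A → Subalgebra.center k A) : Prop :=
  ∀ (u v : 𝒜) (hu : π u ∈ Subalgebra.center k A) (hv : π v ∈ Subalgebra.center k A),
    τ ∣ u * v - v * u ∧
    ∀ d : 𝒜, u * v - v * u = τ * d → (B ⟨π u, hu⟩ ⟨π v, hv⟩ : A) = π d

/-! ### Symplectic reflection algebras -/

namespace SympRefl

variable {V : Type*} [AddCommGroup V] [Module ℂ V]

/-- The action of linear automorphisms of `V` on the tensor algebra `TV` by algebra
automorphisms. -/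
instance instTensorAction : MulSemiringAction (V ≃ₗ[ℂ] V) (TensorAlgebra ℂ V) where
  smul g a := TensorAlgebra.lift ℂ (TensorAlgebra.ι ℂ ∘ₗ (g : V →ₗ[ℂ] V)) a
  one_smul a := by
    change TensorAlgebra.lift ℂ (TensorAlgebra.ι ℂ ∘ₗ ((1 : V ≃ₗ[ℂ] V) : V →ₗ[ℂ] V)) a = a
    have : TensorAlgebra.lift ℂ (TensorAlgebra.ι ℂ ∘ₗ ((1 : V ≃ₗ[ℂ] V) : V →ₗ[ℂ] V)) =
        AlgHom.id ℂ (TensorAlgebra ℂ V) := by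
      apply TensorAlgebra.hom_ext
      ext x
      simp
    rw [this]
    rfl
  mul_smul g h a := by
    change TensorAlgebra.lift ℂ (TensorAlgebra.ι ℂ ∘ₗ ((g * h : V ≃ₗ[ℂ] V) : V →ₗ[ℂ] V)) a =
      TensorAlgebra.lift ℂ (TensorAlgebra.ι ℂ ∘ₗ (g : V →ₗ[ℂ] V))
        (TensorAlgebra.lift ℂ (TensorAlgebra.ι ℂ ∘ₗ (h : V →ₗ[ℂ] V)) a)
    rw [← AlgHom.comp_apply]
    congr 1
    apply TensorAlgebra.hom_ext
    ext x
    simp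
  smul_zero g := map_zero (TensorAlgebra.lift ℂ (TensorAlgebra.ι ℂ ∘ₗ (g : V →ₗ[ℂ] V)))
  smul_add g := map_add (TensorAlgebra.lift ℂ (TensorAlgebra.ι ℂ ∘ₗ (g : V →ₗ[ℂ] V)))
  smul_one g := map_one (TensorAlgebra.lift ℂ (TensorAlgebra.ι ℂ ∘ₗ (g : V →ₗ[ℂ] V)))
  smul_mul g := map_mul (TensorAlgebra.lift ℂ (TensorAlgebra.ι ℂ ∘ₗ (g : V →ₗ[ℂ] V)))

theorem smul_def (g : V ≃ₗ[ℂ] V) (a : TensorAlgebra ℂ V) :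
    g • a = TensorAlgebra.lift ℂ (TensorAlgebra.ι ℂ ∘ₗ (g : V →ₗ[ℂ] V)) a := rfl

instance instTensorSMulComm : SMulCommClass (V ≃ₗ[ℂ] V) ℂ (TensorAlgebra ℂ V) where
  smul_comm g r a := by simp only [smul_def, map_smul]

variable (ω : LinearMap.BilinForm ℂ V) (Γ : Subgroup (V ≃ₗ[ℂ] V))

/-- The set `S` of symplectic reflections in `Γ`: the elements `s` with `rk (Id - s) = 2`. -/
def reflections : Set Γ :=
  {s | Module.finrank ℂ (LinearMap.range (LinearMap.id - ((s : V ≃ₗ[ℂ] V) : V →ₗ[ℂ] V))) = 2}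

/-- The space `C` of conjugation-invariant functions on the set of symplectic reflections. -/
def invariantFunctions : Submodule ℂ (reflections Γ → ℂ) where
  carrier := {c | ∀ s s' : reflections Γ, IsConj (s : Γ) (s' : Γ) → c s = c s'}
  add_mem' ha hb s s' h := by simp [ha s s' h, hb s s' h]
  zero_mem' _ _ _ := rfl
  smul_mem' r _ ha s s' h := by simp [ha s s' h]

/-- For `s` of finite order: the projection of `V` onto `Im (Id - s)` along `Ker (Id - s)`, that
is, `Id` minus the average of the powers of `s`. -/
def movedProj (s : V ≃ₗ[ℂ] V) : V →ₗ[ℂ] V :=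
  LinearMap.id - (orderOf s : ℂ)⁻¹ • ∑ i ∈ Finset.range (orderOf s),
    ((s ^ i : V ≃ₗ[ℂ] V) : V →ₗ[ℂ] V)

/-- The form `ω_s` which coincides with `ω` on `Im (Id - s)` and has radical `Ker (Id - s)`; see
`formRefl_eq` and `formRefl_radical`. -/
def formRefl (s : V ≃ₗ[ℂ] V) : LinearMap.BilinForm ℂ V :=
  ω.compl₁₂ (movedProj s) (movedProj s)

section movedProj

variable {s : V ≃ₗ[ℂ] V}

theorem movedProj_apply (x : V) : movedProj s x =
    x - (orderOf s : ℂ)⁻¹ • ∑ i ∈ Finset.range (orderOf s), (s ^ i) x := by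
  simp [movedProj, LinearMap.sum_apply]

theorem movedProj_of_fixed (hs : IsOfFinOrder s) {x : V} (hx : s x = x) : movedProj s x = 0 := by
  have h (i : ℕ) : (s ^ i) x = x := by
    induction i with
    | zero => rfl
    | succ i ih => rw [pow_succ, LinearEquiv.mul_apply, hx, ih]
  have h0 : (orderOf s : ℂ) ≠ 0 := Nat.cast_ne_zero.mpr hs.orderOf_pos.ne'
  rw [movedProj_apply, Finset.sum_congr rfl fun i _ ↦ h i, Finset.sum_const, Finset.card_range,
    ← Nat.cast_smul_eq_nsmul ℂ, smul_smul, inv_mul_cancel₀ h0, one_smul, sub_self]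

theorem sum_pow_apply_sub (x : V) :
    ∑ i ∈ Finset.range (orderOf s), (s ^ i) (x - s x) = 0 := by
  have h (i : ℕ) : (s ^ i) (x - s x) = (s ^ i) x - (s ^ (i + 1)) x := by
    rw [map_sub, pow_succ, LinearEquiv.mul_apply]
  rw [Finset.sum_congr rfl fun i _ ↦ h i,
    Finset.sum_range_sub' (fun i ↦ (s ^ i) x), pow_orderOf_eq_one, pow_zero, sub_self]

theorem movedProj_of_moved (x : V) : movedProj s (x - s x) = x - s x := by
  rw [movedProj_apply, sum_pow_apply_sub, smul_zero, sub_zero]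

theorem fixed_sub_movedProj (x : V) : s (x - movedProj s x) = x - movedProj s x := by
  have h : ∑ i ∈ Finset.range (orderOf s), s ((s ^ i) x) =
      ∑ i ∈ Finset.range (orderOf s), (s ^ i) x := by
    rw [← sub_eq_zero, ← Finset.sum_sub_distrib]
    have h (i : ℕ) : s ((s ^ i) x) - (s ^ i) x = (s ^ (i + 1)) x - (s ^ i) x := by
      rw [pow_succ', LinearEquiv.mul_apply]
    rw [Finset.sum_congr rfl fun i _ ↦ h i,
      Finset.sum_range_sub (fun i ↦ (s ^ i) x), pow_orderOf_eq_one, pow_zero, sub_self]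
  rw [movedProj_apply, sub_sub_cancel, map_smul, map_sum, h]

/-- `ω_s` coincides with `ω` on `Im (Id - s)`. -/
theorem formRefl_eq (ω : LinearMap.BilinForm ℂ V) {x y : V}
    (hx : x ∈ LinearMap.range (LinearMap.id - (s : V →ₗ[ℂ] V)))
    (hy : y ∈ LinearMap.range (LinearMap.id - (s : V →ₗ[ℂ] V))) :
    formRefl ω s x y = ω x y := by
  obtain ⟨x, rfl⟩ := hx
  obtain ⟨y, rfl⟩ := hy
  change ω (movedProj s (x - s x)) (movedProj s (y - s y)) = ω (x - s x) (y - s y)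
  rw [movedProj_of_moved, movedProj_of_moved]

/-- The radical of `ω_s` is `Ker (Id - s)`. -/
theorem formRefl_radical {ω : LinearMap.BilinForm ℂ V} (hnd : ω.Nondegenerate)
    (hs : IsOfFinOrder s) (hω : ∀ x y, ω (s x) (s y) = ω x y) (x : V) :
    (∀ y, formRefl ω s x y = 0) ↔ x ∈ LinearMap.ker (LinearMap.id - (s : V →ₗ[ℂ] V)) := by
  have hker : x ∈ LinearMap.ker (LinearMap.id - (s : V →ₗ[ℂ] V)) ↔ s x = x := by
    change x - s x = 0 ↔ s x = x
    rw [sub_eq_zero, eq_comm]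
  rw [hker]
  refine ⟨fun h ↦ ?_, fun h y ↦ by simp [formRefl, movedProj_of_fixed hs h]⟩
  have h0 : (orderOf s : ℂ) ≠ 0 := Nat.cast_ne_zero.mpr hs.orderOf_pos.ne'
  have hpow (i : ℕ) (z w : V) (hw : s w = w) : ω ((s ^ i) z) w = ω z w := by
    induction i with
    | zero => rfl
    | succ i ih => rw [pow_succ', LinearEquiv.mul_apply, ← ih, ← hω ((s ^ i) z) w, hw]
  have horth (z w : V) (hw : s w = w) : ω (movedProj s z) w = 0 := by
    rw [movedProj_apply, map_sub, map_smul, map_sum, LinearMap.sub_apply, LinearMap.smul_apply,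
      LinearMap.sum_apply, Finset.sum_congr rfl fun i _ ↦ hpow i z w hw, Finset.sum_const,
      Finset.card_range, ← Nat.cast_smul_eq_nsmul ℂ, smul_smul, inv_mul_cancel₀ h0, one_smul,
      sub_self]
  have hz : movedProj s x = 0 := by
    refine hnd.1 _ fun y ↦ ?_
    have h1 : ω (movedProj s x) (movedProj s y) = 0 := h y
    have h2 := horth x _ (fixed_sub_movedProj (s := s) y)
    rw [map_sub, h1, sub_zero] at h2
    exact h2
  have := fixed_sub_movedProj (s := s) x
  rwa [hz, sub_zero] at this

end movedProj

/-- The smash product `TV # Γ`. -/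
def Smash := SkewMonoidAlgebra (TensorAlgebra ℂ V) Γ

instance instRingSmash : Ring (Smash Γ) :=
  inferInstanceAs (Ring (SkewMonoidAlgebra (TensorAlgebra ℂ V) Γ))

instance instAlgebraSmash : Algebra ℂ (Smash Γ) :=
  inferInstanceAs (Algebra ℂ (SkewMonoidAlgebra (TensorAlgebra ℂ V) Γ))

/-- The inclusion of `V` in `TV # Γ`. -/
def ofVec : V →ₗ[ℂ] Smash Γ where
  toFun x := SkewMonoidAlgebra.single 1 (TensorAlgebra.ι ℂ x)
  map_add' x y := by rw [map_add]; exact SkewMonoidAlgebra.single_add _ _ _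
  map_smul' r x := by rw [map_smul]; exact (SkewMonoidAlgebra.smul_single _ _ _).symm

/-- The inclusion of `Γ` in `TV # Γ`. -/
def ofGrp : Γ →* Smash Γ where
  toFun g := SkewMonoidAlgebra.single g 1
  map_one' := rfl
  map_mul' g h := by
    refine Eq.trans ?_ SkewMonoidAlgebra.single_mul_single.symm
    rw [smul_one, mul_one]

theorem ofGrp_mul_ofVec (g : Γ) (x : V) :
    ofGrp Γ g * ofVec Γ x = ofVec Γ ((g : V ≃ₗ[ℂ] V) x) * ofGrp Γ g := by
  have h : g • TensorAlgebra.ι ℂ x = TensorAlgebra.ι ℂ ((g : V ≃ₗ[ℂ] V) x) := by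
    change (g : V ≃ₗ[ℂ] V) • TensorAlgebra.ι ℂ x = _
    simp [smul_def]
  refine SkewMonoidAlgebra.single_mul_single.trans
    (Eq.trans ?_ SkewMonoidAlgebra.single_mul_single.symm)
  rw [h, smul_one, mul_one, one_mul, mul_one, one_mul]

variable [Fintype Γ]

open Classical in
/-- The element `∑_{s ∈ S} c_s ω_s(x, y) s` of the group algebra of `Γ`, inside `TV # Γ`. -/
def kappa (c : invariantFunctions Γ) (x y : V) : Smash Γ :=
  ∑ s : reflections Γ, (c.1 s * formRefl ω (s : Γ) x y) • ofGrp Γ (s : Γ)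

/-- The defining relations `x ⊗ y - y ⊗ x = t ω(x, y) 1 + ∑_{s ∈ S} c_s ω_s(x, y) s`. -/
inductive Rel (t : ℂ) (c : invariantFunctions Γ) : Smash Γ → Smash Γ → Prop
  | comm (x y : V) : Rel t c (ofVec Γ x * ofVec Γ y - ofVec Γ y * ofVec Γ x)
      ((t * ω x y) • 1 + kappa ω Γ c x y)

/-- The symplectic reflection algebra `H_{t,c}`: the quotient of `TV # Γ` by the two-sided ideal
generated by the defining relations. -/
def H (t : ℂ) (c : invariantFunctions Γ) := RingQuot (Rel ω Γ t c)

instance instRingH (t : ℂ) (c : invariantFunctions Γ) : Ring (H ω Γ t c) :=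
  inferInstanceAs (Ring (RingQuot (Rel ω Γ t c)))

instance instAlgebraH (t : ℂ) (c : invariantFunctions Γ) : Algebra ℂ (H ω Γ t c) :=
  inferInstanceAs (Algebra ℂ (RingQuot (Rel ω Γ t c)))

/-- The quotient map `TV # Γ → H_{t,c}`. -/
def H.mk (t : ℂ) (c : invariantFunctions Γ) : Smash Γ →ₐ[ℂ] H ω Γ t c :=
  RingQuot.mkAlgHom ℂ (Rel ω Γ t c)

/-- The same relations with `t` an indeterminate, in `(TV # Γ)[t]`. -/
inductive FamilyRel (c : invariantFunctions Γ) :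
    Polynomial (Smash Γ) → Polynomial (Smash Γ) → Prop
  | comm (x y : V) : FamilyRel c
      (Polynomial.C (ofVec Γ x * ofVec Γ y - ofVec Γ y * ofVec Γ x))
      (ω x y • Polynomial.X + Polynomial.C (kappa ω Γ c x y))

/-- The family `{H_{t,c}}_t`, viewed as a single `ℂ[t]`-algebra: the quotient of `(TV # Γ)[t]` by
the two-sided ideal generated by the defining relations with `t` an indeterminate. -/
def Family (c : invariantFunctions Γ) := RingQuot (FamilyRel ω Γ c)

instance instRingFamily (c : invariantFunctions Γ) : Ring (Family ω Γ c) :=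
  inferInstanceAs (Ring (RingQuot (FamilyRel ω Γ c)))

/-- The quotient map from `(TV # Γ)[t]` to the family. -/
def Family.mk (c : invariantFunctions Γ) : Polynomial (Smash Γ) →+* Family ω Γ c :=
  RingQuot.mkRingHom (FamilyRel ω Γ c)

/-- The deformation parameter `t` of the family. -/
def param (c : invariantFunctions Γ) : Family ω Γ c := Family.mk ω Γ c Polynomial.X

/-- The reduction `t ↦ 0` from the family to `H_{0,c}`. -/
def reduction (c : invariantFunctions Γ) : Family ω Γ c →+* H ω Γ 0 c :=
  RingQuot.lift ⟨(H.mk ω Γ 0 c : Smash Γ →+* H ω Γ 0 c).comp Polynomial.constantCoeff, by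
    rintro _ _ ⟨x, y⟩
    have h : H.mk ω Γ 0 c _ = H.mk ω Γ 0 c _ :=
      RingQuot.mkAlgHom_rel ℂ (Rel.comm (ω := ω) (Γ := Γ) (t := 0) (c := c) x y)
    simp only [zero_mul, zero_smul, zero_add] at h
    simpa [Polynomial.constantCoeff_apply] using h⟩

theorem reduction_mk (c : invariantFunctions Γ) (p : Polynomial (Smash Γ)) :
    reduction ω Γ c (Family.mk ω Γ c p) = H.mk ω Γ 0 c (p.coeff 0) :=
  RingQuot.lift_mkRingHom_apply _ _ _

theorem Family.mk_surjective (c : invariantFunctions Γ) :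
    Function.Surjective (Family.mk ω Γ c) := RingQuot.mkRingHom_surjective _

theorem reduction_surjective (c : invariantFunctions Γ) :
    Function.Surjective (reduction ω Γ c) := by
  intro a
  obtain ⟨a, rfl⟩ := RingQuot.mkAlgHom_surjective ℂ (Rel ω Γ 0 c) a
  exact ⟨Family.mk ω Γ c (Polynomial.C a), by
    rw [reduction_mk, Polynomial.coeff_C_zero]; rfl⟩

theorem param_comm (c : invariantFunctions Γ) (a : Family ω Γ c) :
    param ω Γ c * a = a * param ω Γ c := by
  obtain ⟨p, rfl⟩ := Family.mk_surjective ω Γ c a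
  rw [param, ← map_mul, ← map_mul, Polynomial.X_mul]

/-- The kernel of the reduction map is the ideal generated by `t`, that is, `H_{0,c}` is the
quotient of the family by `t`. -/
theorem reduction_eq_zero_iff (c : invariantFunctions Γ) (a : Family ω Γ c) :
    reduction ω Γ c a = 0 ↔ param ω Γ c ∣ a := by
  constructor
  · let I : TwoSidedIdeal (Family ω Γ c) := TwoSidedIdeal.mk' {a | param ω Γ c ∣ a}
      (dvd_zero _) (fun ha hb ↦ dvd_add ha hb) (fun ha ↦ (dvd_neg).mpr ha)
      (fun {x y} ⟨d, hd⟩ ↦ ⟨x * d, by rw [hd, ← mul_assoc, ← mul_assoc, param_comm]⟩)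
      (fun ha ↦ Dvd.dvd.mul_right ha _)
    let q : Family ω Γ c →+* I.ringCon.Quotient := I.ringCon.mk'
    have hq (b : Family ω Γ c) : q b = 0 ↔ param ω Γ c ∣ b := by
      have h1 : q b = 0 ↔ I.ringCon b 0 := by
        rw [← map_zero q]; exact RingCon.eq _
      rw [h1, ← TwoSidedIdeal.mem_iff]
      exact TwoSidedIdeal.mem_mk' _ _ _ _ _ _ _
    let f : Smash Γ →+* I.ringCon.Quotient := q.comp ((Family.mk ω Γ c).comp Polynomial.C)
    have hX : q (Family.mk ω Γ c Polynomial.X) = 0 := (hq _).2 dvd_rfl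
    have hf : ∀ ⦃x y⦄, Rel ω Γ 0 c x y → f x = f y := by
      rintro _ _ ⟨x, y⟩
      have h : Family.mk ω Γ c _ = Family.mk ω Γ c _ :=
        RingQuot.mkRingHom_rel (FamilyRel.comm (ω := ω) (Γ := Γ) (c := c) x y)
      have h2 : ω x y • (Polynomial.X : Polynomial (Smash Γ)) =
          Polynomial.C (ω x y • 1) * Polynomial.X := by
        rw [← Polynomial.smul_eq_C_mul, smul_assoc, one_smul]
      change q (Family.mk ω Γ c _) = q (Family.mk ω Γ c _)
      rw [h, map_add, map_add, h2, map_mul, map_mul, hX, mul_zero, zero_add, zero_mul, zero_smul,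
        zero_add]
    let g : H ω Γ 0 c →+* I.ringCon.Quotient := RingQuot.lift ⟨f, hf⟩
    have hg (b : Family ω Γ c) : g (reduction ω Γ c b) = q b := by
      obtain ⟨p, rfl⟩ := Family.mk_surjective ω Γ c b
      have h1 : g (H.mk ω Γ 0 c (p.coeff 0)) = f (p.coeff 0) := by
        have : H.mk ω Γ 0 c (p.coeff 0) = RingQuot.mkRingHom (Rel ω Γ 0 c) (p.coeff 0) :=
          congrArg (fun F : Smash Γ →+* RingQuot (Rel ω Γ 0 c) ↦ F (p.coeff 0))
            (RingQuot.mkAlgHom_coe ℂ (Rel ω Γ 0 c))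
        rw [this]
        exact RingQuot.lift_mkRingHom_apply _ _ _
      rw [reduction_mk, h1]
      conv_rhs => rw [← Polynomial.divX_mul_X_add p]
      rw [map_add, map_mul, map_add, map_mul, hX, mul_zero, zero_add]
      rfl
    intro ha
    rw [← hq, ← hg, ha, map_zero]
  · rintro ⟨d, rfl⟩
    rw [map_mul, param, reduction_mk, Polynomial.coeff_X_zero, map_zero, zero_mul]

/-- The symmetriser `e = |Γ|⁻¹ ∑_{g ∈ Γ} g`, inside `TV # Γ`. -/
def symmetriser : Smash Γ := (Fintype.card Γ : ℂ)⁻¹ • ∑ g : Γ, ofGrp Γ g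

theorem symmetriser_idem : IsIdempotentElem (symmetriser Γ) := by
  have h1 : ∀ g : Γ, ofGrp Γ g * ∑ h : Γ, ofGrp Γ h = ∑ h : Γ, ofGrp Γ h := by
    intro g
    rw [Finset.mul_sum]
    simp only [ofGrp, ← map_mul]
    exact Fintype.sum_equiv (Equiv.mulLeft g) _ _ fun _ ↦ rfl
  have h2 : (∑ g : Γ, ofGrp Γ g) * ∑ h : Γ, ofGrp Γ h =
      (Fintype.card Γ : ℂ) • ∑ h : Γ, ofGrp Γ h := by
    rw [Finset.sum_mul, Finset.sum_congr rfl fun g _ ↦ h1 g]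
    simp [Finset.card_univ, Nat.cast_smul_eq_nsmul]
  have h0 : (Fintype.card Γ : ℂ) ≠ 0 := Nat.cast_ne_zero.mpr Fintype.card_ne_zero
  unfold IsIdempotentElem symmetriser
  rw [smul_mul_smul_comm, h2, smul_smul, mul_assoc, inv_mul_cancel₀ h0, mul_one]

/-- The symmetriser in `H_{t,c}`. -/
def e (t : ℂ) (c : invariantFunctions Γ) : H ω Γ t c :=
  H.mk ω Γ t c (symmetriser Γ)

theorem e_idem (t : ℂ) (c : invariantFunctions Γ) : IsIdempotentElem (e ω Γ t c) :=
  (symmetriser_idem Γ).map _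

/-- The spherical subalgebra `e H_{t,c} e`, an algebra with unit `e`. -/
abbrev Spherical (t : ℂ) (c : invariantFunctions Γ) := (e_idem ω Γ t c).Corner

/-- The symmetriser in the family. -/
def familyE (c : invariantFunctions Γ) : Family ω Γ c :=
  Family.mk ω Γ c (Polynomial.C (symmetriser Γ))

theorem familyE_idem (c : invariantFunctions Γ) : IsIdempotentElem (familyE ω Γ c) :=
  ((symmetriser_idem Γ).map Polynomial.C).map _

/-- The family `{e H_{t,c} e}_t`, viewed as a single `ℂ[t]`-algebra. -/
abbrev SphericalFamily (c : invariantFunctions Γ) := (familyE_idem ω Γ c).Corner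

theorem reduction_familyE (c : invariantFunctions Γ) :
    reduction ω Γ c (familyE ω Γ c) = e ω Γ 0 c := by
  rw [familyE, reduction_mk, Polynomial.coeff_C_zero, e]

/-- The deformation parameter of the spherical family, that is, `t` times its unit `e`. -/
def sphericalParam (c : invariantFunctions Γ) : SphericalFamily ω Γ c :=
  ⟨familyE ω Γ c * param ω Γ c * familyE ω Γ c, param ω Γ c, rfl⟩

/-- The reduction `t ↦ 0` from the spherical family to `e H_{0,c} e`. -/
def sphericalReduction (c : invariantFunctions Γ) :
    SphericalFamily ω Γ c →+* Spherical ω Γ 0 c :=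
  cornerMap (reduction ω Γ c) (familyE_idem ω Γ c) (e_idem ω Γ 0 c) (reduction_familyE ω Γ c)

theorem sphericalReduction_surjective (c : invariantFunctions Γ) :
    Function.Surjective (sphericalReduction ω Γ c) := by
  rintro ⟨_, a, rfl⟩
  obtain ⟨a, rfl⟩ := reduction_surjective ω Γ c a
  refine ⟨⟨_, a, rfl⟩, Subtype.ext ?_⟩
  change reduction ω Γ c (familyE ω Γ c * a * familyE ω Γ c) = _
  rw [map_mul, map_mul, reduction_familyE]

/-- `e H_{0,c} e` is the quotient of the spherical family by `t`. -/
theorem sphericalReduction_eq_zero_iff (c : invariantFunctions Γ) (a : SphericalFamily ω Γ c) :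
    sphericalReduction ω Γ c a = 0 ↔ sphericalParam ω Γ c ∣ a := by
  have hE : familyE ω Γ c * familyE ω Γ c = familyE ω Γ c := familyE_idem ω Γ c
  constructor
  · intro ha
    obtain ⟨h1, h2⟩ := (Subsemigroup.mem_corner_iff (familyE_idem ω Γ c)).1 a.2
    obtain ⟨d, hd⟩ := (reduction_eq_zero_iff ω Γ c a.1).1 (congrArg Subtype.val ha)
    refine ⟨⟨_, d, rfl⟩, Subtype.ext ?_⟩
    change a.1 = familyE ω Γ c * param ω Γ c * familyE ω Γ c *
      (familyE ω Γ c * d * familyE ω Γ c)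
    have h3 : familyE ω Γ c * param ω Γ c * familyE ω Γ c *
        (familyE ω Γ c * d * familyE ω Γ c) =
        familyE ω Γ c * (param ω Γ c * d) * familyE ω Γ c := by
      calc familyE ω Γ c * param ω Γ c * familyE ω Γ c * (familyE ω Γ c * d * familyE ω Γ c)
          = familyE ω Γ c * (param ω Γ c * (familyE ω Γ c * familyE ω Γ c)) * d *
              familyE ω Γ c := by simp only [mul_assoc]
        _ = familyE ω Γ c * (param ω Γ c * d) * familyE ω Γ c := by
            rw [hE, param_comm, ← mul_assoc (familyE ω Γ c) (familyE ω Γ c), hE]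
            simp only [mul_assoc]
    rw [h3, ← hd, h1, h2]
  · rintro ⟨d, rfl⟩
    rw [map_mul]
    have h : sphericalReduction ω Γ c (sphericalParam ω Γ c) = 0 := by
      refine Subtype.ext ?_
      change reduction ω Γ c (familyE ω Γ c * param ω Γ c * familyE ω Γ c) = 0
      rw [map_mul, map_mul, (reduction_eq_zero_iff ω Γ c _).2 dvd_rfl, mul_zero, zero_mul]
    rw [h, zero_mul]

end SympRefl

end

/-! ### Sorting words -/

/-! Everything rests on a PBW theorem, valid for `H` and for the family over `ℂ[t]`: as a module the
algebra is polynomials tensored with the group algebra. To prove it, a functional on `TV # Γ` is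
built by sorting words and collecting the corrections `∑ κ_g(x, y) g` caused by swaps of letters
(`normalForm`). It respects the relations as soon as the corrections are consistent for disjoint
swaps and for the hexagon of three letters (`IsSwapCost.sortCost_swap`). Consistency for disjoint
swaps uses the equivariance of `κ`, and the hexagon is the Jacobi identity, which holds because `Im
(Id - s)` is a plane for `s` in `S` (`formRefl_jacobi`).

Write `B` for the algebra and `e` for the symmetriser. By PBW, `B e` is identified with polynomials
(`theta`), and leading terms of elements of `e B e` are invariant polynomials. The input from
invariant theory is that a nontrivial element of a finite symplectic group never acts as a
reflection. This gives two dual systems with coprime denominators (`isGenericAction`), whence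
endomorphisms of polynomials over the invariants are combinations of group elements, and derivations
of the invariants extend to all polynomials.

Commutativity of `e B e` at `t = 0` (`PBWAlgebra.spherical_comm`): the part of degree `-2` of the
commutator only involves the unit component `t ω` of `κ`, the other group elements cancelling by the
Jacobi identity (`sum_form_grad_eq_zero`). So at `t = 0` commutators drop degree by at least three.
If they drop it by at least `d ≥ 3`, the part of degree `-d` is a biderivation of the invariants; it
extends to a bivector with coefficients of degree at most `2 - d < 0`, hence vanishes. Thus
commutators drop degree by any amount and are zero.

The map `z ↦ z e` is bijective by a double centraliser argument. `B` acts faithfully on `B e`, and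
an endomorphism of `B e` over `e B e` that raises degrees by a bounded amount is left multiplication
by an element of `B`, which is found by correcting leading terms. Since `e B e` is commutative,
right multiplication by an element of it is such an endomorphism, and the resulting element of `B`
is central.

Finally `t` is a nonzero divisor in the family, so commutators can be divided by it. Comparing lifts
of `z` and of `z e`, all correction terms vanish modulo `t` (`map_corner_commutator`). The exponent
is one unless `V = 0`, because `ω` pairs some invariants nontrivially. -/

section Sorting

variable {ι M : Type*} [LinearOrder ι] [AddCommGroup M]

/-- The sum of the costs `φ a x y b` of the swaps `a x y b → a y x b` made when inserting `x` into
the ordered word `w`, in the presence of the prefix `p`. -/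
def insertCost (φ : List ι → ι → ι → List ι → M) : List ι → ι → List ι → M
  | _, _, [] => 0
  | p, x, y :: w => if x ≤ y then 0 else φ p x y w + insertCost φ (p ++ [y]) x w

/-- The sum of the costs `φ a x y b` of the swaps `a x y b → a y x b` made when sorting the word
`w` by insertion, in the presence of the prefix `p`. -/
def sortCost (φ : List ι → ι → ι → List ι → M) : List ι → List ι → M
  | _, [] => 0
  | p, x :: w => sortCost φ (p ++ [x]) w + insertCost φ p x (w.insertionSort (· ≤ ·))

/-- Consistency of a cost function for the swaps of adjacent letters in words. -/
structure IsSwapCost (φ : List ι → ι → ι → List ι → M) : Prop where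
  self : ∀ a x b, φ a x x b = 0
  antisymm : ∀ a x y b, φ a x y b = -φ a y x b
  disjoint : ∀ a x y b u v c, φ a x y (b ++ u :: v :: c) - φ a x y (b ++ v :: u :: c) =
    φ (a ++ x :: y :: b) u v c - φ (a ++ y :: x :: b) u v c
  hexagon : ∀ a x y z b, φ a x y (z :: b) + φ (a ++ [y]) x z b + φ a y z (x :: b) =
    φ (a ++ [x]) y z b + φ a x z (y :: b) + φ (a ++ [z]) x y b

namespace IsSwapCost

variable {φ : List ι → ι → ι → List ι → M} (h : IsSwapCost φ)
include h

/-- The letter `z` passes the letters of `c` one at a time. By `disjoint`, each step contributes the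
change that it causes in the cost of swapping `x` and `y`, and these changes telescope. -/
theorem insertCost_swap_prefix (a : List ι) (x y z : ι) (b c : List ι) :
    insertCost φ (a ++ x :: y :: b) z c - insertCost φ (a ++ y :: x :: b) z c =
      φ a x y (b ++ z :: c) - φ a x y (b ++ c.orderedInsert (· ≤ ·) z) := by
  induction c generalizing b with
  | nil => simp [insertCost]
  | cons w c ih =>
    by_cases hw : z ≤ w
    · simp [insertCost, hw, List.orderedInsert]
    · have h1 := ih (b ++ [w])
      have h2 := h.disjoint a x y b z w c
      simp only [insertCost, hw, List.orderedInsert, if_false, List.append_assoc, List.cons_append,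
        List.nil_append] at h1 h2 ⊢
      rw [add_sub_add_comm, h1, ← h2]
      abel

theorem sortCost_swap_prefix (a : List ι) (x y : ι) (b w : List ι) :
    sortCost φ (a ++ x :: y :: b) w - sortCost φ (a ++ y :: x :: b) w =
      φ a x y (b ++ w) - φ a x y (b ++ w.insertionSort (· ≤ ·)) := by
  induction w generalizing b with
  | nil => simp [sortCost]
  | cons z w ih =>
    have h1 := ih (b ++ [z])
    have h2 := h.insertCost_swap_prefix a x y z b (w.insertionSort (· ≤ ·))
    simp only [sortCost, List.append_assoc, List.cons_append, List.nil_append,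
      List.insertionSort] at h1 h2 ⊢
    rw [add_sub_add_comm, h1, h2]
    abel

/-- Two routes lead to the same ordered word and differ by the initial swap of `x` and `y`. When
both letters pass `z`, the routes enclose the hexagon of the three letters; otherwise the comparison
is immediate. -/
theorem insertCost_swap (p : List ι) (x y : ι) (c : List ι) :
    insertCost φ (p ++ [x]) y c + insertCost φ p x (c.orderedInsert (· ≤ ·) y) -
      (insertCost φ (p ++ [y]) x c + insertCost φ p y (c.orderedInsert (· ≤ ·) x)) =
      φ p x y c := by
  induction c generalizing p with
  | nil =>
    rcases lt_trichotomy x y with hxy | rfl | hxy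
    · simp [insertCost, hxy.le, hxy.not_ge, h.antisymm p x y]
    · simp [h.self]
    · simp [insertCost, hxy.le, hxy.not_ge]
  | cons z c ih =>
    have h1 := ih (p ++ [z])
    have h2 := h.insertCost_swap_prefix p x z y [] c
    have h3 := h.insertCost_swap_prefix p y z x [] c
    have h4 := h.hexagon p x y z c
    by_cases hx : x ≤ z <;> by_cases hy : y ≤ z
    · rcases lt_trichotomy x y with hxy | rfl | hxy
      · simp [insertCost, hxy.le, hxy.not_ge, hx, hy, List.orderedInsert, h.antisymm p x y]
      · simp [h.self]
      · simp [insertCost, hxy.le, hxy.not_ge, hx, hy, List.orderedInsert]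
    · have hxy : x < y := lt_of_le_of_lt hx (not_le.1 hy)
      simp [insertCost, hxy.not_ge, hx, hy, List.orderedInsert, h.antisymm p x y]
    · have hxy : y < x := lt_of_le_of_lt hy (not_le.1 hx)
      simp [insertCost, hxy.not_ge, hx, hy, List.orderedInsert]
    · simp only [insertCost, hx, hy, List.orderedInsert, if_false, List.append_assoc,
        List.cons_append, List.nil_append] at h1 h2 h3 h4 ⊢
      rw [← sub_eq_zero] at h1 h2 h3 h4 ⊢
      -- The combination adds the induction hypothesis and one change of prefix, and subtracts the
      -- hexagon and the other change of prefix.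
      have h5 := congrArg₂ (· - ·) (congrArg₂ (· + ·) h1 h2) (congrArg₂ (· + ·) h4 h3)
      simp only [add_zero, sub_zero] at h5
      rw [← h5]
      abel

/-- A consistent cost function is a coboundary, with potential `sortCost`. This takes the place of a
confluence argument: the cost of one chosen sorting path is compatible with every swap. -/
theorem sortCost_swap (p a : List ι) (x y : ι) (b : List ι) :
    sortCost φ p (a ++ x :: y :: b) - sortCost φ p (a ++ y :: x :: b) = φ (p ++ a) x y b := by
  induction a generalizing p with
  | nil =>
    have h1 := h.insertCost_swap p x y (b.insertionSort (· ≤ ·))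
    have h2 := h.sortCost_swap_prefix p x y [] b
    simp only [sortCost, List.append_assoc, List.cons_append, List.nil_append, List.append_nil,
      List.insertionSort_cons] at h1 h2 ⊢
    rw [← sub_eq_zero] at h1 h2 ⊢
    rw [← add_zero (0 : M)]
    nth_rw 1 [← h1]
    rw [← h2]
    abel
  | cons z a ih =>
    -- Letters in front of the swap are inserted into the same ordered tail in both words, so their
    -- costs cancel.
    have hs : (a ++ x :: y :: b).insertionSort (· ≤ ·) =
        (a ++ y :: x :: b).insertionSort (· ≤ ·) :=
      ((List.perm_insertionSort _ _).trans (((List.Perm.swap y x b).append_left a).trans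
        (List.perm_insertionSort _ _).symm)).eq_of_sortedLE (List.sortedLE_insertionSort)
        (List.sortedLE_insertionSort)
    rw [List.cons_append, List.cons_append, sortCost, sortCost, hs, add_sub_add_right_eq_sub,
      ih, List.append_assoc, List.singleton_append]

end IsSwapCost

theorem insertCost_of_le (φ : List ι → ι → ι → List ι → M) (p : List ι) (x : ι) (w : List ι)
    (hw : ∀ y ∈ w, x ≤ y) : insertCost φ p x w = 0 := by
  cases w with
  | nil => rfl
  | cons y w => simp [insertCost, hw y]

theorem sortCost_of_sorted (φ : List ι → ι → ι → List ι → M) (p w : List ι)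
    (hw : w.Pairwise (· ≤ ·)) : sortCost φ p w = 0 := by
  induction w generalizing p with
  | nil => rfl
  | cons x w ih =>
    rw [List.pairwise_cons] at hw
    rw [sortCost, ih _ hw.2, zero_add, insertCost_of_le]
    intro y hy
    exact hw.1 y (by simpa using hy)

theorem insertCost_eq_zero {φ : List ι → ι → ι → List ι → M} {n : ℕ}
    (h : ∀ a x y b, a.length + b.length + 2 = n → φ a x y b = 0) (p : List ι) (x : ι) (w : List ι)
    (hn : p.length + w.length + 1 = n) : insertCost φ p x w = 0 := by
  induction w generalizing p with
  | nil => rfl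
  | cons y w ih =>
    rw [List.length_cons] at hn
    rw [insertCost, h _ _ _ _ (by omega), ih _ (by simp; omega), add_zero, ite_self]

/-- Swaps preserve the total length, prefix included, so only the costs in that length matter. -/
theorem sortCost_eq_zero {φ : List ι → ι → ι → List ι → M} {n : ℕ}
    (h : ∀ a x y b, a.length + b.length + 2 = n → φ a x y b = 0) (p w : List ι)
    (hn : p.length + w.length = n) : sortCost φ p w = 0 := by
  induction w generalizing p with
  | nil => rfl
  | cons y w ih =>
    rw [List.length_cons] at hn
    rw [sortCost, ih _ (by simp; omega), insertCost_eq_zero h _ _ _ (by simp; omega), add_zero]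

end Sorting

noncomputable section

/-! ### The normal form functional on the tensor algebra -/

theorem Module.Basis.induction {ι R V : Type*} [CommRing R] [AddCommGroup V] [Module R V]
    (b : Module.Basis ι R V) {p : V → Prop} (hb : ∀ i, p (b i)) (h0 : p 0)
    (hadd : ∀ x y, p x → p y → p (x + y)) (hsmul : ∀ (r : R) x, p x → p (r • x)) (v : V) : p v := by
  have hv : v ∈ Submodule.span R (Set.range b) := by rw [b.span_eq]; trivial
  induction hv using Submodule.span_induction with
  | mem x hx => obtain ⟨i, rfl⟩ := hx; exact hb i
  | zero => exact h0
  | add x y _ _ hx hy => exact hadd x y hx hy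
  | smul r x _ hx => exact hsmul r x hx

namespace SympRefl

variable {V : Type*} [AddCommGroup V] [Module ℂ V] {Γ : Subgroup (V ≃ₗ[ℂ] V)}
  {ι : Type*}

theorem smul_ι (g : Γ) (x : V) : g • TensorAlgebra.ι ℂ x =
    TensorAlgebra.ι ℂ ((g : V ≃ₗ[ℂ] V) x) := by
  change (g : V ≃ₗ[ℂ] V) • TensorAlgebra.ι ℂ x = _
  simp [smul_def]

/-- The monomial in the tensor algebra of `V` given by a word in the elements of a basis. -/
def word (b : Module.Basis ι ℂ V) (w : List ι) : TensorAlgebra ℂ V :=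
  (w.map fun i ↦ TensorAlgebra.ι ℂ (b i)).prod

@[simp] theorem word_nil (b : Module.Basis ι ℂ V) : word b [] = 1 := rfl

@[simp] theorem word_cons (b : Module.Basis ι ℂ V) (i : ι) (w : List ι) :
    word b (i :: w) = TensorAlgebra.ι ℂ (b i) * word b w := by simp [word]

@[simp] theorem word_append (b : Module.Basis ι ℂ V) (w w' : List ι) :
    word b (w ++ w') = word b w * word b w' := by simp [word]

theorem word_mul_comm_mul_word (b : Module.Basis ι ℂ V) (u w : List ι) (i j : ι) :
    word b u * (TensorAlgebra.ι ℂ (b i) * TensorAlgebra.ι ℂ (b j) -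
        TensorAlgebra.ι ℂ (b j) * TensorAlgebra.ι ℂ (b i)) * word b w =
      word b (u ++ i :: j :: w) - word b (u ++ j :: i :: w) := by
  simp only [word_append, word_cons]
  noncomm_ring

/-- The words in the elements of a basis of `V` are a basis of the tensor algebra. -/
def wordBasis (b : Module.Basis ι ℂ V) : Module.Basis (List ι) ℂ (TensorAlgebra ℂ V) :=
  b.tensorAlgebra.reindex FreeMonoid.toList

theorem wordBasis_apply (b : Module.Basis ι ℂ V) (w : List ι) : wordBasis b w = word b w := by
  have h0 : wordBasis b w = (TensorAlgebra.equivFreeAlgebra b).symm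
      (FreeAlgebra.equivMonoidAlgebraFreeMonoid.symm
        (MonoidAlgebra.single (FreeMonoid.ofList w) 1)) := by
    rw [wordBasis, Module.Basis.reindex_apply, Module.Basis.tensorAlgebra, Module.Basis.map_apply,
      FreeAlgebra.basisFreeMonoid, Module.Basis.map_apply, Finsupp.coe_basisSingleOne]
    rfl
  have h : FreeAlgebra.equivMonoidAlgebraFreeMonoid.symm
      (MonoidAlgebra.single (FreeMonoid.ofList w) (1 : ℂ)) =
      (w.map (FreeAlgebra.ι ℂ)).prod := by
    refine (MonoidAlgebra.lift_single _ _ _).trans ?_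
    rw [one_smul]
    exact FreeMonoid.lift_apply _ _
  rw [h0, h, map_list_prod, List.map_map, word]
  congr 2
  funext i
  exact TensorAlgebra.equivFreeAlgebra_symm_ι b i

/-- The span of the words of length `n`. -/
def wordSpan (b : Module.Basis ι ℂ V) (n : ℕ) : Submodule ℂ (TensorAlgebra ℂ V) :=
  Submodule.span ℂ (word b '' {w | w.length = n})

theorem word_mem (b : Module.Basis ι ℂ V) {w : List ι} {n : ℕ} (h : w.length = n) :
    word b w ∈ wordSpan b n :=
  Submodule.subset_span ⟨w, h, rfl⟩

theorem ι_mem (b : Module.Basis ι ℂ V) (x : V) : TensorAlgebra.ι ℂ x ∈ wordSpan b 1 := by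
  induction x using b.induction with
  | hb i => simpa using word_mem b (w := [i]) rfl
  | h0 => simp
  | hadd x y hx hy => rw [map_add]; exact add_mem hx hy
  | hsmul r x hx => rw [map_smul]; exact Submodule.smul_mem _ _ hx

theorem mul_mem_wordSpan {b : Module.Basis ι ℂ V} {m n l : ℕ} {u v : TensorAlgebra ℂ V}
    (hu : u ∈ wordSpan b m) (hv : v ∈ wordSpan b n) (h : m + n = l) : u * v ∈ wordSpan b l := by
  have := Submodule.mul_mem_mul hu hv
  rw [wordSpan, wordSpan, Submodule.span_mul_span] at this
  refine Submodule.span_mono ?_ this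
  rintro _ ⟨_, ⟨w, hw, rfl⟩, _, ⟨w', hw', rfl⟩, rfl⟩
  refine ⟨w ++ w', ?_, word_append _ _ _⟩
  simp only [Set.mem_ofPred_eq] at hw hw' ⊢
  rw [List.length_append, hw, hw', h]

theorem smul_word_mem (b : Module.Basis ι ℂ V) (g : Γ) (w : List ι) :
    g • word b w ∈ wordSpan b w.length := by
  induction w with
  | nil => rw [word_nil, smul_one]; exact word_mem b (w := []) rfl
  | cons i w ih =>
    rw [word_cons, smul_mul', smul_ι]
    exact mul_mem_wordSpan (ι_mem b _) ih (by simp [add_comm])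

variable {k M : Type*} [CommRing k] [Algebra ℂ k]

/-- The conditions on a family of forms `κ` under which `[x, y] = ∑ κ_g(x, y) g` defines a flat
deformation of `SV # Γ`. -/
structure IsFlatForm (κ : Γ → V →ₗ[ℂ] V →ₗ[ℂ] k) : Prop where
  self : ∀ g x, κ g x x = 0
  equivariant : ∀ (h g : Γ) (x y : V),
    κ (h * g * h⁻¹) ((h : V ≃ₗ[ℂ] V) x) ((h : V ≃ₗ[ℂ] V) y) = κ g x y
  jacobi : ∀ (g : Γ) (x y z : V) (f : Module.Dual ℂ V),
    κ g x y * algebraMap ℂ k (f (z - (g : V ≃ₗ[ℂ] V) z)) +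
      κ g y z * algebraMap ℂ k (f (x - (g : V ≃ₗ[ℂ] V) x)) +
      κ g z x * algebraMap ℂ k (f (y - (g : V ≃ₗ[ℂ] V) y)) = 0

variable [AddCommGroup M] [Module k M] [Module ℂ M] [IsScalarTower ℂ k M]

/-- The Jacobi axiom is tested on functionals; expanding `l` in a finite basis carries it over to
values in `M`. -/
theorem IsFlatForm.jacobi_map [Fintype ι] {κ : Γ → V →ₗ[ℂ] V →ₗ[ℂ] k} (h : IsFlatForm κ)
    (b : Module.Basis ι ℂ V) (g : Γ) (x y z : V) (l : V →ₗ[ℂ] M) :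
    κ g x y • l (z - (g : V ≃ₗ[ℂ] V) z) + κ g y z • l (x - (g : V ≃ₗ[ℂ] V) x) +
      κ g z x • l (y - (g : V ≃ₗ[ℂ] V) y) = 0 := by
  have hl (v : V) : l v = ∑ i, algebraMap ℂ k (b.repr v i) • l (b i) := by
    calc l v = l (∑ i, b.repr v i • b i) := by rw [b.sum_repr]
      _ = _ := by simp only [map_sum, map_smul, algebraMap_smul]
  rw [hl (z - _), hl (x - _), hl (y - _)]
  simp only [Finset.smul_sum, smul_smul, ← Finset.sum_add_distrib, ← add_smul]
  refine Finset.sum_eq_zero fun i _ ↦ ?_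
  have := h.jacobi g x y z (b.coord i)
  simp only [Module.Basis.coord_apply] at this
  rw [this, zero_smul]

variable [Fintype Γ]

/-- The value that a linear map `L` on `TV`, extended to `TV # Γ` by a right action `ρ` of `Γ`,
takes on `a (∑_g κ_g(x, y) g) b`. -/
def swapTerm (κ : Γ → V →ₗ[ℂ] V →ₗ[ℂ] k) (ρ : Γ → M →ₗ[k] M) (L : TensorAlgebra ℂ V →ₗ[ℂ] M)
    (a : TensorAlgebra ℂ V) (x y : V) (c : TensorAlgebra ℂ V) : M :=
  ∑ g : Γ, κ g x y • ρ g (L (a * g • c))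

section swapTerm

variable (κ : Γ → V →ₗ[ℂ] V →ₗ[ℂ] k) (ρ : Γ → M →ₗ[k] M)

/-- Both sides are linear in each of the four arguments. The maps `L` and `L'` are kept separate
because they will be consecutive components of the normal form. -/
theorem ext_swapTerm (b : Module.Basis ι ℂ V) (L L' : TensorAlgebra ℂ V →ₗ[ℂ] M)
    (h : ∀ (u w : List ι) (i j : ι),
      L (word b u * (TensorAlgebra.ι ℂ (b i) * TensorAlgebra.ι ℂ (b j) -
        TensorAlgebra.ι ℂ (b j) * TensorAlgebra.ι ℂ (b i)) * word b w) =
        swapTerm κ ρ L' (word b u) (b i) (b j) (word b w))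
    (a : TensorAlgebra ℂ V) (x y : V) (c : TensorAlgebra ℂ V) :
    L (a * (TensorAlgebra.ι ℂ x * TensorAlgebra.ι ℂ y -
        TensorAlgebra.ι ℂ y * TensorAlgebra.ι ℂ x) * c) = swapTerm κ ρ L' a x y c := by
  have hsm (r : ℂ) (m : M) : r • m = algebraMap ℂ k r • m := (algebraMap_smul k r m).symm
  induction a using (wordBasis b).induction with
  | h0 => simp [swapTerm]
  | hadd a a' ha ha' => simp only [swapTerm, add_mul, map_add, ha, ha', smul_add,
      Finset.sum_add_distrib]
  | hsmul r a ha =>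
    rw [smul_mul_assoc, smul_mul_assoc, map_smul, ha]
    simp only [swapTerm, hsm, Finset.smul_sum, smul_mul_assoc, map_smul, smul_smul, mul_comm]
  | hb u =>
  induction c using (wordBasis b).induction with
  | h0 => simp [swapTerm]
  | hadd a a' ha ha' => simp only [swapTerm, mul_add, smul_add, map_add, ha, ha',
      Finset.sum_add_distrib]
  | hsmul r a ha =>
    rw [mul_smul_comm, map_smul, ha]
    simp only [swapTerm, hsm, Finset.smul_sum, smul_comm _ r a, mul_smul_comm, map_smul, smul_smul,
      mul_comm]
  | hb w =>
  induction x using b.induction with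
  | h0 => simp [swapTerm]
  | hadd x x' hx hx' =>
    simp only [swapTerm, map_add, LinearMap.add_apply, add_smul, Finset.sum_add_distrib] at hx hx' ⊢
    rw [← hx, ← hx', ← map_add L]
    congr 1
    noncomm_ring
  | hsmul r x hx =>
    rw [map_smul, smul_mul_assoc, mul_smul_comm, ← smul_sub, mul_smul_comm, smul_mul_assoc,
      map_smul, hx, swapTerm, swapTerm]
    simp only [map_smul, LinearMap.smul_apply, smul_assoc, Finset.smul_sum]
  | hb i =>
  induction y using b.induction with
  | h0 => simp [swapTerm]
  | hadd x x' hx hx' =>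
    simp only [swapTerm, map_add, add_smul, Finset.sum_add_distrib] at hx hx' ⊢
    rw [← hx, ← hx', ← map_add L]
    congr 1
    noncomm_ring
  | hsmul r x hx =>
    rw [map_smul, smul_mul_assoc, mul_smul_comm, ← smul_sub, mul_smul_comm, smul_mul_assoc,
      map_smul, hx, swapTerm, swapTerm]
    simp only [map_smul, smul_assoc, Finset.smul_sum]
  | hb j =>
  rw [wordBasis_apply, wordBasis_apply, h]

variable {κ ρ} [Fintype ι]

/-- Each condition on `κ` supplies part of the consistency: alternation gives the first two fields,
equivariance the third, and the Jacobi identity the hexagon. The commutator rule `h`, one level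
down, enters only for disjoint swaps. -/
theorem isSwapCost_swapTerm (hκ : IsFlatForm κ) (hρ : ∀ g h m, ρ h (ρ g m) = ρ (g * h) m)
    (b : Module.Basis ι ℂ V) {L L' : TensorAlgebra ℂ V →ₗ[ℂ] M}
    (h : ∀ a x y c, L (a * (TensorAlgebra.ι ℂ x * TensorAlgebra.ι ℂ y -
      TensorAlgebra.ι ℂ y * TensorAlgebra.ι ℂ x) * c) = swapTerm κ ρ L' a x y c) :
    IsSwapCost fun u i j w ↦ swapTerm κ ρ L (word b u) (b i) (b j) (word b w) where
  self a x w := by simp [swapTerm, hκ.self]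
  antisymm a x y w := by
    have h1 (g : Γ) : κ g (b x) (b y) = - κ g (b y) (b x) := by
      have := hκ.self g (b x + b y)
      simp only [map_add, LinearMap.add_apply, hκ.self, zero_add, add_zero] at this
      exact eq_neg_of_add_eq_zero_right this
    simp only [swapTerm, h1 _, neg_smul, Finset.sum_neg_distrib]
  disjoint a x y w u v c := by
    -- Here `g` stands to the left of the pair `u`, `v` and acts on it; reindexing the sum by
    -- conjugation lets equivariance remove `g` from the arguments of `κ`.
    have h1 (g : Γ) : L (word b a * g • word b (w ++ u :: v :: c)) -
        L (word b a * g • word b (w ++ v :: u :: c)) =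
        ∑ l : Γ, κ l (b u) (b v) • ρ (g * l * g⁻¹) (L' (word b a * g • word b w *
          (g * l) • word b c)) := by
      have h2 := h (word b a * g • word b w) ((g : V ≃ₗ[ℂ] V) (b u)) ((g : V ≃ₗ[ℂ] V) (b v))
        (g • word b c)
      rw [← map_sub]
      refine Eq.trans (congrArg L ?_) (h2.trans ?_)
      · simp only [word_append, word_cons, smul_mul', smul_ι]
        noncomm_ring
      · rw [swapTerm]
        refine (Fintype.sum_equiv (MulAut.conj g).toEquiv _ _ fun l ↦ ?_).symm
        simp only [MulEquiv.toEquiv_eq_coe, EquivLike.coe_coe, MulAut.conj_apply]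
        rw [hκ.equivariant, smul_smul, inv_mul_cancel_right]
    have h3 (l : Γ) : L (word b (a ++ x :: y :: w) * l • word b c) -
        L (word b (a ++ y :: x :: w) * l • word b c) =
        ∑ g : Γ, κ g (b x) (b y) • ρ g (L' (word b a * g • word b w *
          (g * l) • word b c)) := by
      rw [← map_sub]
      refine Eq.trans (congrArg L ?_) ((h (word b a) (b x) (b y) (word b w * l • word b c)).trans ?_)
      · simp only [word_append, word_cons]
        noncomm_ring
      · simp only [swapTerm, smul_mul', smul_smul, mul_assoc]
    simp only [swapTerm]
    rw [← Finset.sum_sub_distrib, ← Finset.sum_sub_distrib]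
    simp only [← smul_sub, ← map_sub, h1, h3, map_sum, map_smul, Finset.smul_sum, hρ,
      inv_mul_cancel_right]
    -- Both sides have become the same double sum, with the group element `g * l` acting.
    rw [Finset.sum_comm]
    exact Finset.sum_congr rfl fun l _ ↦ Finset.sum_congr rfl fun g _ ↦ smul_comm _ _ _
  hexagon a x y z w := by
    rw [← sub_eq_zero]
    simp only [swapTerm, word_append, word_cons, word_nil, mul_one, smul_mul', smul_ι]
    rw [← Finset.sum_add_distrib, ← Finset.sum_add_distrib, ← Finset.sum_add_distrib,
      ← Finset.sum_add_distrib, ← Finset.sum_sub_distrib]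
    refine Finset.sum_eq_zero fun g _ ↦ ?_
    -- The six terms pair off: two terms with the same value of `κ` differ only in whether the
    -- remaining letter `v` stands before or after `g`, that is, by the value of `l` at `v - g v`.
    let l : V →ₗ[ℂ] M := (ρ g).restrictScalars ℂ ∘ₗ L ∘ₗ LinearMap.mulLeft ℂ (word b a) ∘ₗ
      LinearMap.mulRight ℂ (g • word b w) ∘ₗ TensorAlgebra.ι ℂ
    have hl (v : V) : l v = ρ g (L (word b a * (TensorAlgebra.ι ℂ v * g • word b w))) := rfl
    have h1 := hκ.jacobi_map b g (b x) (b y) (b z) l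
    have h2 : κ g (b z) (b x) = - κ g (b x) (b z) := by
      have := hκ.self g (b x + b z)
      simp only [map_add, LinearMap.add_apply, hκ.self, zero_add, add_zero] at this
      exact eq_neg_of_add_eq_zero_left this
    rw [h2] at h1
    simp only [map_sub, sub_mul, mul_sub, smul_sub, hl, neg_smul] at h1
    rw [← neg_eq_zero, ← h1]
    simp only [mul_assoc]
    abel

end swapTerm

end SympRefl

end

/-! ### The normal form functional as a sum over the number of relations used -/

noncomputable section

namespace SympRefl

variable {V : Type*} [AddCommGroup V] [Module ℂ V] {Γ : Subgroup (V ≃ₗ[ℂ] V)} [Fintype Γ]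
  {ι : Type*} [LinearOrder ι] {k M : Type*} [CommRing k] [Algebra ℂ k]
  [AddCommGroup M] [Module k M] [Module ℂ M]

section

variable (κ : Γ → V →ₗ[ℂ] V →ₗ[ℂ] k) (ρ : Γ → M →ₗ[k] M) (b : Module.Basis ι ℂ V) (q : List ι → M)

/-- The components of the normal form functional: the `r`-th one collects the contributions in
which the commutation relations have been used `r` times. -/
def normalFormSeq : ℕ → TensorAlgebra ℂ V →ₗ[ℂ] M
  | 0 => (wordBasis b).constr ℂ fun w ↦ q (w.insertionSort (· ≤ ·))
  | r + 1 => (wordBasis b).constr ℂ fun w ↦ sortCost (fun u i j w ↦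
      swapTerm κ ρ (normalFormSeq r) (word b u) (b i) (b j) (word b w)) [] w

/-- The normal form functional. -/
def normalForm : TensorAlgebra ℂ V →ₗ[ℂ] M :=
  (wordBasis b).constr ℂ fun w ↦
    ∑ r ∈ Finset.range (w.length + 1), normalFormSeq κ ρ b q r (word b w)

theorem normalFormSeq_zero_word (w : List ι) : normalFormSeq κ ρ b q 0 (word b w) =
    q (w.insertionSort (· ≤ ·)) := by
  rw [← wordBasis_apply, normalFormSeq, Module.Basis.constr_basis]

theorem normalFormSeq_succ_word (r : ℕ) (w : List ι) :
    normalFormSeq κ ρ b q (r + 1) (word b w) = sortCost (fun u i j w ↦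
      swapTerm κ ρ (normalFormSeq κ ρ b q r) (word b u) (b i) (b j) (word b w)) [] w := by
  rw [← wordBasis_apply, normalFormSeq, Module.Basis.constr_basis]

/-- Each use of a relation replaces two letters by a group element, so `r` uses need `2 * r`
letters. Hence the sum defining `normalForm` loses nothing by being finite. -/
theorem normalFormSeq_eq_zero (r n : ℕ) (h : n < 2 * r) {u : TensorAlgebra ℂ V}
    (hu : u ∈ wordSpan b n) : normalFormSeq κ ρ b q r u = 0 := by
  induction r generalizing n u with
  | zero => omega
  | succ r ih =>
    induction hu using Submodule.span_induction with
    | mem _ hx =>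
      obtain ⟨w, hw, rfl⟩ := hx
      rw [normalFormSeq_succ_word]
      refine sortCost_eq_zero (n := n) (fun a x y c hn ↦ ?_) [] w (by simpa using hw)
      refine Finset.sum_eq_zero fun g _ ↦ ?_
      rw [ih (a.length + c.length) (by omega)
        (mul_mem_wordSpan (word_mem b rfl) (smul_word_mem b g c) rfl), map_zero, smul_zero]
    | zero => simp
    | add x y _ _ hx hy => rw [map_add, hx, hy, add_zero]
    | smul r x _ hx => rw [map_smul, hx, smul_zero]

/-- A word of length `n` ignores all terms beyond `n`; a freely chosen bound lets words of different
lengths share one range of summation. -/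
theorem normalForm_eq {n N : ℕ} (h : n < N) {u : TensorAlgebra ℂ V} (hu : u ∈ wordSpan b n) :
    normalForm κ ρ b q u = ∑ r ∈ Finset.range N, normalFormSeq κ ρ b q r u := by
  induction hu using Submodule.span_induction with
  | mem _ hx =>
    obtain ⟨w, hw, rfl⟩ := hx
    have h1 : normalForm κ ρ b q (word b w) = ∑ r ∈ Finset.range (w.length + 1),
        normalFormSeq κ ρ b q r (word b w) := by
      rw [← wordBasis_apply, normalForm, Module.Basis.constr_basis]
      simp only [wordBasis_apply]
    have hw' : w.length = n := hw
    rw [h1]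
    refine Finset.sum_subset (by simpa [hw'] using h) fun r _ hr ↦ ?_
    rw [Finset.mem_range, not_lt] at hr
    exact normalFormSeq_eq_zero κ ρ b q r n (by omega) (word_mem b hw)
  | zero => simp
  | add x y _ _ hx hy => rw [map_add, hx, hy]; simp [Finset.sum_add_distrib]
  | smul r x _ hx => rw [map_smul, hx]; simp [Finset.smul_sum]

/-- An ordered word needs no swaps, so only the component with index zero contributes. -/
theorem normalForm_sorted {w : List ι} (hw : w.Pairwise (· ≤ ·)) :
    normalForm κ ρ b q (word b w) = q w := by
  rw [normalForm_eq κ ρ b q (Nat.lt_succ_self _) (word_mem b rfl), Finset.sum_range_succ',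
    normalFormSeq_zero_word, hw.insertionSort_eq, Finset.sum_eq_zero, zero_add]
  intro r _
  rw [normalFormSeq_succ_word, sortCost_of_sorted _ _ _ hw]

end

variable {κ : Γ → V →ₗ[ℂ] V →ₗ[ℂ] k} {ρ : Γ → M →ₗ[k] M}

variable [IsScalarTower ℂ k M]

theorem normalFormSeq_zero_comm (b : Module.Basis ι ℂ V) (q : List ι → M)
    (a : TensorAlgebra ℂ V) (x y : V) (c : TensorAlgebra ℂ V) :
    normalFormSeq κ ρ b q 0 (a * (TensorAlgebra.ι ℂ x * TensorAlgebra.ι ℂ y -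
        TensorAlgebra.ι ℂ y * TensorAlgebra.ι ℂ x) * c) = 0 := by
  refine (ext_swapTerm κ ρ b (normalFormSeq κ ρ b q 0) 0 (fun u w i j ↦ ?_) a x y c).trans
    (by simp [swapTerm])
  have hs : (u ++ i :: j :: w).insertionSort (· ≤ ·) =
      (u ++ j :: i :: w).insertionSort (· ≤ ·) :=
    ((List.perm_insertionSort _ _).trans (((List.Perm.swap j i w).append_left u).trans
      (List.perm_insertionSort _ _).symm)).eq_of_sortedLE (List.sortedLE_insertionSort)
      (List.sortedLE_insertionSort)
  rw [word_mul_comm_mul_word, map_sub, normalFormSeq_zero_word, normalFormSeq_zero_word, hs, sub_self]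
  simp [swapTerm]

variable [Fintype ι]

/-- The costs defining one component are consistent because the previous component satisfies the
commutator rule; this is why the rule is proved by induction on the index. -/
theorem normalFormSeq_succ_comm (hκ : IsFlatForm κ) (hρ : ∀ g h m, ρ h (ρ g m) = ρ (g * h) m)
    (b : Module.Basis ι ℂ V) (q : List ι → M) (r : ℕ)
    (a : TensorAlgebra ℂ V) (x y : V) (c : TensorAlgebra ℂ V) :
    normalFormSeq κ ρ b q (r + 1) (a * (TensorAlgebra.ι ℂ x * TensorAlgebra.ι ℂ y -
        TensorAlgebra.ι ℂ y * TensorAlgebra.ι ℂ x) * c) =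
      swapTerm κ ρ (normalFormSeq κ ρ b q r) a x y c := by
  have key (r : ℕ) (L : TensorAlgebra ℂ V →ₗ[ℂ] M)
      (h : ∀ a x y c, normalFormSeq κ ρ b q r (a * (TensorAlgebra.ι ℂ x * TensorAlgebra.ι ℂ y -
        TensorAlgebra.ι ℂ y * TensorAlgebra.ι ℂ x) * c) = swapTerm κ ρ L a x y c) :
      ∀ a x y c, normalFormSeq κ ρ b q (r + 1) (a * (TensorAlgebra.ι ℂ x * TensorAlgebra.ι ℂ y -
        TensorAlgebra.ι ℂ y * TensorAlgebra.ι ℂ x) * c) =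
      swapTerm κ ρ (normalFormSeq κ ρ b q r) a x y c := by
    refine ext_swapTerm κ ρ b _ _ fun u w i j ↦ ?_
    rw [word_mul_comm_mul_word, map_sub, normalFormSeq_succ_word, normalFormSeq_succ_word]
    exact (isSwapCost_swapTerm hκ hρ b h).sortCost_swap [] u i j w
  induction r generalizing a x y c with
  | zero =>
    -- The component with index zero only sees the sorted word and kills commutators, so the map
    -- below it is taken to be `0`.
    refine key 0 0 (fun a x y c ↦ ?_) a x y c
    rw [normalFormSeq_zero_comm]
    simp [swapTerm]
  | succ r ih => exact key (r + 1) _ ih a x y c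

/-- The commutator rule lowers the index `r` by one, so summation over all `r` yields the
inhomogeneous relation for the total functional. -/
theorem normalForm_comm (hκ : IsFlatForm κ) (hρ : ∀ g h m, ρ h (ρ g m) = ρ (g * h) m)
    (b : Module.Basis ι ℂ V) (q : List ι → M)
    (a : TensorAlgebra ℂ V) (x y : V) (c : TensorAlgebra ℂ V) :
    normalForm κ ρ b q (a * (TensorAlgebra.ι ℂ x * TensorAlgebra.ι ℂ y -
        TensorAlgebra.ι ℂ y * TensorAlgebra.ι ℂ x) * c) =
      swapTerm κ ρ (normalForm κ ρ b q) a x y c := by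
  refine ext_swapTerm κ ρ b _ _ (fun u w i j ↦ ?_) a x y c
  have hm : word b u * (TensorAlgebra.ι ℂ (b i) * TensorAlgebra.ι ℂ (b j) -
      TensorAlgebra.ι ℂ (b j) * TensorAlgebra.ι ℂ (b i)) * word b w ∈
      wordSpan b (u.length + w.length + 2) := by
    rw [word_mul_comm_mul_word]
    exact sub_mem (word_mem b (by simp; omega)) (word_mem b (by simp; omega))
  -- Once the vanishing term of index zero is removed, the remaining range `u.length + w.length + 2`
  -- is still large enough for the words shortened by two letters.
  rw [normalForm_eq κ ρ b q (Nat.lt_succ_self _) hm, Finset.sum_range_succ',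
    normalFormSeq_zero_comm, add_zero]
  simp only [normalFormSeq_succ_comm hκ hρ]
  simp only [swapTerm]
  rw [Finset.sum_comm]
  refine Finset.sum_congr rfl fun g _ ↦ ?_
  rw [normalForm_eq κ ρ b q (N := u.length + w.length + 2) (by omega)
    (mul_mem_wordSpan (word_mem b rfl) (smul_word_mem b g w) rfl), map_sum, Finset.smul_sum]

end SympRefl

end

noncomputable section

/-! ### The degree filtration on polynomials, indexed by the integers -/

namespace MvPolynomial

variable {ι k : Type*} [CommRing k]

/-- The polynomials of total degree at most `n`. -/
def degLE (n : ℤ) : Submodule k (MvPolynomial ι k) where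
  carrier := {p | ∀ d, coeff d p ≠ 0 → (d.degree : ℤ) ≤ n}
  add_mem' {p q} hp hq d h := by
    rw [coeff_add] at h
    by_cases h1 : coeff d p = 0
    · exact hq d (by rwa [h1, zero_add] at h)
    · exact hp d h1
  zero_mem' d h := by simp at h
  smul_mem' r p hp d h := hp d (by
    rw [coeff_smul] at h
    exact right_ne_zero_of_smul h)

/-- The homogeneous component of degree `n` of a polynomial. -/
def comp (n : ℤ) : MvPolynomial ι k →ₗ[k] MvPolynomial ι k :=
  if 0 ≤ n then homogeneousComponent n.toNat else 0

theorem coeff_comp (n : ℤ) (p : MvPolynomial ι k) (d : ι →₀ ℕ) :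
    coeff d (comp n p) = if (d.degree : ℤ) = n then coeff d p else 0 := by
  unfold comp
  split_ifs with h1 h2 h2
  · rw [coeff_homogeneousComponent, if_pos (by omega)]
  · rw [coeff_homogeneousComponent, if_neg (by omega)]
  · omega
  · simp

theorem degLE_mono {m n : ℤ} (h : m ≤ n) : degLE (ι := ι) (k := k) m ≤ degLE n :=
  fun _ hp d hd ↦ (hp d hd).trans h

/-- This ends the descending inductions on degree below, and is the reason for allowing negative
degrees. -/
theorem eq_zero_of_mem_degLE {n : ℤ} (h : n < 0) {p : MvPolynomial ι k} (hp : p ∈ degLE n) :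
    p = 0 := by
  ext d
  by_contra hd
  have := hp d (by simpa using hd)
  omega

theorem exists_mem_degLE (p : MvPolynomial ι k) : ∃ n : ℕ, p ∈ degLE (n : ℤ) :=
  ⟨p.totalDegree, fun d hd ↦ by
    have := le_totalDegree (mem_support_iff.2 hd)
    rw [Finsupp.degree_apply]
    exact_mod_cast this⟩

theorem comp_mem (n : ℤ) (p : MvPolynomial ι k) : comp n p ∈ degLE n := fun d hd ↦ by
  rw [coeff_comp] at hd
  split_ifs at hd with h
  · exact h.le
  · simp at hd

theorem comp_eq_zero {m n : ℤ} (h : m < n) {p : MvPolynomial ι k} (hp : p ∈ degLE m) :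
    comp n p = 0 := by
  ext d
  rw [coeff_comp, coeff_zero, ite_eq_right_iff]
  intro hd
  by_contra h0
  have := hp d h0
  omega

theorem sub_comp_mem {n : ℤ} {p : MvPolynomial ι k} (hp : p ∈ degLE n) :
    p - comp n p ∈ degLE (n - 1) := fun d hd ↦ by
  rw [coeff_sub, coeff_comp] at hd
  split_ifs at hd with h
  · simp at hd
  · have := hp d (by simpa using hd)
    omega

theorem mem_degLE_sub_one {n : ℤ} {p : MvPolynomial ι k} (hp : p ∈ degLE n) (h : comp n p = 0) :
    p ∈ degLE (n - 1) := by simpa [h] using sub_comp_mem hp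

theorem comp_comp (n : ℤ) (p : MvPolynomial ι k) : comp n (comp n p) = comp n p := by
  ext d
  simp only [coeff_comp]
  split_ifs <;> rfl

theorem comp_comp_of_ne {m n : ℤ} (h : m ≠ n) (p : MvPolynomial ι k) : comp m (comp n p) = 0 := by
  ext d
  simp only [coeff_comp, coeff_zero]
  split_ifs <;> first | rfl | omega

theorem mem_degLE_of_comp_eq {n : ℤ} {p : MvPolynomial ι k} (h : comp n p = p) : p ∈ degLE n :=
  h ▸ comp_mem n p

theorem comp_natCast (n : ℕ) : comp (ι := ι) (k := k) n = homogeneousComponent n := by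
  simp [comp]

theorem sum_comp {N : ℕ} {p : MvPolynomial ι k} (hp : p ∈ degLE N) :
    ∑ n ∈ Finset.range (N + 1), comp (n : ℤ) p = p := by
  ext d
  simp only [coeff_sum, coeff_comp, Nat.cast_inj]
  rw [Finset.sum_ite_eq, ite_eq_left_iff, Finset.mem_range]
  intro h
  by_contra h0
  have := hp d (fun h1 ↦ h0 h1.symm)
  omega

theorem comp_mul_of_comp_eq {m n : ℤ} {p q : MvPolynomial ι k} (hp : comp m p = p)
    (hq : comp n q = q) : comp (m + n) (p * q) = p * q := by
  classical
  ext d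
  rw [coeff_comp, ite_eq_left_iff]
  intro hd
  rw [coeff_mul, eq_comm]
  refine Finset.sum_eq_zero fun x hx ↦ ?_
  rw [← hp, ← hq, coeff_comp, coeff_comp]
  have hx : d.degree = x.1.degree + x.2.degree := by
    rw [← Finset.HasAntidiagonal.mem_antidiagonal.1 hx, map_add]
  split_ifs <;> first | omega | simp

theorem mul_mem_degLE {m n l : ℤ} {p q : MvPolynomial ι k} (hp : p ∈ degLE m) (hq : q ∈ degLE n)
    (h : m + n ≤ l) : p * q ∈ degLE l := by
  classical
  intro d hd
  rw [coeff_mul] at hd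
  obtain ⟨x, hx, h0⟩ := Finset.exists_ne_zero_of_sum_ne_zero hd
  have hx : d.degree = x.1.degree + x.2.degree := by
    rw [← Finset.HasAntidiagonal.mem_antidiagonal.1 hx, map_add]
  have h1 := hp _ (left_ne_zero_of_mul h0)
  have h2 := hq _ (right_ne_zero_of_mul h0)
  omega

/-- The bounds matter: in degree `m + n` only the product of the two top components survives. -/
theorem comp_mul {m n : ℤ} {p q : MvPolynomial ι k} (hp : p ∈ degLE m) (hq : q ∈ degLE n) :
    comp (m + n) (p * q) = comp m p * comp n q := by
  have h1 : p * q = comp m p * comp n q + ((p - comp m p) * q + comp m p * (q - comp n q)) := by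
    ring
  rw [h1, map_add, comp_mul_of_comp_eq (comp_comp m p) (comp_comp n q), add_eq_left]
  refine comp_eq_zero (m := m + n - 1) (by omega) (add_mem ?_ ?_)
  · exact mul_mem_degLE (sub_comp_mem hp) hq (by omega)
  · exact mul_mem_degLE (comp_mem m p) (sub_comp_mem hq) (by omega)

theorem comp_X (i : ι) : comp 1 (X i : MvPolynomial ι k) = X i := by
  rw [show (1 : ℤ) = (1 : ℕ) from rfl, comp_natCast]
  exact homogeneousComponent_eq_self (isHomogeneous_X k i)

theorem comp_one : comp 0 (1 : MvPolynomial ι k) = 1 := by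
  rw [show (0 : ℤ) = (0 : ℕ) from rfl, comp_natCast]
  exact homogeneousComponent_eq_self (isHomogeneous_one ι k)

theorem comp_prod_X (w : List ι) :
    comp w.length ((w.map X).prod : MvPolynomial ι k) = (w.map X).prod := by
  induction w with
  | nil => exact comp_one
  | cons i w ih =>
    rw [List.map_cons, List.prod_cons, List.length_cons, Nat.cast_succ, add_comm]
    exact comp_mul_of_comp_eq (comp_X i) ih

theorem prod_map_X_eq_monomial {d : ι →₀ ℕ} {w : List ι} (h : Finsupp.toMultiset d = (w : Multiset ι)) :
    ((w.map X).prod : MvPolynomial ι k) = monomial d 1 := by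
  rw [monomial_eq, C_1, one_mul, ← Multiset.prod_coe, ← Multiset.map_coe, ← h,
    Finsupp.toMultiset_map, Finsupp.prod_toMultiset]
  exact Finsupp.prod_mapDomain_index (fun _ ↦ pow_zero _) (fun _ _ _ ↦ pow_add _ _ _)

theorem length_of_toMultiset_eq {d : ι →₀ ℕ} {w : List ι}
    (h : Finsupp.toMultiset d = (w : Multiset ι)) : w.length = d.degree := by
  rw [← Multiset.coe_card, ← h, Finsupp.card_toMultiset, Finsupp.degree_apply]
  rfl

theorem comp_algHom (f : MvPolynomial ι k →ₐ[k] MvPolynomial ι k)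
    (hf : ∀ i, comp 1 (f (X i)) = f (X i)) {n : ℤ} {p : MvPolynomial ι k} (hp : comp n p = p) :
    comp n (f p) = f p := by
  by_cases hn : 0 ≤ n
  · lift n to ℕ using hn
    rw [comp_natCast] at hp ⊢
    refine homogeneousComponent_eq_self ?_
    have h1 : p.IsHomogeneous n := by
      rw [← hp]
      exact homogeneousComponent_isHomogeneous n p
    rw [aeval_unique f]
    have := h1.aeval (fun i ↦ f (X i)) (n := 1) (fun i ↦ by
      rw [← hf i, show (1 : ℤ) = (1 : ℕ) from rfl, comp_natCast]
      exact homogeneousComponent_isHomogeneous 1 _)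
    rwa [one_mul] at this
  · have : p = 0 := eq_zero_of_mem_degLE (not_le.1 hn) (mem_degLE_of_comp_eq hp)
    rw [this, map_zero, map_zero]

theorem comp_algHom_apply (f : MvPolynomial ι k →ₐ[k] MvPolynomial ι k)
    (hf : ∀ i, comp 1 (f (X i)) = f (X i)) (n : ℤ) (p : MvPolynomial ι k) :
    comp n (f p) = f (comp n p) := by
  obtain ⟨N, hN⟩ := exists_mem_degLE p
  rw [← sum_comp hN, map_sum, map_sum, map_sum, map_sum]
  refine Finset.sum_congr rfl fun m _ ↦ ?_
  by_cases h : n = m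
  · rw [h, comp_comp, comp_algHom f hf (comp_comp _ _)]
  · rw [comp_comp_of_ne h, map_zero, ← comp_algHom f hf (comp_comp _ p), comp_comp_of_ne h]

theorem algHom_mem_degLE (f : MvPolynomial ι k →ₐ[k] MvPolynomial ι k)
    (hf : ∀ i, comp 1 (f (X i)) = f (X i)) {n : ℤ} {p : MvPolynomial ι k} (hp : p ∈ degLE n) :
    f p ∈ degLE n := by
  intro d hd
  by_contra hn
  have h1 : comp (d.degree : ℤ) (f p) = 0 := by
    rw [comp_algHom_apply f hf, comp_eq_zero (not_le.1 hn) hp, map_zero]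
  apply hd
  have := congrArg (coeff d) h1
  simpa [coeff_comp] using this

end MvPolynomial

end

noncomputable section

open MvPolynomial

/-! ### Algebras with a PBW basis -/

/-- Letters `x i` and a finite group `Γ` in an algebra `B`, with the commutation relations
`[x i, x j] = ∑ form g i j • g` satisfying the Jacobi identity. -/
structure SkewGenerators (k ι Γ B : Type*) [CommRing k] [Fintype ι] [Group Γ] [Fintype Γ]
    [Ring B] [Algebra k B] where
  /-- the action of the group on polynomials -/
  act : Γ →* (MvPolynomial ι k →ₐ[k] MvPolynomial ι k)
  /-- the matrices of the action on linear forms -/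
  mat : Γ → ι → ι → k
  act_X : ∀ g i, act g (X i) = ∑ j, mat g j i • X j
  act_ne : ∀ g, g ≠ 1 → ∃ i, act g (X i) ≠ X i
  /-- the components of the commutator of two letters -/
  form : Γ → ι → ι → k
  jacobi : ∀ g i j l, form g i j • (X l - act g (X l)) + form g j l • (X i - act g (X i)) +
    form g l i • (X j - act g (X j)) = 0
  /-- the letters -/
  x : ι → B
  /-- the inclusion of the group -/
  γ : Γ →* B
  γ_mul_x : ∀ g i, γ g * x i = (∑ j, mat g j i • x j) * γ g
  x_comm : ∀ i j, x i * x j - x j * x i = ∑ g, form g i j • γ g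
  /-- the inverse of the order of the group -/
  invCard : k
  invCard_mul : invCard * (Fintype.card Γ : k) = 1

/-- An algebra `B` generated by letters and a finite group, which has a PBW basis: as a module,
`B` is identified with `SV # Γ`, and words have the expected leading terms. -/
structure PBWAlgebra (k ι Γ B : Type*) [CommRing k] [Fintype ι] [Group Γ] [Fintype Γ]
    [DecidableEq Γ] [Ring B] [Algebra k B] extends SkewGenerators k ι Γ B where
  /-- the coordinates with respect to the PBW basis -/
  coord : B ≃ₗ[k] (Γ → MvPolynomial ι k)
  coord_mul_γ : ∀ b g h, coord (b * γ g) h = coord b (h * g⁻¹)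
  coord_word : ∀ (w : List ι) h, coord ((w.map x).prod) h -
    (Pi.single 1 ((w.map X).prod) : Γ → MvPolynomial ι k) h ∈ degLE ((w.length : ℤ) - 1)

namespace PBWAlgebra

variable {k ι Γ B : Type*} [CommRing k] [Fintype ι] [Group Γ] [Fintype Γ] [DecidableEq Γ]
  [Ring B] [Algebra k B] (A : PBWAlgebra k ι Γ B)

theorem comp_act_X (g : Γ) (i : ι) : comp 1 (A.act g (X i)) = A.act g (X i) := by
  rw [A.act_X, map_sum]
  simp only [map_smul, comp_X]

theorem comp_act (g : Γ) (n : ℤ) (p : MvPolynomial ι k) :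
    comp n (A.act g p) = A.act g (comp n p) :=
  comp_algHom_apply _ (A.comp_act_X g) n p

theorem act_mem_degLE (g : Γ) {n : ℤ} {p : MvPolynomial ι k} (hp : p ∈ degLE n) :
    A.act g p ∈ degLE n :=
  algHom_mem_degLE _ (A.comp_act_X g) hp

theorem act_one (p : MvPolynomial ι k) : A.act 1 p = p := by
  rw [map_one]; rfl

/-- The element of the algebra with a given coordinate polynomial at the unit of the group. -/
def lift : MvPolynomial ι k →ₗ[k] B :=
  A.coord.symm.toLinearMap ∘ₗ LinearMap.single k (fun _ ↦ MvPolynomial ι k) 1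

/-- The symmetriser. -/
def sym : B := A.invCard • ∑ g, A.γ g

/-- The identification of `B e` with polynomials. -/
def theta : B →ₗ[k] MvPolynomial ι k :=
  (∑ g, LinearMap.proj g) ∘ₗ A.coord.toLinearMap

theorem theta_apply (b : B) : A.theta b = ∑ g, A.coord b g := by
  simp [theta]

theorem coord_lift (p : MvPolynomial ι k) : A.coord (A.lift p) = Pi.single 1 p := by
  simp [lift]

theorem theta_lift (p : MvPolynomial ι k) : A.theta (A.lift p) = p := by
  rw [theta_apply, coord_lift, Finset.sum_pi_single']
  simp

theorem coord_lift_mul_γ (p : MvPolynomial ι k) (g : Γ) :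
    A.coord (A.lift p * A.γ g) = Pi.single g p := by
  funext h
  rw [A.coord_mul_γ, coord_lift, Pi.single_apply, Pi.single_apply]
  simp only [mul_inv_eq_one]

theorem eq_sum_lift (b : B) : b = ∑ g, A.lift (A.coord b g) * A.γ g := by
  apply A.coord.injective
  rw [map_sum]
  simp only [coord_lift_mul_γ]
  exact (Finset.univ_sum_single (A.coord b)).symm

theorem theta_mul_γ (b : B) (g : Γ) : A.theta (b * A.γ g) = A.theta b := by
  rw [theta_apply, theta_apply]
  simp only [A.coord_mul_γ]
  exact Fintype.sum_equiv (Equiv.mulRight g⁻¹) _ _ fun _ ↦ rfl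

theorem invCard_smul_sum {M : Type*} [AddCommGroup M] [Module k M] (m : M) :
    A.invCard • ∑ _g : Γ, m = m := by
  rw [Finset.sum_const, Finset.card_univ, ← Nat.cast_smul_eq_nsmul k, smul_smul, A.invCard_mul,
    one_smul]

theorem theta_mul_sym (b : B) : A.theta (b * A.sym) = A.theta b := by
  rw [sym, mul_smul_comm, map_smul, Finset.mul_sum, map_sum]
  simp only [theta_mul_γ]
  exact A.invCard_smul_sum _

theorem γ_mul_sym (g : Γ) : A.γ g * A.sym = A.sym := by
  rw [sym, mul_smul_comm, Finset.mul_sum]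
  simp only [← map_mul]
  congr 1
  exact Fintype.sum_equiv (Equiv.mulLeft g) _ _ fun _ ↦ rfl

theorem sym_mul_γ (g : Γ) : A.sym * A.γ g = A.sym := by
  rw [sym, smul_mul_assoc, Finset.sum_mul]
  simp only [← map_mul]
  congr 1
  exact Fintype.sum_equiv (Equiv.mulRight g) _ _ fun _ ↦ rfl

theorem sym_mul_sym : A.sym * A.sym = A.sym := by
  nth_rw 1 [sym]
  rw [smul_mul_assoc, Finset.sum_mul]
  simp only [γ_mul_sym]
  exact A.invCard_smul_sum _

/-- Group elements on the right are absorbed by the symmetriser, so only the sum of the coordinates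
survives. -/
theorem mul_sym (b : B) : b * A.sym = A.lift (A.theta b) * A.sym := by
  conv_lhs => rw [A.eq_sum_lift b]
  rw [Finset.sum_mul, theta_apply, map_sum, Finset.sum_mul]
  simp only [mul_assoc, γ_mul_sym]

/-- Since `theta` only sees `b * sym`, left multiplication descends to polynomials: they carry the
module structure of `B e`. -/
theorem theta_mul (b c : B) : A.theta (b * c) = A.theta (b * A.lift (A.theta c)) := by
  rw [← theta_mul_sym, mul_assoc, mul_sym, ← mul_assoc, theta_mul_sym]

theorem theta_mul_congr (b : B) {c c' : B} (h : A.theta c = A.theta c') :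
    A.theta (b * c) = A.theta (b * c') := by
  rw [theta_mul, h, ← theta_mul]

theorem mul_sym_congr {c c' : B} (h : A.theta c = A.theta c') : c * A.sym = c' * A.sym := by
  rw [mul_sym, h, ← mul_sym]

/-- The PBW filtration. -/
def filt (n : ℤ) : Submodule k B where
  carrier := {b | ∀ g, A.coord b g ∈ degLE n}
  add_mem' ha hb g := by rw [map_add]; exact add_mem (ha g) (hb g)
  zero_mem' g := by rw [map_zero]; exact zero_mem _
  smul_mem' r a ha g := by rw [map_smul]; exact Submodule.smul_mem _ r (ha g)

theorem lift_mem {n : ℤ} {p : MvPolynomial ι k} (hp : p ∈ degLE n) : A.lift p ∈ A.filt n := by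
  intro g
  rw [coord_lift, Pi.single_apply]
  split_ifs
  · exact hp
  · exact zero_mem _

theorem eq_zero_of_mem_filt {n : ℤ} (hn : n < 0) {b : B} (hb : b ∈ A.filt n) : b = 0 := by
  apply A.coord.injective
  funext g
  rw [map_zero]
  exact eq_zero_of_mem_degLE hn (hb g)

theorem exists_mem_filt (b : B) : ∃ n : ℕ, b ∈ A.filt n := by
  choose n hn using fun g ↦ exists_mem_degLE (A.coord b g)
  exact ⟨Finset.univ.sup n, fun g ↦ degLE_mono
    (by exact_mod_cast Finset.le_sup (f := n) (Finset.mem_univ g)) (hn g)⟩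

/-! #### Words and their symbols -/

/-- The words of length `n`, paired with their symbols. -/
def words (n : ℕ) : Submodule k (B × MvPolynomial ι k) :=
  Submodule.span k ((fun w : List ι ↦ ((w.map A.x).prod, (w.map X).prod)) '' {w | w.length = n})

variable {A}

theorem word_mem_words {n : ℕ} {w : List ι} (h : w.length = n) :
    ((w.map A.x).prod, (w.map X).prod) ∈ A.words n :=
  Submodule.subset_span ⟨w, h, rfl⟩

theorem mul_mem_words {m n l : ℕ} {b c : B} {p q : MvPolynomial ι k} (hb : (b, p) ∈ A.words m)
    (hc : (c, q) ∈ A.words n) (h : m + n = l) : (b * c, p * q) ∈ A.words l := by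
  have := Submodule.mul_mem_mul hb hc
  rw [words, words, Submodule.span_mul_span] at this
  refine Submodule.span_mono ?_ this
  rintro _ ⟨_, ⟨w, hw, rfl⟩, _, ⟨w', hw', rfl⟩, rfl⟩
  refine ⟨w ++ w', ?_, by simp⟩
  simp only [Set.mem_ofPred_eq] at hw hw' ⊢
  rw [List.length_append, hw, hw', h]

theorem x_mem_words (i : ι) : (A.x i, X i) ∈ A.words 1 := by
  simpa using word_mem_words (A := A) (w := [i]) rfl

theorem one_mem_words : (1, 1) ∈ A.words 0 := by
  simpa using word_mem_words (A := A) (w := []) rfl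

theorem γ_mul_inv (g : Γ) : A.γ g * A.γ g⁻¹ = 1 := by rw [← map_mul, mul_inv_cancel, map_one]

theorem γ_inv_mul (g : Γ) : A.γ g⁻¹ * A.γ g = 1 := by rw [← map_mul, inv_mul_cancel, map_one]

/-- Moving a group element past a letter produces a linear combination of letters without
corrections, so conjugation acts on words as `act g` acts on their symbols. -/
theorem conj_mem_words (g : Γ) {n : ℕ} {b : B} {p : MvPolynomial ι k} (hb : (b, p) ∈ A.words n) :
    (A.γ g * b * A.γ g⁻¹, A.act g p) ∈ A.words n := by
  let f : B × MvPolynomial ι k →ₗ[k] B × MvPolynomial ι k :=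
    LinearMap.prodMap (LinearMap.mulRight k (A.γ g⁻¹) ∘ₗ LinearMap.mulLeft k (A.γ g))
      (A.act g).toLinearMap
  suffices h : A.words n ≤ (A.words n).comap f from h hb
  refine Submodule.span_le.2 ?_
  clear hb
  rintro _ ⟨w, rfl, rfl⟩
  change (A.γ g * (w.map A.x).prod * A.γ g⁻¹, A.act g (w.map X).prod) ∈ A.words w.length
  induction w with
  | nil =>
    simp only [List.map_nil, List.prod_nil, mul_one, γ_mul_inv, map_one]
    exact one_mem_words
  | cons i w ih =>
    have h1 : (∑ j, A.mat g j i • A.x j, A.act g (X i)) ∈ A.words 1 := by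
      have : ∑ j, A.mat g j i • (A.x j, (X j : MvPolynomial ι k)) ∈ A.words 1 :=
        sum_mem fun j _ ↦ Submodule.smul_mem _ _ (x_mem_words j)
      rw [A.act_X]
      convert this using 1
      ext <;> simp [Prod.fst_sum, Prod.snd_sum]
    have h2 := mul_mem_words h1 ih (l := (i :: w).length) (by simp [add_comm])
    convert h2 using 2
    · rw [List.map_cons, List.prod_cons, ← mul_assoc, A.γ_mul_x]
      simp only [mul_assoc]
    · rw [List.map_cons, List.prod_cons, map_mul]

theorem comp_of_mem_words {n : ℕ} {b : B} {p : MvPolynomial ι k} (hb : (b, p) ∈ A.words n) :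
    comp n p = p := by
  suffices h : A.words n ≤ LinearMap.ker ((comp (n : ℤ) - LinearMap.id) ∘ₗ
      LinearMap.snd k B (MvPolynomial ι k)) by
    simpa [sub_eq_zero] using h hb
  refine Submodule.span_le.2 ?_
  rintro _ ⟨w, rfl, rfl⟩
  simpa [sub_eq_zero] using comp_prod_X w

theorem exists_mem_words {n : ℕ} {p : MvPolynomial ι k} (hp : comp n p = p) :
    ∃ b, (b, p) ∈ A.words n := by
  suffices h : p ∈ (A.words n).map (LinearMap.snd k B (MvPolynomial ι k)) by
    obtain ⟨⟨b, _⟩, hb, rfl⟩ := h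
    exact ⟨b, hb⟩
  rw [p.as_sum]
  refine sum_mem fun d hd ↦ ?_
  have hdeg : d.degree = n := by
    rw [mem_support_iff, ← hp, coeff_comp] at hd
    by_contra h
    exact hd (if_neg (by exact_mod_cast h))
  have hw : Finsupp.toMultiset d = ((Finsupp.toMultiset d).toList : Multiset ι) :=
    (Multiset.coe_toList _).symm
  rw [← mul_one (coeff d p), ← smul_eq_mul, ← smul_monomial]
  exact Submodule.smul_mem _ _ ⟨_, word_mem_words ((length_of_toMultiset_eq hw).trans hdeg),
    prod_map_X_eq_monomial hw⟩

theorem coord_mul_γ_sub_mem {n : ℕ} {b : B} {p : MvPolynomial ι k} (hb : (b, p) ∈ A.words n)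
    (g h : Γ) : A.coord (b * A.γ g) h - (Pi.single g p : Γ → MvPolynomial ι k) h ∈
      degLE ((n : ℤ) - 1) := by
  have h1 : A.coord b (h * g⁻¹) - (Pi.single 1 p : Γ → MvPolynomial ι k) (h * g⁻¹) ∈
      degLE ((n : ℤ) - 1) := by
    suffices h : A.words n ≤ (degLE ((n : ℤ) - 1)).comap
        ((LinearMap.proj (h * g⁻¹) : (Γ → MvPolynomial ι k) →ₗ[k] MvPolynomial ι k) ∘ₗ
        (A.coord.toLinearMap ∘ₗ LinearMap.fst k B (MvPolynomial ι k) -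
          LinearMap.single k (fun _ ↦ MvPolynomial ι k) 1 ∘ₗ
            LinearMap.snd k B (MvPolynomial ι k))) from h hb
    refine Submodule.span_le.2 ?_
    rintro _ ⟨w, rfl, rfl⟩
    exact A.coord_word w (h * g⁻¹)
  rw [A.coord_mul_γ]
  convert h1 using 2
  rw [Pi.single_apply, Pi.single_apply]
  simp only [mul_inv_eq_one]

theorem theta_sub_mem {n : ℕ} {b : B} {p : MvPolynomial ι k} (hb : (b, p) ∈ A.words n) :
    A.theta b - p ∈ degLE ((n : ℤ) - 1) := by
  have h1 : A.theta b - p = ∑ h, (A.coord (b * A.γ 1) h -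
      (Pi.single 1 p : Γ → MvPolynomial ι k) h) := by
    rw [Finset.sum_sub_distrib, map_one, mul_one, theta_apply, Finset.sum_pi_single']
    simp
  rw [h1]
  exact sum_mem fun h _ ↦ coord_mul_γ_sub_mem hb 1 h

theorem theta_mul_γ_mul_sub_mem {m n : ℕ} {b c : B} {p q : MvPolynomial ι k}
    (hb : (b, p) ∈ A.words m) (hc : (c, q) ∈ A.words n) (g : Γ) :
    A.theta (b * A.γ g * c) - p * A.act g q ∈ degLE ((m : ℤ) + n - 1) := by
  have h1 : b * A.γ g * c = b * (A.γ g * c * A.γ g⁻¹) * A.γ g := by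
    simp only [mul_assoc, γ_inv_mul, mul_one]
  rw [h1, theta_mul_γ]
  exact_mod_cast theta_sub_mem (mul_mem_words hb (conj_mem_words g hc) rfl)

/-- The leading term of a product, acting on polynomials. -/
theorem theta_mul_sub_mem {m n : ℤ} {b c : B} (hb : b ∈ A.filt m) (hc : A.theta c ∈ degLE n) :
    A.theta (b * c) - ∑ g, comp m (A.coord b g) * A.act g (comp n (A.theta c)) ∈
      degLE (m + n - 1) := by
  -- Induction on a bound for `m + n`; if `m` or `n` is negative, one of the factors vanishes.
  obtain ⟨N, hN⟩ : ∃ N : ℕ, m + n < N := ⟨(m + n + 1).toNat, by omega⟩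
  induction N generalizing m n b c with
  | zero =>
    rcases lt_or_ge m 0 with hm | hm
    · simp [A.eq_zero_of_mem_filt hm hb]
    · have hn : n < 0 := by push_cast at hN; omega
      rw [theta_mul, eq_zero_of_mem_degLE hn hc]
      simp
  | succ N ih =>
  rcases lt_or_ge m 0 with hm | hm
  · simp [A.eq_zero_of_mem_filt hm hb]
  rcases lt_or_ge n 0 with hn | hn
  · rw [theta_mul, eq_zero_of_mem_degLE hn hc]
    simp
  have ih' {m' n' : ℤ} {b' c' : B} (hb : b' ∈ A.filt m') (hc : A.theta c' ∈ degLE n')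
      (h : m' + n' + 1 = m + n) : A.theta (b' * c') ∈ degLE (m + n - 1) := by
    have h1 := ih hb hc (by omega)
    rw [← sub_add_cancel (A.theta (b' * c')) (∑ g, comp m' (A.coord b' g) *
      A.act g (comp n' (A.theta c')))]
    refine add_mem (degLE_mono (by omega) h1) (sum_mem fun g _ ↦ ?_)
    exact mul_mem_degLE (comp_mem _ _) (A.act_mem_degLE g (comp_mem _ _)) (by omega)
  lift m to ℕ using hm
  lift n to ℕ using hn
  -- The leading parts of `b` and of `theta c` are lifted to combinations of words, for which the
  -- leading term is known; the errors have smaller order and fall under the induction hypothesis.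
  choose b' hb' using fun g ↦ exists_mem_words (A := A) (comp_comp (m : ℤ) (A.coord b g))
  obtain ⟨c', hc'⟩ := exists_mem_words (A := A) (comp_comp (n : ℤ) (A.theta c))
  have h1 : b - ∑ g, b' g * A.γ g ∈ A.filt ((m : ℤ) - 1) := by
    intro h
    have h2 : A.coord (b - ∑ g, b' g * A.γ g) h = (A.coord b h - comp m (A.coord b h)) -
        ∑ g, (A.coord (b' g * A.γ g) h -
          (Pi.single g (comp m (A.coord b g)) : Γ → MvPolynomial ι k) h) := by
      rw [map_sub, map_sum, Pi.sub_apply, Finset.sum_apply, Finset.sum_sub_distrib,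
        Finset.sum_pi_single]
      simp
    rw [h2]
    exact sub_mem (sub_comp_mem (hb h)) (sum_mem fun g _ ↦ coord_mul_γ_sub_mem (hb' g) g h)
  have h2 : A.theta (c - c') ∈ degLE ((n : ℤ) - 1) := by
    have h3 : A.theta (c - c') = (A.theta c - comp n (A.theta c)) -
        (A.theta c' - comp n (A.theta c)) := by rw [map_sub]; ring
    rw [h3]
    exact sub_mem (sub_comp_mem hc) (theta_sub_mem hc')
  have h3 : ∑ g, b' g * A.γ g ∈ A.filt (m : ℤ) := by
    rw [← sub_sub_self b (∑ g, b' g * A.γ g)]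
    exact sub_mem hb fun g ↦ degLE_mono (by omega) (h1 g)
  have h4 : A.theta (b * c) - ∑ g, comp m (A.coord b g) * A.act g (comp n (A.theta c)) =
      A.theta ((b - ∑ g, b' g * A.γ g) * c) + A.theta ((∑ g, b' g * A.γ g) * (c - c')) +
      ∑ g, (A.theta (b' g * A.γ g * c') - comp m (A.coord b g) * A.act g (comp n (A.theta c))) := by
    rw [Finset.sum_sub_distrib, ← map_sum, ← Finset.sum_mul, ← map_add, ← add_sub_assoc, ← map_add]
    congr 2
    noncomm_ring
  rw [h4]
  refine add_mem (add_mem (ih' h1 hc (by omega)) (ih' h3 h2 (by omega))) (sum_mem fun g _ ↦ ?_)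
  exact theta_mul_γ_mul_sub_mem (hb' g) hc' g

theorem theta_mul_mem {m n : ℤ} {b c : B} (hb : b ∈ A.filt m) (hc : A.theta c ∈ degLE n) :
    A.theta (b * c) ∈ degLE (m + n) := by
  rw [← sub_add_cancel (A.theta (b * c)) (∑ g, comp m (A.coord b g) *
    A.act g (comp n (A.theta c)))]
  refine add_mem (degLE_mono (by omega) (theta_mul_sub_mem hb hc)) (sum_mem fun g _ ↦ ?_)
  exact mul_mem_degLE (comp_mem _ _) (A.act_mem_degLE g (comp_mem _ _)) le_rfl

theorem comp_theta_mul {m n : ℤ} {b c : B} (hb : b ∈ A.filt m) (hc : A.theta c ∈ degLE n) :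
    comp (m + n) (A.theta (b * c)) =
      ∑ g, comp m (A.coord b g) * A.act g (comp n (A.theta c)) := by
  have h := comp_eq_zero (by omega) (theta_mul_sub_mem hb hc) (n := m + n)
  rw [map_sub, sub_eq_zero, map_sum] at h
  rw [h]
  refine Finset.sum_congr rfl fun g _ ↦ comp_mul_of_comp_eq (comp_comp _ _) ?_
  rw [A.comp_act, comp_comp]

end PBWAlgebra

end

noncomputable section

open MvPolynomial

namespace PBWAlgebra

variable {k ι Γ B : Type*} [CommRing k] [Fintype ι] [Group Γ] [Fintype Γ] [DecidableEq Γ]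
  [Ring B] [Algebra k B] (A : PBWAlgebra k ι Γ B)

/-! #### The leading term of a commutator -/

open Classical in
/-- The twisted gradients `∑_i w_{<i} g(w_{>i}) ⊗ w_i` of a word. -/
def wordGrad : List ι → Γ → ι → MvPolynomial ι k
  | [], _, _ => 0
  | i :: w, g, j => (if j = i then A.act g ((w.map X).prod) else 0) + X i * wordGrad w g j

/-- The words of length `n`, paired with their symbols and their twisted gradients. -/
def gradWords (n : ℕ) : Submodule k (B × MvPolynomial ι k × (Γ → ι → MvPolynomial ι k)) :=
  Submodule.span k ((fun w : List ι ↦ ((w.map A.x).prod, (w.map X).prod, A.wordGrad w)) ''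
    {w | w.length = n})

variable {A}

theorem exists_mem_gradWords {n : ℕ} {b : B} {p : MvPolynomial ι k} (hb : (b, p) ∈ A.words n) :
    ∃ D, (b, p, D) ∈ A.gradWords n := by
  suffices h : A.words n ≤ (A.gradWords n).map
      (LinearMap.prodMap LinearMap.id (LinearMap.fst k (MvPolynomial ι k) _)) by
    obtain ⟨⟨b', p', D⟩, hD, h1⟩ := h hb
    obtain ⟨rfl, rfl⟩ := Prod.ext_iff.1 h1
    exact ⟨D, hD⟩
  refine Submodule.span_le.2 ?_
  rintro _ ⟨w, rfl, rfl⟩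
  exact ⟨_, Submodule.subset_span ⟨w, rfl, rfl⟩, rfl⟩

/-- By the Leibniz rule each letter of `w` in turn is replaced by a combination of group elements,
and moving `γ g` to the right twists the rest by `g`. The factor `u` collects the letters already
passed. -/
theorem theta_x_comm_word_sub_mem (i : ι) (w : List ι) {m n : ℕ} {u v : B}
    {p q : MvPolynomial ι k} (hu : (u, p) ∈ A.words m) (hv : (v, q) ∈ A.words n) :
    A.theta (u * (A.x i * (w.map A.x).prod - (w.map A.x).prod * A.x i) * v)
      - ∑ g, ∑ j, A.form g i j • (p * A.wordGrad w g j * A.act g q) ∈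
      degLE ((m : ℤ) + n + w.length - 2) := by
  classical
  induction w generalizing m u p with
  | nil => simp [wordGrad]
  | cons l w ih =>
    have h1 := ih (mul_mem_words hu (x_mem_words l) rfl)
    have h2 (g : Γ) := theta_mul_γ_mul_sub_mem hu
      (mul_mem_words (word_mem_words (A := A) (w := w) rfl) hv rfl) g
    have h3 : A.theta (u * (A.x i * ((l :: w).map A.x).prod - ((l :: w).map A.x).prod * A.x i) * v)
        = A.theta (u * A.x l * (A.x i * (w.map A.x).prod - (w.map A.x).prod * A.x i) * v) +
          ∑ g, A.form g i l • A.theta (u * A.γ g * ((w.map A.x).prod * v)) := by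
      have : ∑ g, A.form g i l • A.theta (u * A.γ g * ((w.map A.x).prod * v)) =
          A.theta (u * (A.x i * A.x l - A.x l * A.x i) * ((w.map A.x).prod * v)) := by
        rw [A.x_comm, Finset.mul_sum, Finset.sum_mul, map_sum]
        simp only [mul_smul_comm, smul_mul_assoc, map_smul]
      rw [this, ← map_add, List.map_cons, List.prod_cons]
      congr 1
      noncomm_ring
    have h4 (g : Γ) : ∑ j, A.form g i j • (p * A.wordGrad (l :: w) g j * A.act g q) =
        A.form g i l • (p * A.act g ((w.map X).prod * q)) +
        ∑ j, A.form g i j • (p * X l * A.wordGrad w g j * A.act g q) := by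
      simp only [wordGrad, mul_add, add_mul, smul_add, Finset.sum_add_distrib, mul_ite, mul_zero,
        ite_mul, zero_mul, smul_ite, smul_zero, Finset.sum_ite_eq', Finset.mem_univ, if_true,
        map_mul, mul_assoc]
    rw [h3, Finset.sum_congr rfl fun g _ ↦ h4 g, Finset.sum_add_distrib, add_comm (A.theta _),
      add_sub_add_comm, ← Finset.sum_sub_distrib]
    refine add_mem (sum_mem fun g _ ↦ ?_) (degLE_mono (by simp; omega) h1)
    rw [← smul_sub]
    exact Submodule.smul_mem _ _ (degLE_mono (by simp; omega) (h2 g))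

/-- Leibniz rule in the first word: letters to the left of the active one are absorbed into `u`,
letters to the right into `v`. -/
theorem theta_word_comm_word_sub_mem (w w' : List ι) {m n : ℕ} {u v : B}
    {p q : MvPolynomial ι k} (hu : (u, p) ∈ A.words m) (hv : (v, q) ∈ A.words n) :
    A.theta (u * ((w.map A.x).prod * (w'.map A.x).prod - (w'.map A.x).prod * (w.map A.x).prod) * v)
      - ∑ g, ∑ i, ∑ j, A.form g i j • (p * (A.wordGrad w g i * A.wordGrad w' g j) * A.act g q) ∈
      degLE ((m : ℤ) + n + w.length + w'.length - 3) := by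
  classical
  induction w generalizing m u p with
  | nil => simp [wordGrad]
  | cons l w ih =>
    have h1 := ih (mul_mem_words hu (x_mem_words l) rfl)
    have h2 := theta_x_comm_word_sub_mem l w' hu
      (mul_mem_words (word_mem_words (A := A) (w := w) rfl) hv rfl)
    have h3 : A.theta (u * (((l :: w).map A.x).prod * (w'.map A.x).prod -
          (w'.map A.x).prod * ((l :: w).map A.x).prod) * v)
        = A.theta (u * (A.x l * (w'.map A.x).prod - (w'.map A.x).prod * A.x l) *
            ((w.map A.x).prod * v)) +
          A.theta (u * A.x l * ((w.map A.x).prod * (w'.map A.x).prod -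
            (w'.map A.x).prod * (w.map A.x).prod) * v) := by
      rw [← map_add, List.map_cons, List.prod_cons]
      congr 1
      noncomm_ring
    have h4 (g : Γ) : ∑ i, ∑ j, A.form g i j •
          (p * (A.wordGrad (l :: w) g i * A.wordGrad w' g j) * A.act g q) =
        ∑ j, A.form g l j • (p * A.wordGrad w' g j * A.act g ((w.map X).prod * q)) +
        ∑ i, ∑ j, A.form g i j •
          (p * X l * (A.wordGrad w g i * A.wordGrad w' g j) * A.act g q) := by
      rw [Finset.sum_comm, Finset.sum_comm (γ := ι) (f := fun i j ↦ A.form g i j •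
          (p * X l * (A.wordGrad w g i * A.wordGrad w' g j) * A.act g q)), ← Finset.sum_add_distrib]
      refine Finset.sum_congr rfl fun j _ ↦ ?_
      simp only [wordGrad, mul_add, add_mul, smul_add, Finset.sum_add_distrib, mul_ite, mul_zero,
        ite_mul, zero_mul, smul_ite, smul_zero, Finset.sum_ite_eq', Finset.mem_univ, if_true,
        map_mul, mul_assoc]
      congr 2
      ring
    rw [h3, Finset.sum_congr rfl fun g _ ↦ h4 g, Finset.sum_add_distrib, add_sub_add_comm]
    exact add_mem (degLE_mono (by simp; omega) h2) (degLE_mono (by simp; omega) h1)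

theorem theta_comm_sub_mem {m n : ℕ} {b c : B} {p q : MvPolynomial ι k}
    {D E : Γ → ι → MvPolynomial ι k} (hb : (b, p, D) ∈ A.gradWords m)
    (hc : (c, q, E) ∈ A.gradWords n) :
    A.theta (b * c - c * b) - ∑ g, ∑ i, ∑ j, A.form g i j • (D g i * E g j) ∈
      degLE ((m : ℤ) + n - 3) := by
  suffices h : ∀ y ∈ A.gradWords m, ∀ z ∈ A.gradWords n,
      A.theta (y.1 * z.1 - z.1 * y.1) -
        ∑ g, ∑ i, ∑ j, A.form g i j • (y.2.2 g i * z.2.2 g j) ∈ degLE ((m : ℤ) + n - 3) from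
    h (b, p, D) hb (c, q, E) hc
  clear hb hc b c p q D E
  intro y hy z hz
  induction hy using Submodule.span_induction with
  | mem y hy =>
    obtain ⟨w, rfl, rfl⟩ := hy
    induction hz using Submodule.span_induction with
    | mem z hz =>
      obtain ⟨w', rfl, rfl⟩ := hz
      have := theta_word_comm_word_sub_mem w w' (one_mem_words (A := A)) (one_mem_words (A := A))
      simpa using this
    | zero => simp
    | add z z' _ _ h h' =>
      convert add_mem h h' using 1
      simp only [Prod.fst_add, Prod.snd_add, Pi.add_apply, mul_add, add_mul, smul_add,
        Finset.sum_add_distrib, map_sub, map_add]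
      ring
    | smul r z _ h =>
      convert Submodule.smul_mem _ r h using 1
      simp only [Prod.smul_fst, Prod.smul_snd, Pi.smul_apply, mul_smul_comm, smul_mul_assoc,
        map_sub, map_smul, smul_sub, Finset.smul_sum, smul_comm _ r]
  | zero => simp
  | add z z' _ _ h h' =>
    convert add_mem h h' using 1
    simp only [Prod.fst_add, Prod.snd_add, Pi.add_apply, mul_add, add_mul, smul_add,
      Finset.sum_add_distrib, map_sub, map_add]
    ring
  | smul r z _ h =>
    convert Submodule.smul_mem _ r h using 1
    simp only [Prod.smul_fst, Prod.smul_snd, Pi.smul_apply, mul_smul_comm, smul_mul_assoc,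
      map_sub, map_smul, smul_sub, Finset.smul_sum, smul_comm _ r]

/-- The sum telescopes: it passes from a word to its image under `g` one letter at a time. -/
theorem sum_grad_mul {n : ℕ} {b : B} {p : MvPolynomial ι k} {D : Γ → ι → MvPolynomial ι k}
    (hb : (b, p, D) ∈ A.gradWords n) (g : Γ) :
    ∑ i, D g i * (X i - A.act g (X i)) = p - A.act g p := by
  suffices h : ∀ y ∈ A.gradWords n,
      ∑ i, y.2.2 g i * (X i - A.act g (X i)) = y.2.1 - A.act g y.2.1 from
    h (b, p, D) hb
  classical
  clear hb b p D
  intro y hy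
  induction hy using Submodule.span_induction with
  | mem y hy =>
    obtain ⟨w, rfl, rfl⟩ := hy
    induction w with
    | nil => simp [wordGrad]
    | cons l w ih =>
      simp only [wordGrad, add_mul, Finset.sum_add_distrib, ite_mul, zero_mul, Finset.sum_ite_eq',
        Finset.mem_univ, if_true, List.map_cons, List.prod_cons, map_mul, mul_assoc,
        ← Finset.mul_sum] at ih ⊢
      rw [ih]
      ring
  | zero => simp
  | add z z' _ _ h h' =>
    simp only [Prod.snd_add, Prod.fst_add, Pi.add_apply, add_mul, Finset.sum_add_distrib, h, h',
      map_add]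
    ring
  | smul r z _ h =>
    simp only [Prod.smul_fst, Prod.smul_snd, Pi.smul_apply, smul_mul_assoc, ← Finset.smul_sum, h,
      map_smul, smul_sub]

theorem grad_one {n : ℕ} {b : B} {p : MvPolynomial ι k} {D : Γ → ι → MvPolynomial ι k}
    (hb : (b, p, D) ∈ A.gradWords n) (i : ι) : D 1 i = pderiv i p := by
  suffices h : ∀ y ∈ A.gradWords n, y.2.2 1 i = pderiv i y.2.1 from h (b, p, D) hb
  classical
  clear hb b p D
  intro y hy
  induction hy using Submodule.span_induction with
  | mem y hy =>
    obtain ⟨w, rfl, rfl⟩ := hy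
    induction w with
    | nil => simp [wordGrad]
    | cons l w ih =>
      simp only [wordGrad, List.map_cons, List.prod_cons, Derivation.leibniz, smul_eq_mul,
        A.act_one] at ih ⊢
      rw [ih, add_comm]
      congr 1
      split_ifs with h
      · rw [h, pderiv_X_self, mul_one]
      · rw [pderiv_X_of_ne (Ne.symm h), mul_zero]
  | zero => simp
  | add z z' _ _ h h' => simp only [Prod.snd_add, Prod.fst_add, Pi.add_apply, h, h', map_add]
  | smul r z _ h =>
    simp only [Prod.smul_fst, Prod.smul_snd, Pi.smul_apply, h]
    exact ((pderiv i).map_smul r z.2.1).symm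

variable (A) in
/-- The polynomials that are invariant under the group. -/
def Inv (p : MvPolynomial ι k) : Prop := ∀ g, A.act g p = p

/-- Multiply by a nonzero `X l - g (X l)`. The Jacobi identity trades this factor for `X i - g (X
i)` and `X j - g (X j)`, which contract with the twisted gradients to `p - g p = 0` and `q - g q =
0`. -/
theorem sum_form_grad_eq_zero [IsDomain k] {m n : ℕ} {b c : B} {p q : MvPolynomial ι k}
    {D E : Γ → ι → MvPolynomial ι k} (hb : (b, p, D) ∈ A.gradWords m)
    (hc : (c, q, E) ∈ A.gradWords n) (hp : A.Inv p) (hq : A.Inv q) {g : Γ} (hg : g ≠ 1) :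
    ∑ i, ∑ j, A.form g i j • (D g i * E g j) = 0 := by
  obtain ⟨l, hl⟩ := A.act_ne g hg
  have h1 := sum_grad_mul hb g
  have h2 := sum_grad_mul hc g
  rw [hp g, sub_self] at h1
  rw [hq g, sub_self] at h2
  refine (mul_eq_zero.1 ?_).resolve_right (sub_ne_zero.2 hl.symm)
  have h3 (i j : ι) : A.form g i j • (D g i * E g j) * (X l - A.act g (X l)) =
      - (D g i * (X i - A.act g (X i)) * (A.form g j l • E g j)) -
        E g j * (X j - A.act g (X j)) * (A.form g l i • D g i) := by
    have := congrArg (fun r ↦ r * (D g i * E g j)) (A.jacobi g i j l)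
    simp only [smul_eq_C_mul] at this ⊢
    linear_combination this
  simp only [Finset.sum_mul, h3, Finset.sum_sub_distrib, Finset.sum_neg_distrib]
  rw [Finset.sum_comm]
  simp only [← Finset.sum_mul, h1, h2]
  simp

/-- The leading term of the commutator of lifts of invariant polynomials only involves the
component of the commutators of letters at the unit of the group. -/
theorem theta_comm_sub_mem_of_inv [IsDomain k] {m n : ℕ} {b c : B} {p q : MvPolynomial ι k}
    (hb : (b, p) ∈ A.words m) (hc : (c, q) ∈ A.words n) (hp : A.Inv p) (hq : A.Inv q) :
    A.theta (b * c - c * b) - ∑ i, ∑ j, A.form 1 i j • (pderiv i p * pderiv j q) ∈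
      degLE ((m : ℤ) + n - 3) := by
  obtain ⟨D, hD⟩ := exists_mem_gradWords hb
  obtain ⟨E, hE⟩ := exists_mem_gradWords hc
  have := theta_comm_sub_mem hD hE
  rw [Finset.sum_eq_single 1 (fun g _ hg ↦ sum_form_grad_eq_zero hD hE hp hq hg)
    (fun h ↦ absurd (Finset.mem_univ _) h)] at this
  simpa only [grad_one hD, grad_one hE] using this

end PBWAlgebra

end

/-! ### From a normal form functional to a PBW basis -/

noncomputable section

open MvPolynomial

/-- Generators of an algebra together with a functional showing that ordered words are linearly
independent. -/
structure PrePBWAlgebra (k ι Γ B : Type*) [CommRing k] [Fintype ι] [LinearOrder ι] [Group Γ]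
    [Fintype Γ] [DecidableEq Γ] [Ring B] [Algebra k B] extends SkewGenerators k ι Γ B where
  /-- the functional -/
  L : B →ₗ[k] (Γ → MvPolynomial ι k)
  L_mul_γ : ∀ b g h, L (b * γ g) h = L b (h * g⁻¹)
  L_sorted : ∀ w : List ι, w.Pairwise (· ≤ ·) →
    L ((w.map x).prod) = (Pi.single 1 ((w.map X).prod) : Γ → MvPolynomial ι k)
  span_eq_top : Submodule.span k
    (Set.range fun p : List ι × Γ ↦ (p.1.map x).prod * γ p.2) = ⊤

section

variable {ι : Type*} [LinearOrder ι]

/-- The ordered word with given exponents. -/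
def sortedWord (d : ι →₀ ℕ) : List ι := (Finsupp.toMultiset d).toList.insertionSort (· ≤ ·)

theorem toMultiset_eq_sortedWord (d : ι →₀ ℕ) :
    Finsupp.toMultiset d = (sortedWord d : Multiset ι) := by
  rw [sortedWord, Multiset.coe_eq_coe.2 (List.perm_insertionSort _ _), Multiset.coe_toList]

theorem sortedWord_sorted (d : ι →₀ ℕ) : (sortedWord d).Pairwise (· ≤ ·) :=
  List.pairwise_insertionSort _ _

end

namespace PrePBWAlgebra

variable {k ι Γ B : Type*} [CommRing k] [Fintype ι] [LinearOrder ι] [Group Γ]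
    [Fintype Γ] [DecidableEq Γ] [Ring B] [Algebra k B] (A : PrePBWAlgebra k ι Γ B)

/-- The span of the words of length less than `n`, multiplied by group elements. -/
def lower (n : ℕ) : Submodule k B :=
  Submodule.span k ((fun p : List ι × Γ ↦ (p.1.map A.x).prod * A.γ p.2) ''
    {p | p.1.length < n})

variable {A}

theorem word_mem_lower {w : List ι} {n : ℕ} (h : w.length < n) (g : Γ) :
    (w.map A.x).prod * A.γ g ∈ A.lower n :=
  Submodule.subset_span ⟨(w, g), h, rfl⟩

theorem lower_mono {m n : ℕ} (h : m ≤ n) : A.lower m ≤ A.lower n :=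
  Submodule.span_mono (Set.image_mono fun _ hp ↦ lt_of_lt_of_le hp h)

theorem x_mul_mem_lower {n : ℕ} (i : ι) {b : B} (hb : b ∈ A.lower n) :
    A.x i * b ∈ A.lower (n + 1) := by
  suffices h : A.lower n ≤ (A.lower (n + 1)).comap (LinearMap.mulLeft k (A.x i)) from h hb
  refine Submodule.span_le.2 ?_
  rintro _ ⟨⟨w, g⟩, hw, rfl⟩
  have := word_mem_lower (A := A) (w := i :: w) (n := n + 1) (by simpa using hw) g
  rwa [List.map_cons, List.prod_cons, mul_assoc] at this

theorem mul_γ_mem_lower {n : ℕ} (g : Γ) {b : B} (hb : b ∈ A.lower n) :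
    b * A.γ g ∈ A.lower n := by
  suffices h : A.lower n ≤ (A.lower n).comap (LinearMap.mulRight k (A.γ g)) from h hb
  refine Submodule.span_le.2 ?_
  rintro _ ⟨⟨w, h⟩, hw, rfl⟩
  have := word_mem_lower (A := A) hw (h * g)
  rwa [map_mul, ← mul_assoc] at this

theorem γ_mul_word_mem_lower (g : Γ) (w : List ι) :
    A.γ g * (w.map A.x).prod ∈ A.lower (w.length + 1) := by
  induction w with
  | nil => simpa using word_mem_lower (A := A) (w := []) (n := 1) (by simp) g
  | cons i w ih =>
    rw [List.map_cons, List.prod_cons, ← mul_assoc, A.γ_mul_x, mul_assoc, Finset.sum_mul]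
    refine sum_mem fun j _ ↦ ?_
    rw [smul_mul_assoc]
    exact Submodule.smul_mem _ _ (x_mul_mem_lower j ih)

/-- Adjacent letters commute up to a combination of group elements, which replaces two letters and
so shortens the word. -/
theorem word_sub_mem_lower {w w' : List ι} (h : w.Perm w') :
    (w.map A.x).prod - (w'.map A.x).prod ∈ A.lower w.length := by
  induction h with
  | nil => simp
  | cons i _ ih =>
    rw [List.map_cons, List.prod_cons, List.map_cons, List.prod_cons, ← mul_sub]
    exact x_mul_mem_lower i ih
  | swap i j w =>
    have h1 : ((j :: i :: w).map A.x).prod - ((i :: j :: w).map A.x).prod =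
        ∑ g, A.form g j i • (A.γ g * (w.map A.x).prod) := by
      simp only [← smul_mul_assoc, ← Finset.sum_mul, ← A.x_comm, List.map_cons, List.prod_cons]
      noncomm_ring
    rw [h1]
    exact sum_mem fun g _ ↦ Submodule.smul_mem _ _
      (lower_mono (by simp) (γ_mul_word_mem_lower g w))
  | trans h1 _ ih1 ih2 =>
    rw [← sub_add_sub_cancel]
    exact add_mem ih1 (by rwa [h1.length_eq])

theorem L_word_sub_mem_of_lower {w : List ι} (h : ∀ b ∈ A.lower w.length, ∀ g,
    A.L b g ∈ degLE ((w.length : ℤ) - 1)) (g : Γ) :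
    A.L ((w.map A.x).prod) g - (Pi.single 1 ((w.map X).prod) : Γ → MvPolynomial ι k) g ∈
      degLE ((w.length : ℤ) - 1) := by
  have hs : w.Perm (w.insertionSort (· ≤ ·)) := (List.perm_insertionSort _ _).symm
  have h1 := A.L_sorted (w.insertionSort (· ≤ ·)) (List.pairwise_insertionSort _ _)
  rw [← (hs.map X).prod_eq] at h1
  rw [← h1, ← Pi.sub_apply, ← map_sub]
  exact h _ (word_sub_mem_lower hs) g

/-- Sorting a word changes it by shorter ones, to which strong induction applies, and the value on
the sorted word is prescribed. -/
theorem L_mem_of_mem_lower (n : ℕ) {b : B} (hb : b ∈ A.lower n) (g : Γ) :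
    A.L b g ∈ degLE ((n : ℤ) - 1) := by
  induction n using Nat.strong_induction_on generalizing b g with
  | _ n ih =>
  suffices h : A.lower n ≤ (degLE ((n : ℤ) - 1)).comap
      ((LinearMap.proj g : (Γ → MvPolynomial ι k) →ₗ[k] MvPolynomial ι k) ∘ₗ A.L) from h hb
  refine Submodule.span_le.2 ?_
  rintro _ ⟨⟨w, h⟩, hw, rfl⟩
  have hw : w.length < n := hw
  have h1 := L_word_sub_mem_of_lower (A := A) (w := w) (fun b hb g ↦ ih _ hw hb g) (g * h⁻¹)
  change A.L ((w.map A.x).prod * A.γ h) g ∈ degLE ((n : ℤ) - 1)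
  rw [A.L_mul_γ, ← sub_add_cancel (A.L _ _) ((Pi.single 1 ((w.map X).prod) :
    Γ → MvPolynomial ι k) (g * h⁻¹))]
  refine add_mem (degLE_mono (by omega) h1) ?_
  rw [Pi.single_apply]
  split_ifs
  · exact degLE_mono (by omega) (mem_degLE_of_comp_eq (comp_prod_X w))
  · exact zero_mem _

variable (A)

theorem L_word (w : List ι) (g : Γ) :
    A.L ((w.map A.x).prod) g - (Pi.single 1 ((w.map X).prod) : Γ → MvPolynomial ι k) g ∈
      degLE ((w.length : ℤ) - 1) :=
  L_word_sub_mem_of_lower (fun _ hb g ↦ L_mem_of_mem_lower _ hb g) g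

/-- The map sending a monomial to the ordered word with the same exponents. -/
def ordered : MvPolynomial ι k →ₗ[k] B :=
  (basisMonomials ι k).constr k fun d ↦ ((sortedWord d).map A.x).prod

theorem ordered_monomial (d : ι →₀ ℕ) :
    A.ordered (monomial d 1) = ((sortedWord d).map A.x).prod := by
  have := (basisMonomials ι k).constr_basis k (fun d ↦ ((sortedWord d).map A.x).prod) d
  rwa [coe_basisMonomials] at this

/-- The map sending a family of polynomials to the corresponding sum of ordered words. -/
def orderedSum : (Γ → MvPolynomial ι k) →ₗ[k] B :=
  ∑ g, LinearMap.mulRight k (A.γ g) ∘ₗ A.ordered ∘ₗ LinearMap.proj g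

theorem orderedSum_apply (m : Γ → MvPolynomial ι k) :
    A.orderedSum m = ∑ g, A.ordered (m g) * A.γ g := by
  simp [orderedSum]

theorem orderedSum_single (g : Γ) (p : MvPolynomial ι k) :
    A.orderedSum (Pi.single g p) = A.ordered p * A.γ g := by
  rw [orderedSum_apply, Finset.sum_eq_single g, Pi.single_eq_same]
  · intro h _ hg
    rw [Pi.single_eq_of_ne hg, map_zero, zero_mul]
  · simp

theorem L_ordered (p : MvPolynomial ι k) : A.L (A.ordered p) = (Pi.single 1 p : Γ → MvPolynomial ι k) := by
  have : A.L ∘ₗ A.ordered = LinearMap.single k (fun _ ↦ MvPolynomial ι k) 1 := by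
    refine (basisMonomials ι k).ext fun d ↦ ?_
    rw [coe_basisMonomials, LinearMap.comp_apply, ordered_monomial,
      A.L_sorted _ (sortedWord_sorted d), prod_map_X_eq_monomial (toMultiset_eq_sortedWord d)]
    rfl
  exact LinearMap.congr_fun this p

/-- This is the linear independence of the ordered words, detected by `L`. -/
theorem L_orderedSum (m : Γ → MvPolynomial ι k) : A.L (A.orderedSum m) = m := by
  funext h
  rw [orderedSum_apply, map_sum, Finset.sum_apply]
  simp only [A.L_mul_γ, L_ordered, Pi.single_apply, mul_inv_eq_one]
  simp

/-- This is the spanning half of PBW: straightening a word leaves only shorter words to treat. -/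
theorem lower_le_range (n : ℕ) : A.lower n ≤ LinearMap.range A.orderedSum := by
  induction n using Nat.strong_induction_on with
  | _ n ih =>
  refine Submodule.span_le.2 ?_
  rintro _ ⟨⟨w, g⟩, hw, rfl⟩
  have hw : w.length < n := hw
  obtain ⟨d, hd⟩ : ∃ d : ι →₀ ℕ, Finsupp.toMultiset d = (w : Multiset ι) :=
    ⟨Multiset.toFinsupp (w : Multiset ι), Multiset.toFinsupp_toMultiset _⟩
  have hs : w.Perm (sortedWord d) := by
    rw [← Multiset.coe_eq_coe, ← toMultiset_eq_sortedWord, hd]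
  change (w.map A.x).prod * A.γ g ∈ LinearMap.range A.orderedSum
  rw [← sub_add_cancel (w.map A.x).prod ((sortedWord d).map A.x).prod, add_mul]
  refine add_mem (ih _ hw (mul_γ_mem_lower g (word_sub_mem_lower hs))) ?_
  exact ⟨Pi.single g (monomial d 1), by rw [orderedSum_single, ordered_monomial]⟩

theorem orderedSum_L (b : B) : A.orderedSum (A.L b) = b := by
  obtain ⟨m, rfl⟩ : b ∈ LinearMap.range A.orderedSum := by
    have h : b ∈ (⊤ : Submodule k B) := trivial
    rw [← A.span_eq_top] at h
    refine Submodule.span_le.2 ?_ h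
    rintro _ ⟨⟨w, g⟩, rfl⟩
    exact A.lower_le_range (w.length + 1) (word_mem_lower (Nat.lt_succ_self _) g)
  rw [L_orderedSum]

/-- The PBW theorem. -/
def toPBWAlgebra : PBWAlgebra k ι Γ B where
  toSkewGenerators := A.toSkewGenerators
  coord := LinearEquiv.ofLinearMap A.L A.orderedSum (LinearMap.ext A.L_orderedSum)
    (LinearMap.ext A.orderedSum_L)
  coord_mul_γ := A.L_mul_γ
  coord_word := A.L_word

end PrePBWAlgebra

end

/-! ### Linear forms, the group action on polynomials, and flatness of the commutator form -/

noncomputable section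

namespace SympRefl

open MvPolynomial

section

variable {V : Type*} [AddCommGroup V] [Module ℂ V] {ι : Type*} {k : Type*} [CommRing k]
  [Algebra ℂ k]

variable (k) in
/-- Vectors as linear forms in the letters given by a basis. -/
def linPoly (b : Module.Basis ι ℂ V) : V →ₗ[ℂ] MvPolynomial ι k := b.constr ℂ X

variable (b : Module.Basis ι ℂ V)

theorem linPoly_basis (i : ι) : linPoly k b (b i) = X i := b.constr_basis ℂ _ i

theorem linPoly_eq [Fintype ι] (v : V) :
    linPoly k b v = ∑ j, algebraMap ℂ k (b.repr v j) • (X j : MvPolynomial ι k) := by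
  calc linPoly k b v = linPoly k b (∑ i, b.repr v i • b i) := by rw [b.sum_repr]
    _ = _ := by simp only [map_sum, map_smul, algebraMap_smul, linPoly_basis]

theorem linPoly_injective [Nontrivial k] [Fintype ι] : Function.Injective (linPoly k b) := by
  intro v w h
  rw [linPoly_eq, linPoly_eq] at h
  refine b.repr.injective (Finsupp.ext fun i ↦ ?_)
  classical
  have := congrArg (coeff (Finsupp.single i 1)) h
  simp only [coeff_sum, coeff_smul, coeff_X, smul_eq_mul, Finsupp.single_left_inj one_ne_zero,
    mul_ite, mul_one, mul_zero, Finset.sum_ite_eq', Finset.mem_univ, if_true] at this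
  exact (algebraMap ℂ k).injective this

variable (k) in
/-- The action of linear automorphisms of `V` on polynomials. -/
def polyAct : (V ≃ₗ[ℂ] V) →* (MvPolynomial ι k →ₐ[k] MvPolynomial ι k) :=
  have h (g : V ≃ₗ[ℂ] V) (v : V) : (aeval fun i ↦ linPoly k b (g (b i)) :
      MvPolynomial ι k →ₐ[k] MvPolynomial ι k) (linPoly k b v) = linPoly k b (g v) := by
    induction v using b.induction with
    | hb i => rw [linPoly_basis, aeval_X]
    | h0 => simp
    | hadd x y hx hy => simp only [map_add, hx, hy]
    | hsmul r x hx =>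
      rw [map_smul, ← algebraMap_smul k, map_smul, hx, algebraMap_smul, map_smul, map_smul]
  { toFun := fun g ↦ aeval fun i ↦ linPoly k b (g (b i))
    map_one' := by
      ext1 i
      rw [aeval_X]
      exact linPoly_basis b i
    map_mul' := fun g g' ↦ by
      ext1 i
      rw [aeval_X, AlgHom.mul_apply, aeval_X, h]
      rfl }

theorem polyAct_X (g : V ≃ₗ[ℂ] V) (i : ι) : polyAct k b g (X i) = linPoly k b (g (b i)) :=
  aeval_X _ _

theorem polyAct_linPoly (g : V ≃ₗ[ℂ] V) (v : V) :
    polyAct k b g (linPoly k b v) = linPoly k b (g v) := by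
  induction v using b.induction with
  | hb i => rw [linPoly_basis, polyAct_X]
  | h0 => simp
  | hadd x y hx hy => simp only [map_add, hx, hy]
  | hsmul r x hx =>
    rw [map_smul, ← algebraMap_smul k, map_smul, hx, algebraMap_smul, map_smul, map_smul]

end

section

variable {V : Type*} [AddCommGroup V] [Module ℂ V]

theorem conj_pow_apply (g h : V ≃ₗ[ℂ] V) (i : ℕ) (x : V) :
    ((h * g * h⁻¹) ^ i) (h x) = h ((g ^ i) x) := by
  rw [conj_pow]
  change h ((g ^ i) (h⁻¹ (h x))) = h ((g ^ i) x)
  rw [← LinearEquiv.mul_apply h⁻¹ h, inv_mul_cancel]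
  rfl

theorem movedProj_conj (g h : V ≃ₗ[ℂ] V) (x : V) :
    movedProj (h * g * h⁻¹) (h x) = h (movedProj g x) := by
  have : orderOf (h * g * h⁻¹) = orderOf g := by
    rw [← MulAut.conj_apply]
    exact MulEquiv.orderOf_eq (MulAut.conj h) g
  rw [movedProj_apply, movedProj_apply, this]
  simp only [conj_pow_apply, map_sub, map_smul, map_sum]

theorem sub_pow_mem_range (g : V ≃ₗ[ℂ] V) (i : ℕ) (x : V) :
    x - (g ^ i) x ∈ LinearMap.range (LinearMap.id - (g : V →ₗ[ℂ] V)) := by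
  induction i with
  | zero => simp
  | succ i ih =>
    rw [← sub_add_sub_cancel x ((g ^ i) x)]
    refine add_mem ih ⟨(g ^ i) x, ?_⟩
    rw [pow_succ']
    rfl

theorem movedProj_mem_range {g : V ≃ₗ[ℂ] V} (hg : IsOfFinOrder g) (x : V) :
    movedProj g x ∈ LinearMap.range (LinearMap.id - (g : V →ₗ[ℂ] V)) := by
  have h0 : (orderOf g : ℂ) ≠ 0 := Nat.cast_ne_zero.mpr hg.orderOf_pos.ne'
  have : movedProj g x =
      (orderOf g : ℂ)⁻¹ • ∑ i ∈ Finset.range (orderOf g), (x - (g ^ i) x) := by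
    rw [movedProj_apply, Finset.sum_sub_distrib, Finset.sum_const, Finset.card_range,
      ← Nat.cast_smul_eq_nsmul ℂ, smul_sub, smul_smul, inv_mul_cancel₀ h0, one_smul]
  rw [this]
  exact Submodule.smul_mem _ _ (sum_mem fun i _ ↦ sub_pow_mem_range g i x)

/-- In a plane, the alternating trilinear map `ω(p, q) r + ω(q, r) p + ω(r, p) q` vanishes. -/
theorem cyclic_sum_eq_zero {ω : LinearMap.BilinForm ℂ V} (hω : ω.IsAlt) {U : Submodule ℂ V}
    (hU : Module.finrank ℂ U = 2) {p q r : V} (hp : p ∈ U) (hq : q ∈ U) (hr : r ∈ U) :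
    ω p q • r + ω q r • p + ω r p • q = 0 := by
  have : Module.Finite ℂ U := Module.finite_of_finrank_eq_succ hU
  let e := Module.finBasisOfFinrankEq ℂ U hU
  have he (v : U) : (v : V) = e.repr v 0 • (e 0 : V) + e.repr v 1 • (e 1 : V) := by
    have := congrArg (Subtype.val) (e.sum_repr v)
    rw [Fin.sum_univ_two] at this
    exact this.symm
  have h10 : ω (e 1) (e 0) = - ω (e 0) (e 1) := (LinearMap.IsAlt.neg hω _ _).symm
  have hp' := he ⟨p, hp⟩
  have hq' := he ⟨q, hq⟩
  have hr' := he ⟨r, hr⟩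
  simp only at hp' hq' hr'
  rw [hp', hq', hr']
  simp only [map_add, map_smul, LinearMap.add_apply, LinearMap.smul_apply, hω _, h10,
    smul_eq_mul, mul_zero, add_zero, zero_add]
  module

/-- The form `ω_g` factors through the projection to the plane `Im (Id - g)`, and so does `Id - g`.
The identity is therefore the image under `Id - g` of `cyclic_sum_eq_zero` for the projected
vectors. -/
theorem formRefl_jacobi {ω : LinearMap.BilinForm ℂ V} (hω : ω.IsAlt) {g : V ≃ₗ[ℂ] V}
    (hg : IsOfFinOrder g)
    (hr : Module.finrank ℂ (LinearMap.range (LinearMap.id - (g : V →ₗ[ℂ] V))) = 2) (x y z : V) :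
    formRefl ω g x y • (z - g z) + formRefl ω g y z • (x - g x) +
      formRefl ω g z x • (y - g y) = 0 := by
  have h := cyclic_sum_eq_zero hω hr (movedProj_mem_range hg x) (movedProj_mem_range hg y)
    (movedProj_mem_range hg z)
  have h1 (v : V) : v - g v = movedProj g v - g (movedProj g v) := by
    have := fixed_sub_movedProj (s := g) v
    rw [map_sub, sub_eq_sub_iff_add_eq_add] at this
    rw [sub_eq_sub_iff_add_eq_add, ← this, add_comm]
  rw [h1 x, h1 y, h1 z]
  have h2 := congrArg (fun v ↦ v - g v) h
  simp only [map_add, map_smul, map_zero, sub_zero] at h2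
  rw [← h2]
  simp only [formRefl, LinearMap.compl₁₂_apply]
  module

end

section

variable {V : Type*} [AddCommGroup V] [Module ℂ V] (ω : LinearMap.BilinForm ℂ V)
  (Γ : Subgroup (V ≃ₗ[ℂ] V)) (c : invariantFunctions Γ) {k : Type*} [CommRing k] [Algebra ℂ k]

variable {Γ} in
open Classical in
/-- The extension of a function on reflections by zero. -/
def extendFun (g : Γ) : ℂ := if h : g ∈ reflections Γ then c.1 ⟨g, h⟩ else 0

variable {Γ} in
theorem conj_mem_reflections_iff (h g : Γ) :
    h * g * h⁻¹ ∈ reflections Γ ↔ g ∈ reflections Γ := by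
  have : LinearMap.range (LinearMap.id - (((h * g * h⁻¹ : Γ) : V ≃ₗ[ℂ] V) : V →ₗ[ℂ] V)) =
      (LinearMap.range (LinearMap.id - ((g : V ≃ₗ[ℂ] V) : V →ₗ[ℂ] V))).map
        ((h : V ≃ₗ[ℂ] V) : V →ₗ[ℂ] V) := by
    have h1 (y : V) : (h : V ≃ₗ[ℂ] V) y - ((h * g * h⁻¹ : Γ) : V ≃ₗ[ℂ] V) ((h : V ≃ₗ[ℂ] V) y) =
        (h : V ≃ₗ[ℂ] V) (y - (g : V ≃ₗ[ℂ] V) y) := by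
      have := conj_pow_apply (g : V ≃ₗ[ℂ] V) h 1 y
      rw [pow_one, pow_one] at this
      rw [map_sub, ← this]
      rfl
    ext v
    constructor
    · rintro ⟨y, rfl⟩
      obtain ⟨y, rfl⟩ := (h : V ≃ₗ[ℂ] V).surjective y
      exact ⟨_, ⟨y, rfl⟩, (h1 y).symm⟩
    · rintro ⟨_, ⟨y, rfl⟩, rfl⟩
      exact ⟨(h : V ≃ₗ[ℂ] V) y, h1 y⟩
  change Module.finrank ℂ _ = 2 ↔ Module.finrank ℂ _ = 2
  rw [this, LinearEquiv.finrank_map_eq]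

variable {Γ} in
theorem extendFun_conj (h g : Γ) : extendFun c (h * g * h⁻¹) = extendFun c g := by
  unfold extendFun
  by_cases hg : g ∈ reflections Γ
  · rw [dif_pos hg, dif_pos ((conj_mem_reflections_iff h g).2 hg)]
    exact (c.2 _ _ (isConj_iff.2 ⟨h, rfl⟩)).symm
  · rw [dif_neg hg, dif_neg ((conj_mem_reflections_iff h g).not.2 hg)]

open Classical in
/-- The components of the commutator of two vectors, where `τ` is the deformation parameter. -/
def kappaForm (τ : k) (g : Γ) : V →ₗ[ℂ] V →ₗ[ℂ] k :=
  (if g = 1 then ω.compr₂ (LinearMap.toSpanSingleton ℂ k τ) else 0) +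
    extendFun c g • (formRefl ω (g : V ≃ₗ[ℂ] V)).compr₂ (Algebra.linearMap ℂ k)

open Classical in
theorem kappaForm_apply (τ : k) (g : Γ) (x y : V) : kappaForm ω Γ c τ g x y =
    (if g = 1 then ω x y • τ else 0) +
      algebraMap ℂ k (extendFun c g * formRefl ω (g : V ≃ₗ[ℂ] V) x y) := by
  rw [map_mul, ← Algebra.smul_def]
  unfold kappaForm
  split_ifs <;> simp

theorem extendFun_one : extendFun c 1 = 0 := by
  refine dif_neg fun h ↦ ?_
  have h : Module.finrank ℂ _ = 2 := h
  have h0 : LinearMap.id - (((1 : Γ) : V ≃ₗ[ℂ] V) : V →ₗ[ℂ] V) = 0 := by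
    ext v
    simp
  rw [h0, LinearMap.range_zero, finrank_bot] at h
  exact absurd h (by norm_num)

theorem kappaForm_one (τ : k) (x y : V) : kappaForm ω Γ c τ 1 x y = ω x y • τ := by
  rw [kappaForm_apply, if_pos rfl, extendFun_one, zero_mul, map_zero, add_zero]

variable {ω Γ}

/-- The Jacobi identity is checked for each group element separately: at the unit the vectors `z - g
z` vanish, at a reflection it is `formRefl_jacobi`, and elsewhere the form is zero. Equivariance
uses the invariance of `ω` and of `c`. -/
theorem isFlatForm_kappaForm [Finite Γ] (hω : ω.IsAlt)
    (hΓ : ∀ g ∈ Γ, ∀ x y, ω (g x) (g y) = ω x y) (τ : k) :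
    IsFlatForm (kappaForm ω Γ c τ) where
  self g x := by
    rw [kappaForm_apply]
    simp [hω _, formRefl]
  equivariant h g x y := by
    have h1 : h * g * h⁻¹ = 1 ↔ g = 1 := conj_eq_one_iff
    have h2 : formRefl ω ((h * g * h⁻¹ : Γ) : V ≃ₗ[ℂ] V) ((h : V ≃ₗ[ℂ] V) x)
        ((h : V ≃ₗ[ℂ] V) y) = formRefl ω (g : V ≃ₗ[ℂ] V) x y := by
      have := movedProj_conj (g : V ≃ₗ[ℂ] V) (h : V ≃ₗ[ℂ] V)
      simp only [formRefl, LinearMap.compl₁₂_apply]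
      change ω (movedProj ((h : V ≃ₗ[ℂ] V) * (g : V ≃ₗ[ℂ] V) * (h : V ≃ₗ[ℂ] V)⁻¹) _)
        (movedProj ((h : V ≃ₗ[ℂ] V) * (g : V ≃ₗ[ℂ] V) * (h : V ≃ₗ[ℂ] V)⁻¹) _) = _
      rw [this, this, hΓ _ h.2]
    rw [kappaForm_apply, kappaForm_apply, extendFun_conj, h2, hΓ _ h.2]
    split_ifs with h3 h4 h4
    · rfl
    · exact absurd (h1.1 h3) h4
    · exact absurd (h1.2 h4) h3
    · rfl
  jacobi g x y z f := by
    by_cases h1 : g = 1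
    · subst h1
      simp
    · rw [kappaForm_apply, kappaForm_apply, kappaForm_apply]
      simp only [if_neg h1, zero_add, ← map_mul, ← map_add]
      rw [← map_zero (algebraMap ℂ k)]
      congr 1
      by_cases hg : g ∈ reflections Γ
      · have hfin : IsOfFinOrder (g : V ≃ₗ[ℂ] V) :=
          Submonoid.isOfFinOrder_coe.2 (isOfFinOrder_of_finite g)
        have := congrArg f (formRefl_jacobi hω hfin hg x y z)
        simp only [map_add, map_smul, smul_eq_mul, map_zero] at this
        linear_combination extendFun c g * this
      · simp [extendFun, dif_neg hg]

theorem kappa_eq_sum [Fintype Γ] (x y : V) : kappa ω Γ c x y =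
    ∑ g : Γ, (extendFun c g * formRefl ω (g : V ≃ₗ[ℂ] V) x y) • ofGrp Γ g := by
  classical
  rw [kappa]
  refine Fintype.sum_of_injective Subtype.val Subtype.val_injective _ _ (fun g hg ↦ ?_)
    (fun s ↦ ?_)
  · have hg : g ∉ reflections Γ := by simpa using hg
    rw [extendFun, dif_neg hg, zero_mul, zero_smul]
  · rw [extendFun, dif_pos s.2]

end

end SympRefl

end

/-! ### The normal form functional on the smash product -/

noncomputable section

/-- An additive map which is compatible with the relations defining a quotient ring, also after
multiplication from both sides, vanishes on the kernel of the quotient map. -/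
theorem RingQuot.apply_eq_zero {R G : Type*} [Ring R] [AddCommGroup G] {r : R → R → Prop}
    (L : R →+ G) (h : ∀ x y, r x y → ∀ b c, L (b * x * c) = L (b * y * c)) {p : R}
    (hp : RingQuot.mkRingHom r p = 0) : L p = 0 := by
  -- The elements all of whose two-sided multiples are killed by `L` form an ideal; it contains the
  -- differences of related elements, so the quotient by it receives a map from `RingQuot r`.
  let I : TwoSidedIdeal R := TwoSidedIdeal.mk' {a | ∀ b c, L (b * a * c) = 0}
    (fun b c ↦ by simp)
    (fun {x y} hx hy b c ↦ by rw [mul_add, add_mul, map_add, hx b c, hy b c, add_zero])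
    (fun {x} hx b c ↦ by rw [mul_neg, neg_mul, map_neg, hx b c, neg_zero])
    (fun {x y} hy b c ↦ by rw [← mul_assoc]; exact hy _ _)
    (fun {x y} hx b c ↦ by rw [← mul_assoc, mul_assoc _ y]; exact hx _ _)
  let q : R →+* I.ringCon.Quotient := I.ringCon.mk'
  have hq (b : R) : q b = 0 ↔ ∀ u v, L (u * b * v) = 0 := by
    have h1 : q b = 0 ↔ I.ringCon b 0 := by
      rw [← map_zero q]; exact RingCon.eq _
    rw [h1, ← TwoSidedIdeal.mem_iff]
    exact TwoSidedIdeal.mem_mk' _ _ _ _ _ _ _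
  have hr : ∀ ⦃x y⦄, r x y → q x = q y := by
    intro x y hxy
    rw [← sub_eq_zero, ← map_sub, hq]
    intro u v
    rw [mul_sub, sub_mul, map_sub, h x y hxy, sub_self]
  have h1 : RingQuot.lift ⟨q, hr⟩ (RingQuot.mkRingHom r p) = q p :=
    RingQuot.lift_mkRingHom_apply _ _ _
  rw [hp, map_zero] at h1
  simpa using (hq p).1 h1.symm 1 1

namespace SympRefl

open MvPolynomial

variable {V : Type*} [AddCommGroup V] [Module ℂ V] (Γ : Subgroup (V ≃ₗ[ℂ] V))

/-- The inclusion of a summand of the smash product. -/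
def smashSingle (g : Γ) : TensorAlgebra ℂ V →ₗ[ℂ] Smash Γ where
  toFun a := SkewMonoidAlgebra.single g a
  map_add' _ _ := SkewMonoidAlgebra.single_add _ _ _
  map_smul' _ _ := (SkewMonoidAlgebra.smul_single _ _ _).symm

/-- The coefficients of elements of the smash product. -/
def smashCoeff (g : Γ) : Smash Γ →ₗ[ℂ] TensorAlgebra ℂ V where
  toFun a := SkewMonoidAlgebra.coeff a g
  map_add' _ _ := by
    exact DFunLike.congr_fun (SkewMonoidAlgebra.coeff_add _ _) g
  map_smul' _ _ := by
    exact DFunLike.congr_fun (SkewMonoidAlgebra.coeff_smul _ _) g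

variable {Γ}

theorem smashSingle_mul (g h : Γ) (a b : TensorAlgebra ℂ V) :
    smashSingle Γ g a * smashSingle Γ h b = smashSingle Γ (g * h) (a * g • b) :=
  SkewMonoidAlgebra.single_mul_single

theorem smashCoeff_single [DecidableEq Γ] (g h : Γ) (a : TensorAlgebra ℂ V) :
    smashCoeff Γ h (smashSingle Γ g a) = if g = h then a else 0 :=
  SkewMonoidAlgebra.coeff_single_apply

theorem smash_induction {p : Smash Γ → Prop} (u : Smash Γ) (h0 : p 0)
    (hs : ∀ g a, p (smashSingle Γ g a)) (hadd : ∀ u v, p u → p v → p (u + v)) : p u :=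
  SkewMonoidAlgebra.induction_on (p := p) u h0 hs fun {u v} ↦ hadd u v

theorem ofVec_eq (x : V) : ofVec Γ x = smashSingle Γ 1 (TensorAlgebra.ι ℂ x) := rfl

theorem ofGrp_eq (g : Γ) : ofGrp Γ g = smashSingle Γ g 1 := rfl

theorem prod_ofVec {ι : Type*} (b : Module.Basis ι ℂ V) (w : List ι) :
    (w.map fun i ↦ ofVec Γ (b i)).prod = smashSingle Γ 1 (word b w) := by
  induction w with
  | nil => rw [word_nil]; rfl
  | cons i w ih =>
    rw [List.map_cons, List.prod_cons, ih, ofVec_eq, smashSingle_mul, one_smul, word_cons, one_mul]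

theorem smashSingle_eq_mul (g : Γ) (a : TensorAlgebra ℂ V) :
    smashSingle Γ g a = smashSingle Γ 1 a * ofGrp Γ g := by
  rw [ofGrp_eq, smashSingle_mul, one_smul, mul_one, one_mul]

variable {ι k : Type*} [CommRing k]

/-- The right translation on families of polynomials. -/
def translate (g : Γ) : (Γ → MvPolynomial ι k) →ₗ[k] (Γ → MvPolynomial ι k) :=
  LinearMap.funLeft k _ fun h ↦ h * g⁻¹

theorem translate_apply (g h : Γ) (m : Γ → MvPolynomial ι k) :
    translate g m h = m (h * g⁻¹) := rfl

theorem translate_translate (g h : Γ) (m : Γ → MvPolynomial ι k) :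
    translate h (translate g m) = translate (g * h) m := by
  funext x
  simp only [translate_apply, mul_inv_rev, mul_assoc]

variable [Fintype Γ] [LinearOrder ι] [Algebra ℂ k]

open Classical in
/-- The normal form functional on the tensor algebra, with values in families of polynomials. -/
def polyForm (κ : Γ → V →ₗ[ℂ] V →ₗ[ℂ] k) (b : Module.Basis ι ℂ V) :
    TensorAlgebra ℂ V →ₗ[ℂ] (Γ → MvPolynomial ι k) :=
  normalForm κ translate b fun w ↦ Pi.single 1 ((w.map X).prod)

/-- The normal form functional on the smash product. -/
def smashForm (κ : Γ → V →ₗ[ℂ] V →ₗ[ℂ] k) (b : Module.Basis ι ℂ V) :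
    Smash Γ →ₗ[ℂ] (Γ → MvPolynomial ι k) :=
  ∑ g, (translate g).restrictScalars ℂ ∘ₗ polyForm κ b ∘ₗ smashCoeff Γ g

variable {κ : Γ → V →ₗ[ℂ] V →ₗ[ℂ] k} {b : Module.Basis ι ℂ V}

theorem smashForm_single (g : Γ) (a : TensorAlgebra ℂ V) :
    smashForm κ b (smashSingle Γ g a) = translate g (polyForm κ b a) := by
  classical
  rw [smashForm, LinearMap.sum_apply, Finset.sum_eq_single g]
  · simp [smashCoeff_single]
  · intro h _ hg
    simp [smashCoeff_single, hg.symm]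
  · simp

theorem smashForm_mul_ofGrp (u : Smash Γ) (g : Γ) :
    smashForm κ b (u * ofGrp Γ g) = translate g (smashForm κ b u) := by
  induction u using smash_induction with
  | h0 => simp
  | hs h a =>
    rw [ofGrp_eq, smashSingle_mul, smul_one, mul_one, smashForm_single, smashForm_single,
      translate_translate]
  | hadd u v hu hv => rw [add_mul, map_add, map_add, map_add, hu, hv]

theorem smashForm_word [DecidableEq Γ] {w : List ι} (hw : w.Pairwise (· ≤ ·)) :
    smashForm κ b ((w.map fun i ↦ ofVec Γ (b i)).prod) = 
      (Pi.single 1 ((w.map X).prod) : Γ → MvPolynomial ι k) := by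
  rw [prod_ofVec, smashForm_single, polyForm, normalForm_sorted _ _ _ _ hw]
  funext h
  rw [translate_apply, inv_one, mul_one]
  congr!

variable [Fintype ι]

theorem polyForm_comm (hκ : IsFlatForm κ) (a : TensorAlgebra ℂ V) (x y : V)
    (c : TensorAlgebra ℂ V) :
    polyForm κ b (a * (TensorAlgebra.ι ℂ x * TensorAlgebra.ι ℂ y -
        TensorAlgebra.ι ℂ y * TensorAlgebra.ι ℂ x) * c) =
      swapTerm κ translate (polyForm κ b) a x y c :=
  normalForm_comm hκ translate_translate b _ a x y c

/-- Pulling the group element `h` of the left factor through the commutator replaces `x`, `y` by `h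
x`, `h y`; equivariance of `κ` undoes this after conjugating the summation index. -/
theorem smashForm_comm (hκ : IsFlatForm κ) (x y : V) (u v : Smash Γ) :
    smashForm κ b (u * (ofVec Γ x * ofVec Γ y - ofVec Γ y * ofVec Γ x) * v) =
      ∑ g, κ g x y • smashForm κ b (u * ofGrp Γ g * v) := by
  induction u using smash_induction with
  | h0 => simp
  | hadd u u' hu hu' =>
    simp only [add_mul, map_add, hu, hu', smul_add, Finset.sum_add_distrib]
  | hs h u =>
  induction v using smash_induction with
  | h0 => simp
  | hadd u u' hu hu' =>
    simp only [mul_add, map_add, hu, hu', smul_add, Finset.sum_add_distrib]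
  | hs l v =>
  have h1 : smashSingle Γ h u * (ofVec Γ x * ofVec Γ y - ofVec Γ y * ofVec Γ x) *
      smashSingle Γ l v = smashSingle Γ (h * l) (u * (TensorAlgebra.ι ℂ ((h : V ≃ₗ[ℂ] V) x) *
        TensorAlgebra.ι ℂ ((h : V ≃ₗ[ℂ] V) y) - TensorAlgebra.ι ℂ ((h : V ≃ₗ[ℂ] V) y) *
        TensorAlgebra.ι ℂ ((h : V ≃ₗ[ℂ] V) x)) * h • v) := by
    simp only [ofVec_eq, smashSingle_mul, one_smul, mul_one, mul_sub, sub_mul, map_sub, smul_mul',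
      smul_ι]
  rw [h1, smashForm_single, polyForm_comm hκ]
  rw [swapTerm, map_sum]
  refine (Fintype.sum_equiv (MulAut.conj h).toEquiv _ _ fun g ↦ ?_).symm
  simp only [MulEquiv.toEquiv_eq_coe, EquivLike.coe_coe, MulAut.conj_apply]
  rw [hκ.equivariant, map_smul, translate_translate, smul_smul, inv_mul_cancel_right, ofGrp_eq,
    smashSingle_mul, smashSingle_mul, smashForm_single, smul_one, mul_one]
  congr 2
  simp only [mul_assoc, inv_mul_cancel_left]

/-- The commutator rule in the shape of the defining relations, with arbitrary factors on both sides
as `RingQuot.apply_eq_zero` requires. It serves both for a number `τ` and for the indeterminate. -/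
theorem mul_smashForm {ω : LinearMap.BilinForm ℂ V} (hω : ω.IsAlt)
    (hΓ : ∀ g ∈ Γ, ∀ x y, ω (g x) (g y) = ω x y) (c : invariantFunctions Γ) (τ : k) (x y : V)
    (u v : Smash Γ) :
    smashForm (kappaForm ω Γ c τ) b (u * (ofVec Γ x * ofVec Γ y - ofVec Γ y * ofVec Γ x) * v) =
      (ω x y • τ) • smashForm (kappaForm ω Γ c τ) b (u * v) +
      smashForm (kappaForm ω Γ c τ) b (u * kappa ω Γ c x y * v) := by
  classical
  rw [smashForm_comm (isFlatForm_kappaForm c hω hΓ τ)]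
  simp only [kappaForm_apply, add_smul, ite_smul, zero_smul, Finset.sum_add_distrib,
    Finset.sum_ite_eq', Finset.mem_univ, if_true, map_one, mul_one, kappa_eq_sum, Finset.mul_sum,
    Finset.sum_mul, map_sum, mul_smul_comm, smul_mul_assoc, map_smul, algebraMap_smul]

end SympRefl

end

/-! ### The PBW theorem for symplectic reflection algebras and for their family -/

noncomputable section

namespace SympRefl

open MvPolynomial

variable {V : Type*} [AddCommGroup V] [Module ℂ V] {ω : LinearMap.BilinForm ℂ V}
  {Γ : Subgroup (V ≃ₗ[ℂ] V)} [Fintype Γ] (c : invariantFunctions Γ)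

section

variable {ι k B : Type*} [LinearOrder ι] [Fintype ι] [CommRing k] [Algebra ℂ k] [Ring B]
  [Algebra k B] (b : Module.Basis ι ℂ V) (τ : k)

/-- The generators of an algebra in which the defining relations of symplectic reflection algebras
hold. -/
def skewGenerators [Nontrivial k] (hω : ω.IsAlt) (hΓ : ∀ g ∈ Γ, ∀ x y, ω (g x) (g y) = ω x y)
    (f : Smash Γ →+* B) (hf : ∀ (r : ℂ) u, f (r • u) = algebraMap ℂ k r • f u)
    (hrel : ∀ x y, f (ofVec Γ x * ofVec Γ y - ofVec Γ y * ofVec Γ x) =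
      (ω x y • τ) • 1 + f (kappa ω Γ c x y)) : SkewGenerators k ι Γ B where
  act := (polyAct k b).comp Γ.subtype
  mat g j i := algebraMap ℂ k (b.repr ((g : V ≃ₗ[ℂ] V) (b i)) j)
  act_X g i := (polyAct_X b _ i).trans (linPoly_eq b _)
  act_ne g hg := by
    by_contra! h
    apply hg
    ext v
    have h1 : ((g : V ≃ₗ[ℂ] V) : V →ₗ[ℂ] V) = LinearMap.id := b.ext fun i ↦ by
      refine linPoly_injective (k := k) b ?_
      rw [LinearMap.id_apply, linPoly_basis, ← h i]
      exact (polyAct_X b _ i).symm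
    exact LinearMap.congr_fun h1 v
  form g i j := kappaForm ω Γ c τ g (b i) (b j)
  jacobi g i j l := by
    have := (isFlatForm_kappaForm c hω hΓ τ).jacobi_map b g (b i) (b j) (b l) (linPoly k b)
    simp only [map_sub, linPoly_basis] at this
    exact (by simpa only [MonoidHom.comp_apply, Subgroup.coe_subtype, polyAct_X] using this)
  x i := f (ofVec Γ (b i))
  γ := (f : Smash Γ →* B).comp (ofGrp Γ)
  γ_mul_x g i := by
    have h1 : ∑ j, algebraMap ℂ k (b.repr ((g : V ≃ₗ[ℂ] V) (b i)) j) • f (ofVec Γ (b j)) =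
        f (ofVec Γ ((g : V ≃ₗ[ℂ] V) (b i))) := by
      simp only [← hf, ← map_smul, ← map_sum, b.sum_repr]
    rw [h1]
    change f (ofGrp Γ g) * f (ofVec Γ (b i)) = _ * f (ofGrp Γ g)
    rw [← map_mul, ofGrp_mul_ofVec, map_mul]
  x_comm i j := by
    classical
    rw [← map_mul f, ← map_mul f, ← map_sub f, hrel]
    simp only [kappaForm_apply, add_smul, Finset.sum_add_distrib, ite_smul, zero_smul,
      Finset.sum_ite_eq', Finset.mem_univ, if_true, map_one, kappa_eq_sum, map_sum, hf]
    rfl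
  invCard := algebraMap ℂ k (Fintype.card Γ : ℂ)⁻¹
  invCard_mul := by
    rw [← map_natCast (algebraMap ℂ k), ← map_mul,
      inv_mul_cancel₀ (Nat.cast_ne_zero.mpr Fintype.card_ne_zero), map_one]

/-- A functional extending the normal form functional gives the PBW theorem. -/
def prePBWAlgebra [Nontrivial k] [DecidableEq Γ] (hω : ω.IsAlt)
    (hΓ : ∀ g ∈ Γ, ∀ x y, ω (g x) (g y) = ω x y)
    (f : Smash Γ →+* B) (hf : ∀ (r : ℂ) u, f (r • u) = algebraMap ℂ k r • f u)
    (hrel : ∀ x y, f (ofVec Γ x * ofVec Γ y - ofVec Γ y * ofVec Γ x) =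
      (ω x y • τ) • 1 + f (kappa ω Γ c x y))
    (hspan : Submodule.span k (Set.range f) = ⊤) (L : B →ₗ[k] (Γ → MvPolynomial ι k))
    (hL : ∀ u, L (f u) = smashForm (kappaForm ω Γ c τ) b u) : PrePBWAlgebra k ι Γ B where
  toSkewGenerators := skewGenerators c b τ hω hΓ f hf hrel
  L := L
  L_mul_γ u g h := by
    suffices L (u * f (ofGrp Γ g)) = translate g (L u) from
      congrFun this h
    have hu : u ∈ Submodule.span k (Set.range f) := hspan ▸ trivial
    induction hu using Submodule.span_induction with
    | mem _ hx =>
      obtain ⟨u, rfl⟩ := hx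
      rw [← map_mul, hL, hL, smashForm_mul_ofGrp]
    | zero => simp
    | add x y _ _ hx hy => rw [add_mul, map_add, map_add, map_add, hx, hy]
    | smul r x _ hx => rw [smul_mul_assoc, map_smul, map_smul, map_smul, hx]
  L_sorted w hw := by
    rw [← smashForm_word (κ := kappaForm ω Γ c τ) (b := b) hw, ← hL, map_list_prod f,
      List.map_map]
    rfl
  span_eq_top := by
    rw [← top_le_iff, ← hspan]
    refine Submodule.span_le.2 ?_
    rintro _ ⟨u, rfl⟩
    induction u using smash_induction with
    | h0 => rw [map_zero]; exact zero_mem _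
    | hadd u v hu hv => rw [map_add]; exact add_mem hu hv
    | hs g a =>
    induction a using (wordBasis b).induction with
    | h0 => rw [map_zero, map_zero]; exact zero_mem _
    | hadd u v hu hv => rw [map_add, map_add]; exact add_mem hu hv
    | hsmul r u hu => rw [map_smul, hf]; exact Submodule.smul_mem _ _ hu
    | hb w =>
      refine Submodule.subset_span ⟨(w, g), ?_⟩
      change (w.map fun i ↦ f (ofVec Γ (b i))).prod * f (ofGrp Γ g) = _
      rw [wordBasis_apply, smashSingle_eq_mul, map_mul, ← prod_ofVec, map_list_prod, List.map_map]
      rfl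

end

section H

variable {ι : Type*} [LinearOrder ι] [Fintype ι] (b : Module.Basis ι ℂ V)

theorem smashForm_eq_zero_of_H_mk (hω : ω.IsAlt) (hΓ : ∀ g ∈ Γ, ∀ x y, ω (g x) (g y) = ω x y)
    (t : ℂ) {u : Smash Γ} (hu : H.mk ω Γ t c u = 0) : smashForm (kappaForm ω Γ c t) b u = 0 := by
  refine RingQuot.apply_eq_zero (r := Rel ω Γ t c)
    (smashForm (kappaForm ω Γ c t) b).toAddMonoidHom ?_ ?_
  · rintro _ _ ⟨x, y⟩ u v
    refine (mul_smashForm hω hΓ c t x y u v).trans ?_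
    change _ = smashForm (kappaForm ω Γ c t) b (u * ((t * ω x y) • 1 + kappa ω Γ c x y) * v)
    rw [mul_add, add_mul, map_add, mul_smul_comm, mul_one, smul_mul_assoc, map_smul, smul_eq_mul,
      mul_comm]
  · exact (congrArg (fun F : Smash Γ →+* RingQuot (Rel ω Γ t c) ↦ F u)
      (RingQuot.mkAlgHom_coe ℂ (Rel ω Γ t c))).symm.trans hu

theorem H.mk_surjective (t : ℂ) : Function.Surjective (H.mk ω Γ t c) :=
  RingQuot.mkAlgHom_surjective ℂ (Rel ω Γ t c)

theorem H.mk_comm (t : ℂ) (x y : V) :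
    H.mk ω Γ t c (ofVec Γ x * ofVec Γ y - ofVec Γ y * ofVec Γ x) =
      (ω x y • t) • 1 + H.mk ω Γ t c (kappa ω Γ c x y) := by
  refine (RingQuot.mkAlgHom_rel ℂ (Rel.comm (ω := ω) (Γ := Γ) (t := t) (c := c) x y)).trans ?_
  change H.mk ω Γ t c _ = _
  rw [map_add, map_smul, map_one, mul_comm, smul_eq_mul]

/-- The normal form functional on symplectic reflection algebras. -/
def H.form (hω : ω.IsAlt) (hΓ : ∀ g ∈ Γ, ∀ x y, ω (g x) (g y) = ω x y) (t : ℂ) :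
    H ω Γ t c →ₗ[ℂ] (Γ → MvPolynomial ι ℂ) :=
  (LinearMap.ker (H.mk ω Γ t c).toLinearMap).liftQ (smashForm (kappaForm ω Γ c t) b)
      (fun _ hu ↦ smashForm_eq_zero_of_H_mk c b hω hΓ t hu) ∘ₗ
      ((H.mk ω Γ t c).toLinearMap.quotKerEquivOfSurjective (H.mk_surjective c t)).symm.toLinearMap

theorem H.form_mk (hω : ω.IsAlt) (hΓ : ∀ g ∈ Γ, ∀ x y, ω (g x) (g y) = ω x y) (t : ℂ)
    (u : Smash Γ) : H.form c b hω hΓ t (H.mk ω Γ t c u) =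
      smashForm (kappaForm ω Γ c t) b u := by
  have : ((H.mk ω Γ t c).toLinearMap.quotKerEquivOfSurjective
      (H.mk_surjective c t)).symm (H.mk ω Γ t c u) = Submodule.Quotient.mk u := by
    rw [LinearEquiv.symm_apply_eq]
    rfl
  rw [H.form, LinearMap.comp_apply, LinearEquiv.coe_coe, this]
  exact Submodule.liftQ_apply _ _ _

/-- The PBW theorem for symplectic reflection algebras. -/
def H.pbw [DecidableEq Γ] (hω : ω.IsAlt) (hΓ : ∀ g ∈ Γ, ∀ x y, ω (g x) (g y) = ω x y) (t : ℂ) :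
    PBWAlgebra ℂ ι Γ (H ω Γ t c) :=
  (prePBWAlgebra c b t hω hΓ (H.mk ω Γ t c : Smash Γ →+* H ω Γ t c) (map_smul (H.mk ω Γ t c))
    (H.mk_comm c t)
    (by
      rw [RingHom.coe_coe, (H.mk_surjective c t).range_eq, Submodule.span_univ])
    (H.form c b hω hΓ t) (H.form_mk c b hω hΓ t)).toPBWAlgebra

end H

section Family

theorem commute_map_algebraMap {R : Type*} [Ring R] [Algebra ℂ R] (r : Polynomial ℂ)
    (p : Polynomial R) : r.map (algebraMap ℂ R) * p = p * r.map (algebraMap ℂ R) := by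
  induction r using Polynomial.induction_on' with
  | add r s hr hs => rw [Polynomial.map_add, add_mul, mul_add, hr, hs]
  | monomial n a =>
  induction p using Polynomial.induction_on' with
  | add r s hr hs => rw [add_mul, mul_add, hr, hs]
  | monomial m u =>
    rw [Polynomial.map_monomial, Polynomial.monomial_mul_monomial,
      Polynomial.monomial_mul_monomial, Algebra.commutes, add_comm]

instance instAlgebraFamily : Algebra (Polynomial ℂ) (Family ω Γ c) :=
  RingHom.toAlgebra' ((Family.mk ω Γ c).comp (Polynomial.mapRingHom (algebraMap ℂ (Smash Γ))))
    fun r a ↦ by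
      obtain ⟨p, rfl⟩ := Family.mk_surjective ω Γ c a
      rw [RingHom.comp_apply, ← map_mul, ← map_mul]
      exact congrArg _ (commute_map_algebraMap r p)

variable {c}

theorem Family.smul_mk (r : Polynomial ℂ) (p : Polynomial (Smash Γ)) :
    r • Family.mk ω Γ c p = Family.mk ω Γ c (r.map (algebraMap ℂ (Smash Γ)) * p) := by
  rw [Algebra.smul_def, map_mul]
  rfl

variable (ω c) in
theorem Family.algebraMap_X : algebraMap (Polynomial ℂ) (Family ω Γ c) Polynomial.X =
    param ω Γ c := by
  refine (congrArg (Family.mk ω Γ c) ?_)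
  simp

theorem Family.X_smul (a : Family ω Γ c) : (Polynomial.X : Polynomial ℂ) • a = param ω Γ c * a := by
  rw [Algebra.smul_def, Family.algebraMap_X]

variable {ι : Type*} [LinearOrder ι] [Fintype ι] {b : Module.Basis ι ℂ V}

variable (ω c b) in
/-- The normal form functional on polynomials over the smash product. -/
def familyForm : Polynomial (Smash Γ) →+ (Γ → MvPolynomial ι (Polynomial ℂ)) where
  toFun p := p.sum fun n a ↦ (Polynomial.X : Polynomial ℂ) ^ n •
    smashForm (kappaForm ω Γ c (Polynomial.X : Polynomial ℂ)) b a
  map_zero' := Polynomial.sum_zero_index _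
  map_add' p q := Polynomial.sum_add_index _ _ _ (fun _ ↦ by simp) fun _ _ _ ↦ by
    rw [map_add, smul_add]

theorem familyForm_monomial (n : ℕ) (u : Smash Γ) : familyForm ω c b (Polynomial.monomial n u) =
    (Polynomial.X : Polynomial ℂ) ^ n •
      smashForm (kappaForm ω Γ c (Polynomial.X : Polynomial ℂ)) b u :=
  Polynomial.sum_monomial_index u (fun n a ↦ (Polynomial.X : Polynomial ℂ) ^ n •
    smashForm (kappaForm ω Γ c (Polynomial.X : Polynomial ℂ)) b a) (by simp)

theorem familyForm_map_mul (r : Polynomial ℂ) (p : Polynomial (Smash Γ)) :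
    familyForm ω c b (r.map (algebraMap ℂ (Smash Γ)) * p) = r • familyForm ω c b p := by
  induction r using Polynomial.induction_on' with
  | add r s hr hs => rw [Polynomial.map_add, add_mul, map_add, hr, hs, add_smul]
  | monomial n a =>
  induction p using Polynomial.induction_on' with
  | add r s hr hs => rw [mul_add, map_add, map_add, hr, hs, smul_add]
  | monomial m u =>
    rw [Polynomial.map_monomial, Polynomial.monomial_mul_monomial, familyForm_monomial,
      familyForm_monomial, ← Algebra.smul_def, map_smul, smul_smul,
      ← algebraMap_smul (Polynomial ℂ) a, smul_smul, ← Polynomial.C_mul_X_pow_eq_monomial,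
      Polynomial.algebraMap_eq, pow_add]
    congr 1
    ring

theorem familyForm_eq_zero (hω : ω.IsAlt) (hΓ : ∀ g ∈ Γ, ∀ x y, ω (g x) (g y) = ω x y)
    {p : Polynomial (Smash Γ)} (hp : Family.mk ω Γ c p = 0) : familyForm ω c b p = 0 := by
  refine RingQuot.apply_eq_zero (r := FamilyRel ω Γ c) (familyForm ω c b) ?_ hp
  rintro _ _ ⟨x, y⟩ p q
  induction p using Polynomial.induction_on' with
  | add r s hr hs => simp only [add_mul, map_add] at hr hs ⊢; rw [hr, hs]
  | monomial m u =>
  induction q using Polynomial.induction_on' with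
  | add r s hr hs => rw [mul_add, mul_add, map_add, map_add, hr, hs]
  | monomial n v =>
  have h1 : ω x y • (Polynomial.X : Polynomial (Smash Γ)) =
      Polynomial.monomial 1 (ω x y • (1 : Smash Γ)) := by
    rw [← Polynomial.smul_monomial]
    rfl
  rw [h1, Polynomial.monomial_mul_C, Polynomial.monomial_mul_monomial, mul_add, add_mul,
    Polynomial.monomial_mul_C, Polynomial.monomial_mul_monomial, Polynomial.monomial_mul_monomial,
    Polynomial.monomial_mul_monomial, map_add, familyForm_monomial, familyForm_monomial,
    familyForm_monomial, mul_smashForm hω hΓ, mul_smul_comm, mul_one, smul_mul_assoc, map_smul,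
    smul_add, smul_smul, ← algebraMap_smul (Polynomial ℂ) (ω x y) (Polynomial.X : Polynomial ℂ),
    ← algebraMap_smul (Polynomial ℂ) (ω x y)
      (smashForm (kappaForm ω Γ c (Polynomial.X : Polynomial ℂ)) b (u * v)), smul_smul, smul_eq_mul]
  congr 2
  ring

theorem Family.span_range :
    Submodule.span (Polynomial ℂ) (Set.range ((Family.mk ω Γ c).comp Polynomial.C)) = ⊤ := by
  refine top_le_iff.1 fun a _ ↦ ?_
  obtain ⟨p, rfl⟩ := Family.mk_surjective ω Γ c a
  induction p using Polynomial.induction_on' with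
  | add r s hr hs => rw [map_add]; exact add_mem (hr trivial) (hs trivial)
  | monomial n u =>
    have : Family.mk ω Γ c (Polynomial.monomial n u) =
        (Polynomial.X : Polynomial ℂ) ^ n • Family.mk ω Γ c (Polynomial.C u) := by
      rw [Family.smul_mk]
      simp [← Polynomial.C_mul_X_pow_eq_monomial, Polynomial.X_pow_mul_C]
    rw [this]
    exact Submodule.smul_mem _ _ (Submodule.subset_span ⟨u, rfl⟩)

variable (b c) in
/-- The PBW theorem for the family of symplectic reflection algebras. -/
def Family.pbw [DecidableEq Γ] (hω : ω.IsAlt) (hΓ : ∀ g ∈ Γ, ∀ x y, ω (g x) (g y) = ω x y) :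
    PBWAlgebra (Polynomial ℂ) ι Γ (Family ω Γ c) :=
  -- The functional descends first as an additive map; linearity over `ℂ[t]` is checked afterwards
  -- on representatives.
  let L : Family ω Γ c →+ (Γ → MvPolynomial ι (Polynomial ℂ)) :=
    (Family.mk ω Γ c).toAddMonoidHom.liftOfSurjective (Family.mk_surjective ω Γ c)
      ⟨familyForm ω c b, fun _ hp ↦ familyForm_eq_zero hω hΓ hp⟩
  have hL (p : Polynomial (Smash Γ)) : L (Family.mk ω Γ c p) = familyForm ω c b p :=
    AddMonoidHom.liftOfRightInverse_comp_apply _ _ _ _ p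
  (prePBWAlgebra c b Polynomial.X hω hΓ ((Family.mk ω Γ c).comp Polynomial.C)
    (fun r u ↦ by
      rw [RingHom.comp_apply, RingHom.comp_apply, Family.smul_mk, Algebra.smul_def]
      simp)
    (fun x y ↦ by
      have h : Family.mk ω Γ c _ = Family.mk ω Γ c _ :=
        RingQuot.mkRingHom_rel (FamilyRel.comm (ω := ω) (Γ := Γ) (c := c) x y)
      rw [RingHom.comp_apply, h, map_add]
      congr 1
      rw [← map_one (Family.mk ω Γ c), Family.smul_mk, mul_one]
      congr 1
      rw [← algebraMap_smul (Polynomial ℂ) (ω x y) (Polynomial.X : Polynomial ℂ)]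
      simp [Algebra.smul_def])
    Family.span_range
    { toFun := L
      map_add' := map_add L
      map_smul' := fun r a ↦ by
        obtain ⟨p, rfl⟩ := Family.mk_surjective ω Γ c a
        rw [Family.smul_mk, hL, hL, familyForm_map_mul]
        rfl }
    (fun u ↦ by
      change L (Family.mk ω Γ c (Polynomial.C u)) = _
      rw [hL, ← Polynomial.monomial_zero_left, familyForm_monomial, pow_zero, one_smul])).toPBWAlgebra

end Family

end SympRefl

end

noncomputable section

/-! ### Invariants of finite groups acting without reflections -/

namespace InvariantTheory

variable {k P Γ : Type*} [CommRing k] [CommRing P] [Algebra k P] [Group Γ]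

/-- Invariant elements. -/
def IsInv (act : Γ →* (P →ₐ[k] P)) (p : P) : Prop := ∀ g, act g p = p

section

variable {act : Γ →* (P →ₐ[k] P)} {p q : P}

theorem IsInv.mul (hp : IsInv act p) (hq : IsInv act q) : IsInv act (p * q) := fun g ↦ by
  rw [map_mul, hp g, hq g]

theorem IsInv.smul (hp : IsInv act p) (r : k) : IsInv act (r • p) := fun g ↦ by
  rw [map_smul, hp g]

theorem act_act (g h : Γ) (p : P) : act g (act h p) = act (g * h) p := by rw [map_mul]; rfl

theorem act_one (p : P) : act 1 p = p := by rw [map_one]; rfl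

variable [Fintype Γ]

theorem isInv_sum (p : P) : IsInv act (∑ h, act h p) := fun g ↦ by
  rw [map_sum]
  simp only [act_act]
  exact Fintype.sum_equiv (Equiv.mulLeft g) _ _ fun _ ↦ rfl

theorem isInv_prod (p : P) : IsInv act (∏ h, act h p) := fun g ↦ by
  rw [map_prod]
  simp only [act_act]
  exact Fintype.prod_equiv (Equiv.mulLeft g) _ _ fun _ ↦ rfl

end

variable [Fintype Γ] [DecidableEq Γ] (act : Γ →* (P →ₐ[k] P))

/-- `Δ` is a common denominator of the matrix coefficients of the elements of the group, with
respect to dual systems of elements of `P`. -/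
structure IsDualSystem (Δ : P) {n : ℕ} (u v : Fin n → P) : Prop where
  ne_zero : Δ ≠ 0
  inv : IsInv act Δ
  sum_eq : ∀ h, ∑ j, act h (v j) * u j = if h = 1 then Δ else 0

/-- The action is faithful and has dual systems with coprime denominators. -/
structure IsGenericAction : Prop where
  injective : Function.Injective act
  exists_dual : ∃ (Δ Δ' : P) (n n' : ℕ) (u v : Fin n → P) (u' v' : Fin n' → P),
    IsRelPrime Δ Δ' ∧ IsDualSystem act Δ u v ∧ IsDualSystem act Δ' u' v'

variable {act}

/-- Exchanging the sums, the duality relation leaves only the unit of the group. Up to the factor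
`Δ`, the `u j` and `v j` behave like dual bases for the trace form over the invariants. -/
theorem IsDualSystem.mul_eq {Δ : P} {n : ℕ} {u v : Fin n → P} (h : IsDualSystem act Δ u v) (p : P) :
    Δ * p = ∑ j, (∑ g, act g (p * v j)) * u j := by
  simp only [Finset.sum_mul, map_mul]
  rw [Finset.sum_comm]
  simp only [mul_assoc, ← Finset.mul_sum, h.sum_eq]
  simp [mul_comm]

/-- A linear map over the invariants is, up to a denominator, a combination of group elements. -/
theorem IsDualSystem.mul_apply {Δ : P} {n : ℕ} {u v : Fin n → P} (h : IsDualSystem act Δ u v)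
    {F : P →ₗ[k] P} (hF : ∀ f p, IsInv act f → F (f * p) = f * F p) (p : P) :
    Δ * F p = ∑ g, (∑ j, act g (v j) * F (u j)) * act g p := by
  have h1 (j : Fin n) : F ((∑ g, act g (p * v j)) * u j) = (∑ g, act g (p * v j)) * F (u j) :=
    hF _ _ (isInv_sum _)
  rw [← hF _ _ h.inv, h.mul_eq, map_sum]
  simp only [h1]
  simp only [Finset.sum_mul, map_mul]
  rw [Finset.sum_comm]
  refine Finset.sum_congr rfl fun g _ ↦ Finset.sum_congr rfl fun j _ ↦ ?_
  ring

variable [IsDomain P]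

/-- This is Dedekind's independence of characters for the distinct automorphisms `act g`. -/
theorem IsGenericAction.ext (h : IsGenericAction act) {a b : Γ → P}
    (hab : ∀ p, ∑ g, a g * act g p = ∑ g, b g * act g p) : a = b := by
  have hli := (linearIndependent_monoidHom P P).comp
    (fun g : Γ ↦ ((act g : P →+* P) : P →* P)) (fun g g' hg ↦ h.injective (AlgHom.ext fun p ↦
      DFunLike.congr_fun hg p))
  rw [Fintype.linearIndependent_iff] at hli
  funext g
  rw [← sub_eq_zero]
  refine hli (a - b) ?_ g
  funext p
  have := hab p
  rw [← sub_eq_zero, ← Finset.sum_sub_distrib] at this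
  rw [Finset.sum_apply, Pi.zero_apply, ← this]
  refine Finset.sum_congr rfl fun g _ ↦ ?_
  rw [← sub_mul]
  rfl

/-- Endomorphisms over the invariants are combinations of group elements. -/
theorem IsGenericAction.exists_eq_sum [DecompositionMonoid P] (h : IsGenericAction act)
    {F : P →ₗ[k] P} (hF : ∀ f p, IsInv act f → F (f * p) = f * F p) :
    ∃ a : Γ → P, ∀ p, F p = ∑ g, a g * act g p := by
  obtain ⟨Δ, Δ', n, n', u, v, u', v', hrel, hd, hd'⟩ := h.exists_dual
  -- Both dual systems compute `Δ * Δ' * F p`. Comparing coefficients, coprimality allows the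
  -- denominator `Δ` to be divided out.
  have h1 := h.ext (a := fun g ↦ Δ' * ∑ j, act g (v j) * F (u j))
    (b := fun g ↦ Δ * ∑ j, act g (v' j) * F (u' j)) fun p ↦ by
      simp only [mul_assoc, ← Finset.mul_sum]
      rw [← hd.mul_apply hF, ← hd'.mul_apply hF]
      ring
  have h2 (g : Γ) : Δ ∣ ∑ j, act g (v j) * F (u j) :=
    hrel.dvd_of_dvd_mul_left ⟨_, congrFun h1 g⟩
  choose a ha using h2
  refine ⟨a, fun p ↦ mul_left_cancel₀ hd.ne_zero ?_⟩
  rw [hd.mul_apply hF, Finset.mul_sum]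
  simp only [ha, mul_assoc]

/-- A derivation vanishing on the invariants is zero. -/
theorem IsGenericAction.derivation_eq_zero (h : IsGenericAction act) {E : Derivation k P P}
    (hE : ∀ f, IsInv act f → E f = 0) : E = 0 := by
  obtain ⟨Δ, -, n, -, u, v, -, -, -, hd, -⟩ := h.exists_dual
  have hF (p : P) : Δ * E p = ∑ g, (∑ j, act g (v j) * E (u j)) * act g p :=
    hd.mul_apply (F := E) (fun f p hf ↦ by
      rw [Derivation.coeFn_coe, Derivation.leibniz, hE f hf, smul_zero, add_zero, smul_eq_mul]) p
  set a : Γ → P := fun g ↦ ∑ j, act g (v j) * E (u j)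
  ext p
  -- Two expansions of `Δ * E (p * q)` as combinations of group elements applied to `q` are
  -- compared; at the unit of the group this gives `a 1 * p = p * a 1 + Δ * E p`.
  have h1 := h.ext (a := fun g ↦ a g * act g p) (b := fun g ↦ p * a g + if g = 1 then Δ * E p else 0)
    fun q ↦ by
      have h2 := hF (p * q)
      rw [Derivation.leibniz, smul_eq_mul, smul_eq_mul, mul_add, mul_left_comm, hF q] at h2
      simp only [add_mul, Finset.sum_add_distrib, ite_mul, zero_mul, mul_assoc, ← Finset.mul_sum,
        Finset.sum_ite_eq', Finset.mem_univ, if_true, act_one]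
      simp only [map_mul] at h2
      rw [← h2]
      ring
  have h2 := congrFun h1 1
  simp only [act_one, if_true] at h2
  rw [mul_comm, left_eq_add] at h2
  exact (mul_eq_zero.1 h2).resolve_left hd.ne_zero

theorem IsGenericAction.derivation_ext (h : IsGenericAction act) {E E' : Derivation k P P}
    (hE : ∀ f, IsInv act f → E f = E' f) : E = E' :=
  sub_eq_zero.1 <| h.derivation_eq_zero fun f hf ↦ by rw [Derivation.sub_apply, hE f hf, sub_self]

/-- Derivations of the invariants extend, up to a denominator. -/
theorem IsGenericAction.exists_derivation_of_dual [DecompositionMonoid P] (h : IsGenericAction act)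
    {D : P →ₗ[k] P} (hD : ∀ f g, IsInv act f → IsInv act g → D (f * g) = f * D g + g * D f)
    {Δ : P} {n : ℕ} {u v : Fin n → P} (hd : IsDualSystem act Δ u v) :
    ∃ E : Derivation k P P, ∀ f, IsInv act f → E f = Δ * D f := by
  let tr (j : Fin n) : P →ₗ[k] P := ∑ g, (act g).toLinearMap ∘ₗ LinearMap.mulRight k (v j)
  have htr (j : Fin n) (p : P) : tr j p = ∑ g, act g (p * v j) := by simp [tr]
  -- `F` applies `D` to the invariant coefficients of `Δ * p` in the dual system, so it obeys a
  -- Leibniz rule for invariant factors, with `Δ * D` as the derivation part.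
  let F : P →ₗ[k] P := ∑ j, LinearMap.mulRight k (u j) ∘ₗ D ∘ₗ tr j
  have hF' (p : P) : F p = ∑ j, D (∑ g, act g (p * v j)) * u j := by
    simp only [F, LinearMap.sum_apply, LinearMap.comp_apply, LinearMap.mulRight_apply, htr]
  have hF (f p : P) (hf : IsInv act f) : F (f * p) = f * F p + Δ * p * D f := by
    have h1 (j : Fin n) : ∑ g, act g (f * p * v j) = f * ∑ g, act g (p * v j) := by
      rw [Finset.mul_sum]
      refine Finset.sum_congr rfl fun g _ ↦ ?_
      rw [mul_assoc, map_mul, hf g]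
    rw [hF', hd.mul_eq, hF', Finset.mul_sum, Finset.sum_mul, ← Finset.sum_add_distrib]
    refine Finset.sum_congr rfl fun j _ ↦ ?_
    rw [h1, hD _ _ hf (isInv_sum _)]
    ring
  -- The commutator of `F` with multiplication by `w` is linear over the invariants, hence a
  -- combination of group elements with coefficients `a w`. As a function of `w`, the coefficient at
  -- the unit is the required derivation.
  let G (w : P) : P →ₗ[k] P := F ∘ₗ LinearMap.mulLeft k w - LinearMap.mulLeft k w ∘ₗ F
  have hG (w p : P) : G w p = F (w * p) - w * F p := rfl
  have h1 (w : P) := h.exists_eq_sum (F := G w) fun f p hf ↦ by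
    rw [hG, hG, mul_left_comm, hF _ _ hf, hF _ _ hf]
    ring
  choose a ha using h1
  have hadd (w w' : P) : a (w + w') = a w + a w' := h.ext fun p ↦ by
    simp only [Pi.add_apply, add_mul, Finset.sum_add_distrib]
    rw [← ha, ← ha, ← ha, hG, hG, hG, add_mul, map_add]
    ring
  have hsmul (r : k) (w : P) : a (r • w) = r • a w := h.ext fun p ↦ by
    simp only [Pi.smul_apply, smul_mul_assoc, ← Finset.smul_sum]
    rw [← ha, ← ha, hG, hG, smul_mul_assoc, map_smul, smul_mul_assoc, smul_sub]
  have hmul (w w' : P) : a (w * w') = fun g ↦ w * a w' g + a w g * act g w' := h.ext fun p ↦ by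
    simp only [add_mul, Finset.sum_add_distrib, mul_assoc, ← Finset.mul_sum, ← map_mul]
    rw [← ha, ← ha, ← ha, hG, hG, hG]
    ring_nf
  let E : Derivation k P P := Derivation.mk'
    { toFun := fun w ↦ a w 1
      map_add' := fun w w' ↦ by rw [hadd]; rfl
      map_smul' := fun r w ↦ by rw [hsmul]; rfl } fun w w' ↦ by
        change a (w * w') 1 = w * a w' 1 + w' * a w 1
        rw [hmul]
        simp only [act_one]
        ring
  refine ⟨E, fun f hf ↦ ?_⟩
  have h2 : a f = fun g ↦ if g = 1 then Δ * D f else 0 := h.ext fun p ↦ by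
    rw [← ha, hG, hF _ _ hf]
    simp only [ite_mul, zero_mul, Finset.sum_ite_eq', Finset.mem_univ, if_true, act_one]
    ring
  change a f 1 = _
  rw [h2]
  simp

/-- Derivations of the invariants extend. -/
theorem IsGenericAction.exists_derivation [DecompositionMonoid P] (h : IsGenericAction act)
    {D : P →ₗ[k] P} (hD : ∀ f g, IsInv act f → IsInv act g → D (f * g) = f * D g + g * D f) :
    ∃ E : Derivation k P P, ∀ f, IsInv act f → E f = D f := by
  obtain ⟨Δ, Δ', n, n', u, v, u', v', hrel, hd, hd'⟩ := h.exists_dual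
  obtain ⟨E, hE⟩ := h.exists_derivation_of_dual hD hd
  obtain ⟨E', hE'⟩ := h.exists_derivation_of_dual hD hd'
  -- Both are derivations of `P` extending `Δ * Δ' * D`, and such an extension is unique;
  -- coprimality then removes the denominator.
  have h1 : Δ' • E = Δ • E' := h.derivation_ext fun f hf ↦ by
    rw [Derivation.smul_apply, Derivation.smul_apply, hE f hf, hE' f hf, smul_eq_mul, smul_eq_mul]
    ring
  have h2 (p : P) : Δ ∣ E p :=
    hrel.dvd_of_dvd_mul_left ⟨_, DFunLike.congr_fun h1 p⟩
  choose e he using h2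
  refine ⟨Derivation.mk'
    { toFun := e
      map_add' := fun p q ↦ mul_left_cancel₀ hd.ne_zero ?_
      map_smul' := fun r p ↦ mul_left_cancel₀ hd.ne_zero ?_ } fun p q ↦
        mul_left_cancel₀ hd.ne_zero ?_, fun f hf ↦ mul_left_cancel₀ hd.ne_zero ?_⟩
  · rw [mul_add, ← he, ← he, ← he, map_add]
  · rw [RingHom.id_apply, mul_smul_comm, ← he, ← he, E.map_smul]
  · change Δ * e (p * q) = Δ * (p * e q + q * e p)
    rw [mul_add, mul_left_comm, mul_left_comm Δ q, ← he, ← he, ← he, Derivation.leibniz]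
    rfl
  · change Δ * e f = Δ * D f
    rw [← he, hE f hf]

/-- The dual systems given by an element with trivial stabiliser. -/
theorem exists_isDualSystem {x : P} (hx : ∀ g : Γ, g ≠ 1 → x ≠ act g x) :
    ∃ (n : ℕ) (u v : Fin n → P),
    IsDualSystem act (∏ h, act h (∏ g ∈ Finset.univ.erase (1 : Γ), (x - act g x))) u v := by
  set δ : P := ∏ g ∈ Finset.univ.erase (1 : Γ), (x - act g x)
  let T : Polynomial P := ∏ g ∈ Finset.univ.erase (1 : Γ), (Polynomial.X - Polynomial.C (act g x))
  have hinj (h : Γ) : Function.Injective (act h) := by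
    refine Function.LeftInverse.injective (g := act h⁻¹) fun p ↦ ?_
    rw [act_act, inv_mul_cancel, act_one]
  -- Pairing the coefficients of `act h T` with powers of `x` evaluates it at `x`: the result is `δ`
  -- for `h = 1` and zero otherwise. The extra product in `v j` completes `δ` to its norm, which is
  -- invariant.
  refine ⟨T.natDegree + 1, fun j ↦ x ^ (j : ℕ),
    fun j ↦ T.coeff j * ∏ h ∈ Finset.univ.erase (1 : Γ), act h δ, ?_, isInv_prod _, fun h ↦ ?_⟩
  · refine Finset.prod_ne_zero_iff.2 fun h _ ↦ (map_ne_zero_iff _ (hinj h)).2 ?_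
    exact Finset.prod_ne_zero_iff.2 fun g hg ↦
      sub_ne_zero.2 (hx g (Finset.ne_of_mem_erase hg))
  · have h1 : ∑ j : Fin (T.natDegree + 1), act h (T.coeff j) * x ^ (j : ℕ) =
        (T.map (act h : P →+* P)).eval x := by
      rw [Polynomial.eval_eq_sum_range' (n := T.natDegree + 1)
        (Nat.lt_succ_of_le Polynomial.natDegree_map_le), Finset.sum_range]
      simp
    simp only [map_mul, mul_right_comm _ _ (x ^ _), ← Finset.sum_mul, h1]
    split_ifs with hh
    · subst hh
      rw [act_one, ← Finset.mul_prod_erase Finset.univ (fun h ↦ act h δ) (Finset.mem_univ 1),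
        act_one, Polynomial.map_prod, Polynomial.eval_prod]
      simp [δ]
    -- The factor of `T` with index `h⁻¹` is carried by `h` to `X - x`, which vanishes at `x`.
    · rw [Polynomial.map_prod, Polynomial.eval_prod, Finset.prod_eq_zero (i := h⁻¹), zero_mul]
      · simp [hh]
      · simp [act_act]

end InvariantTheory

end

/-! ### Finite symplectic groups act generically -/

noncomputable section

namespace SympRefl

open MvPolynomial InvariantTheory

variable {V : Type*} [AddCommGroup V] [Module ℂ V]

theorem exists_forall_notMem {I : Type*} [Finite I] {S : I → Submodule ℂ V} (hS : ∀ i, S i ≠ ⊤) :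
    ∃ x, ∀ i, x ∉ S i := by
  classical
  cases nonempty_fintype I
  by_contra! h
  refine Subspace.biUnion_ne_univ_of_top_notMem (s := Finset.univ.image S) ?_
    (Set.eq_univ_of_forall fun x ↦ ?_)
  · simpa using hS
  · simpa using h x

/-- A symplectic automorphism of finite order is not a reflection. -/
theorem exists_sub_notMem_span {ω : LinearMap.BilinForm ℂ V} (hω : ω.IsAlt)
    (hnd : ω.Nondegenerate) {g : V ≃ₗ[ℂ] V} (hg : IsOfFinOrder g)
    (hgω : ∀ x y, ω (g x) (g y) = ω x y) (hne : g ≠ 1) (w : V) :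
    ∃ x, x - g x ∉ Submodule.span ℂ {w} := by
  by_contra! h
  apply hne
  have hp (x : V) : movedProj g x ∈ Submodule.span ℂ {w} := by
    obtain ⟨y, hy⟩ := movedProj_mem_range hg x
    rw [← hy]
    exact h y
  ext x
  -- If `Im (Id - g)` lies in a line, the alternating form `ω_g` is zero, so its radical `Ker (Id -
  -- g)` is everything.
  have hx := (formRefl_radical hnd hg hgω x).1 fun y ↦ by
    obtain ⟨r, hr⟩ := Submodule.mem_span_singleton.1 (hp x)
    obtain ⟨s, hs⟩ := Submodule.mem_span_singleton.1 (hp y)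
    rw [formRefl, LinearMap.compl₁₂_apply, ← hr, ← hs]
    simp [hω w]
  exact (sub_eq_zero.1 hx).symm

variable {ι : Type*} [Fintype ι] (b : Module.Basis ι ℂ V)

/-- By degrees, a nonunit divisor of a linear form is proportional to it, so a common one would make
`v` and `w` proportional. -/
theorem isRelPrime_linPoly {v w : V} (hv : v ≠ 0) (hw : w ∉ Submodule.span ℂ {v}) :
    IsRelPrime (linPoly ℂ b v) (linPoly ℂ b w) := by
  have hw0 : w ≠ 0 := fun h ↦ hw (h ▸ zero_mem _)
  have hdeg {x : V} (hx : x ≠ 0) : (linPoly ℂ b x).totalDegree = 1 := by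
    refine IsHomogeneous.totalDegree ?_ ((map_ne_zero_iff _ (linPoly_injective b)).2 hx)
    rw [linPoly_eq]
    refine (homogeneousSubmodule ι ℂ 1).sum_mem fun i _ ↦ Submodule.smul_mem _ _ ?_
    exact isHomogeneous_X ℂ i
  have key {x : V} (hx : x ≠ 0) {d : MvPolynomial ι ℂ} (hd : d ∣ linPoly ℂ b x)
      (hu : ¬ IsUnit d) : ∃ r : ℂ, linPoly ℂ b x = r • d := by
    obtain ⟨a, ha⟩ := hd
    have h0 : d * a ≠ 0 := ha ▸ (map_ne_zero_iff _ (linPoly_injective b)).2 hx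
    have h1 := hdeg hx
    rw [ha, totalDegree_mul_of_isDomain (left_ne_zero_of_mul h0) (right_ne_zero_of_mul h0)] at h1
    have h2 : d.totalDegree ≠ 0 := fun h ↦ hu <| by
      rw [totalDegree_eq_zero_iff_eq_C] at h
      have h3 : coeff 0 d ≠ 0 := fun h0' ↦ left_ne_zero_of_mul h0 (by rw [h, h0', C_0])
      rw [h]
      exact (isUnit_iff_ne_zero.2 h3).map C
    have h3 : a.totalDegree = 0 := by omega
    rw [totalDegree_eq_zero_iff_eq_C] at h3
    exact ⟨coeff 0 a, by rw [ha, smul_eq_C_mul, ← h3, mul_comm]⟩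
  intro d hdv hdw
  by_contra hu
  obtain ⟨r, hr⟩ := key hv hdv hu
  obtain ⟨s, hs⟩ := key hw0 hdw hu
  have hr0 : r ≠ 0 := by
    rintro rfl
    rw [zero_smul] at hr
    exact (map_ne_zero_iff _ (linPoly_injective b)).2 hv hr
  refine hw (Submodule.mem_span_singleton.2 ⟨r⁻¹ * s, linPoly_injective (k := ℂ) b ?_⟩)
  rw [map_smul, hr, hs, smul_smul, mul_right_comm, inv_mul_cancel₀ hr0, one_mul]

/-- The denominators are products of the linear forms `h (x - g x)` and `h' (y - g' y)`. Since the
image of `Id - g'` is contained in no line, a general `y` makes no form of the second kind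
proportional to one of the first; this is where reflections would be an obstruction. -/
theorem isGenericAction {ω : LinearMap.BilinForm ℂ V} (hω : ω.IsAlt) (hnd : ω.Nondegenerate)
    {Γ : Subgroup (V ≃ₗ[ℂ] V)} [Fintype Γ] [DecidableEq Γ]
    (hΓ : ∀ g ∈ Γ, ∀ x y, ω (g x) (g y) = ω x y) :
    IsGenericAction ((polyAct ℂ b).comp Γ.subtype) where
  injective g g' h := by
    ext v
    refine linPoly_injective (k := ℂ) b ?_
    have := DFunLike.congr_fun h (linPoly ℂ b v)
    simpa only [MonoidHom.comp_apply, Subgroup.coe_subtype, polyAct_linPoly] using this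
  exists_dual := by
    have hmove (g : {g : Γ // g ≠ 1}) (w : V) :
        ∃ x, x - (g.1 : V ≃ₗ[ℂ] V) x ∉ Submodule.span ℂ {w} :=
      exists_sub_notMem_span hω hnd (Submonoid.isOfFinOrder_coe.2 (isOfFinOrder_of_finite g.1))
        (hΓ _ g.1.2) (fun h ↦ g.2 (Subtype.ext h)) w
    have hact (g : Γ) (v : V) : ((polyAct ℂ b).comp Γ.subtype) g (linPoly ℂ b v) =
        linPoly ℂ b ((g : V ≃ₗ[ℂ] V) v) := polyAct_linPoly b _ v
    let S (w : V) (p : Γ × {g : Γ // g ≠ 1}) : Submodule ℂ V := (Submodule.span ℂ {w}).comap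
      (((p.1 : V ≃ₗ[ℂ] V) : V →ₗ[ℂ] V) ∘ₗ
        (LinearMap.id - ((p.2.1 : V ≃ₗ[ℂ] V) : V →ₗ[ℂ] V)))
    have hS (w : V) (p : Γ × {g : Γ // g ≠ 1}) : S w p ≠ ⊤ := by
      obtain ⟨x, hx⟩ := hmove p.2 ((p.1 : V ≃ₗ[ℂ] V).symm w)
      intro h
      have h1 : x ∈ S w p := by rw [h]; trivial
      obtain ⟨r, hr⟩ := Submodule.mem_span_singleton.1 (Submodule.mem_comap.1 h1)
      refine hx (Submodule.mem_span_singleton.2 ⟨r, (p.1 : V ≃ₗ[ℂ] V).injective ?_⟩)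
      rw [map_smul, LinearEquiv.apply_symm_apply, hr]
      rfl
    -- For `w = 0` the avoided subspaces are the fixed spaces of the nontrivial elements, so `x` has
    -- trivial stabiliser.
    obtain ⟨x, hx⟩ := exists_forall_notMem fun p ↦ hS 0 p
    obtain ⟨y, hy⟩ := exists_forall_notMem
      fun q : (Γ × {g : Γ // g ≠ 1}) × (Γ × {g : Γ // g ≠ 1}) ↦
        hS ((q.1.1 : V ≃ₗ[ℂ] V) (x - (q.1.2.1 : V ≃ₗ[ℂ] V) x)) q.2
    have hfix (z w : V) (p : {g : Γ // g ≠ 1}) (hz : z ∉ S w (1, p)) :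
        linPoly ℂ b z ≠ ((polyAct ℂ b).comp Γ.subtype) p.1 (linPoly ℂ b z) := fun h ↦ by
      rw [hact] at h
      refine hz ?_
      change z - (p.1 : V ≃ₗ[ℂ] V) z ∈ Submodule.span ℂ {w}
      rw [← linPoly_injective b h, sub_self]
      exact zero_mem _
    obtain ⟨n, u, v, h1⟩ := exists_isDualSystem (act := (polyAct ℂ b).comp Γ.subtype)
      (x := linPoly ℂ b x) fun g hg ↦ hfix x 0 ⟨g, hg⟩ (hx (1, ⟨g, hg⟩))
    obtain ⟨n', u', v', h2⟩ := exists_isDualSystem (act := (polyAct ℂ b).comp Γ.subtype)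
      (x := linPoly ℂ b y) fun g hg ↦ hfix y _ ⟨g, hg⟩ (hy ((1, ⟨g, hg⟩), (1, ⟨g, hg⟩)))
    refine ⟨_, _, n, n', u, v, u', v', ?_, h1, h2⟩
    refine IsRelPrime.prod_left fun h _ ↦ ?_
    rw [map_prod]
    refine IsRelPrime.prod_left fun g hg ↦ IsRelPrime.prod_right fun h' _ ↦ ?_
    rw [map_prod]
    refine IsRelPrime.prod_right fun g' hg' ↦ ?_
    have hg := Finset.ne_of_mem_erase hg
    have hg' := Finset.ne_of_mem_erase hg'
    simp only [hact, ← map_sub]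
    refine isRelPrime_linPoly b (fun h0 ↦ hx (h, ⟨g, hg⟩) ?_) (hy ((h, ⟨g, hg⟩), (h', ⟨g', hg'⟩)))
    exact Submodule.mem_comap.2 (by
      rw [Submodule.span_zero_singleton]
      exact (Submodule.mem_bot ℂ).2 h0)

end SympRefl

/-! ### Gluing graded maps, and derivations of polynomials -/

namespace MvPolynomial

variable {ι k : Type*} [CommRing k]

/-- Glue a family of linear maps, taking the `m`-th one in degree `m`. -/
def glue {M : Type*} [AddCommGroup M] [Module k M] (f : ℕ → MvPolynomial ι k →ₗ[k] M) :
    MvPolynomial ι k →ₗ[k] M :=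
  (basisMonomials ι k).constr k fun d ↦ f d.degree (monomial d 1)

theorem glue_apply {M : Type*} [AddCommGroup M] [Module k M] (f : ℕ → MvPolynomial ι k →ₗ[k] M)
    {m : ℕ} {p : MvPolynomial ι k} (hp : comp m p = p) : glue f p = f m p := by
  have h1 (d : ι →₀ ℕ) : glue f (monomial d 1) = f d.degree (monomial d 1) := by
    have := (basisMonomials ι k).constr_basis k (fun d ↦ f d.degree (monomial d 1)) d
    rwa [coe_basisMonomials] at this
  have h2 (d : ι →₀ ℕ) : monomial d (coeff d p) = coeff d p • (monomial d 1 : MvPolynomial ι k) := by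
    rw [smul_monomial, smul_eq_mul, mul_one]
  rw [p.as_sum, map_sum, map_sum]
  refine Finset.sum_congr rfl fun d hd ↦ ?_
  have hdeg : d.degree = m := by
    rw [mem_support_iff, ← hp, coeff_comp] at hd
    by_contra h
    exact hd (if_neg (by exact_mod_cast h))
  rw [h2, map_smul, map_smul, h1, hdeg]

theorem derivation_eq_sum [Fintype ι] (E : Derivation k (MvPolynomial ι k) (MvPolynomial ι k))
    (p : MvPolynomial ι k) : E p = ∑ i, pderiv i p * E (X i) := by
  classical
  have hsum (q : MvPolynomial ι k) :
      (∑ i, E (X i) • pderiv i : Derivation k _ _) q = ∑ i, E (X i) * pderiv i q := by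
    have := congrFun (map_sum (Derivation.coeFnAddMonoidHom (R := k) (A := MvPolynomial ι k)
      (M := MvPolynomial ι k)) (fun i ↦ E (X i) • pderiv i) Finset.univ) q
    rw [Finset.sum_apply] at this
    exact this
  have : E = ∑ i, E (X i) • pderiv i := by
    refine derivation_ext fun j ↦ ?_
    rw [hsum]
    simp [pderiv_X, Pi.single_apply]
  conv_lhs => rw [this]
  rw [hsum]
  simp only [mul_comm]

theorem pderiv_mem_degLE (i : ι) {m : ℤ} {p : MvPolynomial ι k} (hp : p ∈ degLE m) :
    pderiv i p ∈ degLE (m - 1) := by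
  rw [p.as_sum, map_sum]
  refine sum_mem fun d hd ↦ ?_
  have hdm := hp d (mem_support_iff.1 hd)
  rw [pderiv_monomial]
  intro d' hd'
  classical
  rw [coeff_monomial] at hd'
  split_ifs at hd' with h
  · have hdi : d i ≠ 0 := fun h0 ↦ hd' (by rw [h0]; simp)
    have h1 : d = d' + Finsupp.single i 1 := by
      rw [← h]
      exact (tsub_add_cancel_of_le (Finsupp.single_le_iff.2 (Nat.one_le_iff_ne_zero.2 hdi))).symm
    rw [h1, map_add, Finsupp.degree_single] at hdm
    push_cast at hdm
    omega
  · exact absurd rfl hd'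

theorem comp_pderiv (i : ι) {m : ℤ} {p : MvPolynomial ι k} (hp : comp m p = p) :
    comp (m - 1) (pderiv i p) = pderiv i p := by
  ext d
  rw [coeff_comp, ite_eq_left_iff]
  intro h
  rw [← hp]
  by_contra h0
  classical
  have h2 : coeff d (pderiv i (comp m p)) = coeff (d + Finsupp.single i 1) (comp m p) * (d i + 1) := by
    exact coeff_pderiv _ _
  rw [h2, coeff_comp] at h0
  split_ifs at h0 with h3
  · rw [map_add, Finsupp.degree_single] at h3
    push_cast at h3
    omega
  · simp at h0

theorem comp_mul_right {m n : ℤ} {p q : MvPolynomial ι k} (hq : comp n q = q) :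
    comp (m + n) (p * q) = comp m p * q := by
  obtain ⟨N, hN⟩ := exists_mem_degLE p
  have h1 (l : ℤ) : comp (m + n) (comp l p * q) = if l = m then comp l p * q else 0 := by
    rw [← comp_mul_of_comp_eq (comp_comp l p) hq]
    split_ifs with h
    · rw [h, comp_comp]
    · exact comp_comp_of_ne (by omega) _
  conv_lhs => rw [← sum_comp hN]
  rw [Finset.sum_mul, map_sum]
  simp only [h1]
  by_cases hm : ∃ l ∈ Finset.range (N + 1), (l : ℤ) = m
  · obtain ⟨l, hl, rfl⟩ := hm
    simp only [Nat.cast_inj]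
    rw [Finset.sum_ite_eq', if_pos hl]
  · push Not at hm
    rw [Finset.sum_eq_zero fun l hl ↦ if_neg (hm l hl)]
    have : comp m p = 0 := by
      rcases lt_or_ge m 0 with h | h
      · ext d
        rw [coeff_comp, if_neg (by omega), coeff_zero]
      · lift m to ℕ using h
        refine comp_eq_zero ?_ hN
        by_contra h
        exact hm m (Finset.mem_range.2 (by omega)) rfl
    rw [this, zero_mul]

end MvPolynomial

end

/-! ### Degrees of derivations and biderivations of invariants -/

noncomputable section

namespace InvariantTheory

open MvPolynomial

variable {k ι Γ : Type*} [Field k] [Group Γ]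
  {act : Γ →* (MvPolynomial ι k →ₐ[k] MvPolynomial ι k)}

theorem IsInv.comp (hgr : ∀ g n p, comp n (act g p) = act g (comp n p)) {p : MvPolynomial ι k}
    (hp : IsInv act p) (n : ℤ) : IsInv act (comp n p) := fun g ↦ by
  rw [← hgr, hp g]

/-- To prove an additive property for invariants, it suffices to consider homogeneous ones. -/
theorem IsInv.induction (hgr : ∀ g n p, MvPolynomial.comp n (act g p) =
      act g (MvPolynomial.comp n p)) {motive : MvPolynomial ι k → Prop} (h0 : motive 0)
    (hadd : ∀ p q, motive p → motive q → motive (p + q))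
    (hhom : ∀ (n : ℕ) p, IsInv act p → MvPolynomial.comp n p = p → motive p)
    {p : MvPolynomial ι k} (hp : IsInv act p) : motive p := by
  obtain ⟨N, hN⟩ := exists_mem_degLE p
  rw [← sum_comp hN]
  exact Finset.sum_induction _ motive (fun p q ↦ hadd p q) h0
    fun n _ ↦ hhom n _ (hp.comp hgr n) (comp_comp _ _)

variable [Fintype Γ] [DecidableEq Γ] [Fintype ι]

/-- If `E` raised the degree by more than `a`, its top homogeneous part would be a derivation
killing all invariants, hence zero. -/
theorem IsGenericAction.derivation_mem_degLE (h : IsGenericAction act)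
    (hgr : ∀ g n p, comp n (act g p) = act g (comp n p))
    {E : Derivation k (MvPolynomial ι k) (MvPolynomial ι k)} {a : ℤ}
    (hE : ∀ (m : ℕ) f, IsInv act f → comp m f = f → E f ∈ degLE (m + a)) (i : ι) :
    E (X i) ∈ degLE (1 + a) := by
  have step (N : ℤ) (hN : a < N) (hX : ∀ i, E (X i) ∈ degLE (1 + N)) (i : ι) :
      E (X i) ∈ degLE (1 + N - 1) := by
    refine mem_degLE_sub_one (hX i) ?_
    set E' : Derivation k (MvPolynomial ι k) (MvPolynomial ι k) :=
      mkDerivation k fun i ↦ comp (1 + N) (E (X i)) with hE'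
    have h1 : E' = 0 := h.derivation_eq_zero fun f hf ↦ by
      refine hf.induction hgr (motive := fun f ↦ E' f = 0) (map_zero _)
        (fun p q hp hq ↦ by rw [map_add, hp, hq, add_zero])
        fun m p hp hm ↦ ?_
      have h2 : E' p = comp (m + N) (E p) := by
        rw [derivation_eq_sum, derivation_eq_sum E p, map_sum]
        refine Finset.sum_congr rfl fun i _ ↦ ?_
        rw [hE', mkDerivation_X, show (m + N : ℤ) = (m - 1) + (1 + N) by ring,
          comp_mul (pderiv_mem_degLE i (mem_degLE_of_comp_eq hm)) (hX i), comp_pderiv i hm]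
      rw [h2]
      exact comp_eq_zero (by omega) (hE m p hp hm)
    have h2 := DFunLike.congr_fun h1 (X i)
    rwa [hE', mkDerivation_X, Derivation.zero_apply] at h2
  choose n hn using fun i ↦ exists_mem_degLE (E (X i))
  have key (N : ℕ) (hX : ∀ i, E (X i) ∈ degLE (1 + (a + N))) (i : ι) :
      E (X i) ∈ degLE (1 + a) := by
    induction N generalizing i with
    | zero => simpa using hX i
    | succ N ih =>
      refine ih (fun i ↦ ?_) i
      convert step (a + (N + 1 : ℕ)) (by omega) hX i using 2
      push_cast
      ring
  -- The starting bound dominates the degrees of all `E (X i)`; each step lowers it by one.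
  refine key ((Finset.univ.sup n : ℕ) - 1 - a).toNat (fun i ↦ degLE_mono ?_ (hn i)) i
  have := Finset.le_sup (f := n) (Finset.mem_univ i)
  omega

/-- A biderivation on invariants which lowers the degree by at least three is zero. -/
theorem IsGenericAction.biderivation_eq_zero [CharZero k] (h : IsGenericAction act)
    (hgr : ∀ g n p, comp n (act g p) = act g (comp n p))
    {Br : MvPolynomial ι k →ₗ[k] MvPolynomial ι k →ₗ[k] MvPolynomial ι k} {d : ℤ} (hd : 3 ≤ d)
    (h1 : ∀ f g q, IsInv act f → IsInv act g → IsInv act q →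
      Br (f * g) q = f * Br g q + g * Br f q)
    (h2 : ∀ q f g, IsInv act q → IsInv act f → IsInv act g →
      Br q (f * g) = f * Br q g + g * Br q f)
    (hdeg : ∀ (m n : ℕ) f q, IsInv act f → IsInv act q → comp m f = f → comp n q = q →
      Br f q ∈ degLE (m + n - d))
    {f q : MvPolynomial ι k} (hf : IsInv act f) (hq : IsInv act q) : Br f q = 0 := by
  have hc : (Fintype.card Γ : k) ≠ 0 := Nat.cast_ne_zero.mpr Fintype.card_ne_zero
  -- Averaging makes the second argument invariant while keeping linear dependence on an arbitrary
  -- polynomial.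
  let avg : MvPolynomial ι k →ₗ[k] MvPolynomial ι k :=
    (Fintype.card Γ : k)⁻¹ • ∑ g, (act g).toLinearMap
  have havg (p : MvPolynomial ι k) : avg p = (Fintype.card Γ : k)⁻¹ • ∑ g, act g p := by
    simp [avg]
  have havg_inv (p : MvPolynomial ι k) : IsInv act (avg p) := by
    rw [havg]
    exact (isInv_sum p).smul _
  have havg_eq {p : MvPolynomial ι k} (hp : IsInv act p) : avg p = p := by
    rw [havg, Finset.sum_congr rfl fun g _ ↦ hp g, Finset.sum_const, Finset.card_univ,
      ← Nat.cast_smul_eq_nsmul k, smul_smul, inv_mul_cancel₀ hc, one_smul]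
  have hE (q : MvPolynomial ι k) := h.exists_derivation (D := Br.flip (avg q))
    fun f g hf hg ↦ h1 f g _ hf hg (havg_inv q)
  choose E hE using hE
  have hE (q f : MvPolynomial ι k) (hf : IsInv act f) : E q f = Br f (avg q) := hE q f hf
  -- The bracket has been extended in its first variable; its coefficient at `X i` is a derivation
  -- of the invariants in the second variable, so it extends again.
  let D (i : ι) : MvPolynomial ι k →ₗ[k] MvPolynomial ι k :=
    { toFun := fun q ↦ E q (X i)
      map_add' := fun q q' ↦ by
        rw [← Derivation.add_apply]
        congr 1
        refine h.derivation_ext fun f hf ↦ ?_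
        rw [Derivation.add_apply, hE _ _ hf, hE _ _ hf, hE _ _ hf, map_add, map_add]
      map_smul' := fun r q ↦ by
        rw [RingHom.id_apply, ← Derivation.smul_apply]
        congr 1
        refine h.derivation_ext fun f hf ↦ ?_
        rw [Derivation.smul_apply, hE _ _ hf, hE _ _ hf, map_smul, map_smul] }
  have hD (i : ι) (q q' : MvPolynomial ι k) (hq : IsInv act q) (hq' : IsInv act q') :
      D i (q * q') = q * D i q' + q' * D i q := by
    have : E (q * q') = q • E q' + q' • E q := h.derivation_ext fun f hf ↦ by
      rw [Derivation.add_apply, Derivation.smul_apply, Derivation.smul_apply, hE _ _ hf,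
        hE _ _ hf, hE _ _ hf, havg_eq (hq.mul hq'), havg_eq hq, havg_eq hq', h2 _ _ _ hf hq hq']
      rfl
    exact DFunLike.congr_fun this (X i)
  have hE0 (i : ι) : E q (X i) = 0 := by
    obtain ⟨E', hE'⟩ := h.exists_derivation (hD i)
    -- Passing from an invariant of degree `m` to a letter replaces `m` by one. After both
    -- variables, the coefficients of the bivector have degree at most `2 - d`, which is negative.
    have h3 (j : ι) : E' (X j) ∈ degLE (1 + (1 - d)) :=
      h.derivation_mem_degLE hgr (fun n q hq hn ↦ by
        rw [hE' q hq]
        have := h.derivation_mem_degLE hgr (E := E q) (a := n - d) (fun m f hf hm ↦ by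
          rw [hE _ _ hf, havg_eq hq, ← add_sub_assoc]
          exact hdeg m n f q hf hq hm hn) i
        exact degLE_mono (by omega) this) j
    have h4 : E' = 0 := MvPolynomial.derivation_ext fun j ↦ by
      rw [eq_zero_of_mem_degLE (by omega) (h3 j), Derivation.zero_apply]
    exact (hE' q hq).symm.trans (by rw [h4, Derivation.zero_apply])
  rw [← havg_eq hq, ← hE q f hf, derivation_eq_sum]
  simp [hE0]

/-- A nonzero constant bivector pairs some invariants nontrivially. -/
theorem IsGenericAction.exists_pairing_ne_zero (h : IsGenericAction act)
    (hgr : ∀ g n p, comp n (act g p) = act g (comp n p)) {a : ι → ι → k} {i j : ι}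
    (hij : a i j ≠ 0) : ∃ (m n : ℕ) (f q : MvPolynomial ι k), IsInv act f ∧ IsInv act q ∧
      comp m f = f ∧ comp n q = q ∧ ∑ i, ∑ j, a i j • (pderiv i f * pderiv j q) ≠ 0 := by
  by_contra! h0
  apply hij
  let E (f : MvPolynomial ι k) : Derivation k (MvPolynomial ι k) (MvPolynomial ι k) :=
    mkDerivation k fun j ↦ ∑ i, a i j • pderiv i f
  have hE (f q : MvPolynomial ι k) :
      E f q = ∑ i, ∑ j, a i j • (pderiv i f * pderiv j q) := by
    rw [derivation_eq_sum, Finset.sum_comm]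
    simp only [E, mkDerivation_X, Finset.mul_sum, mul_smul_comm, mul_comm]
  have h1 (f : MvPolynomial ι k) (hf : IsInv act f) (j : ι) : ∑ i, a i j • pderiv i f = 0 := by
    have : E f = 0 := by
      refine h.derivation_eq_zero fun q hq ↦ ?_
      refine hq.induction hgr (motive := fun q ↦ E f q = 0) (map_zero _)
        (fun p q hp hq ↦ by rw [map_add, hp, hq, add_zero])
        fun n q hq hn ↦ ?_
      refine hf.induction hgr (motive := fun f ↦ E f q = 0) (by simp [hE]) (fun p p' hp hp' ↦ ?_)
        fun m f hf hm ↦ (hE f q).trans (h0 m n f q hf hq hm hn)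
      rw [hE] at hp hp' ⊢
      simp only [map_add, add_mul, smul_add, Finset.sum_add_distrib, hp, hp', add_zero]
    have h2 := DFunLike.congr_fun this (X j)
    rwa [Derivation.zero_apply, mkDerivation_X] at h2
  -- Vanishing in the second variable has freed the index `j`; now the constant vector field with
  -- coefficients `a i j` kills all invariants `f`.
  have h2 : mkDerivation k (fun i ↦ (C (a i j) : MvPolynomial ι k)) = 0 := by
    refine h.derivation_eq_zero fun f hf ↦ ?_
    rw [derivation_eq_sum, ← h1 f hf j]
    simp only [mkDerivation_X, smul_eq_C_mul, mul_comm]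
  have h3 := DFunLike.congr_fun h2 (X i)
  rw [Derivation.zero_apply, mkDerivation_X] at h3
  exact C_eq_zero.1 h3

end InvariantTheory

end

/-! ### Commutativity of the spherical subalgebra -/

noncomputable section

open MvPolynomial InvariantTheory

namespace PBWAlgebra

section

variable {k ι Γ B : Type*} [CommRing k] [Fintype ι] [Group Γ] [Fintype Γ] [DecidableEq Γ]
  [Ring B] [Algebra k B] (A : PBWAlgebra k ι Γ B)

theorem coord_γ (g : Γ) : A.coord (A.γ g) = Pi.single g 1 := by
  funext h
  rw [← sub_eq_zero]
  have := coord_mul_γ_sub_mem (one_mem_words (A := A)) g h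
  rw [one_mul] at this
  exact eq_zero_of_mem_degLE (by simp) this

theorem γ_mem_filt (g : Γ) : A.γ g ∈ A.filt 0 := fun h ↦ by
  rw [coord_γ, Pi.single_apply]
  split_ifs
  · exact mem_degLE_of_comp_eq comp_one
  · exact zero_mem _

theorem sym_mem_filt : A.sym ∈ A.filt 0 :=
  Submodule.smul_mem _ _ (sum_mem fun g _ ↦ A.γ_mem_filt g)

theorem coord_mul_sym (b : B) (g : Γ) : A.coord (b * A.sym) g = A.invCard • A.theta b := by
  rw [mul_sym, sym, mul_smul_comm, Finset.mul_sum, map_smul, map_sum]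
  simp only [coord_lift_mul_γ]
  rw [Pi.smul_apply, Finset.sum_apply, Finset.sum_pi_single]
  simp

/-- The filtration of the spherical subalgebra. -/
def sph (n : ℤ) : Submodule k B where
  carrier := {u | A.sym * u = u ∧ u * A.sym = u ∧ A.theta u ∈ degLE n}
  add_mem' ha hb := ⟨by rw [mul_add, ha.1, hb.1], by rw [add_mul, ha.2.1, hb.2.1],
    by rw [map_add]; exact add_mem ha.2.2 hb.2.2⟩
  zero_mem' := ⟨mul_zero _, zero_mul _, by rw [map_zero]; exact zero_mem _⟩
  smul_mem' r a ha := ⟨by rw [mul_smul_comm, ha.1], by rw [smul_mul_assoc, ha.2.1],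
    by rw [map_smul]; exact Submodule.smul_mem _ r ha.2.2⟩

variable {A}

theorem mem_filt_of_mem_sph {n : ℤ} {u : B} (hu : u ∈ A.sph n) : u ∈ A.filt n := fun g ↦ by
  rw [← hu.2.1, coord_mul_sym]
  exact Submodule.smul_mem _ _ hu.2.2

theorem eq_zero_of_mem_sph {n : ℤ} (hn : n < 0) {u : B} (hu : u ∈ A.sph n) : u = 0 :=
  A.eq_zero_of_mem_filt hn (mem_filt_of_mem_sph hu)

theorem sph_mono {m n : ℤ} (h : m ≤ n) : A.sph m ≤ A.sph n :=
  fun _ hu ↦ ⟨hu.1, hu.2.1, degLE_mono h hu.2.2⟩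

theorem mem_sph_sub_one {n : ℤ} {u : B} (hu : u ∈ A.sph n) (h : comp n (A.theta u) = 0) :
    u ∈ A.sph (n - 1) :=
  ⟨hu.1, hu.2.1, mem_degLE_sub_one hu.2.2 h⟩

theorem mul_mem_sph {m n : ℤ} {u v : B} (hu : u ∈ A.sph m) (hv : v ∈ A.sph n) :
    u * v ∈ A.sph (m + n) :=
  ⟨by rw [← mul_assoc, hu.1], by rw [mul_assoc, hv.2.1],
    A.theta_mul_mem (mem_filt_of_mem_sph hu) hv.2.2⟩

theorem γ_mul_of_sym_mul {u : B} (hu : A.sym * u = u) (g : Γ) : A.γ g * u = u := by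
  rw [← hu, ← mul_assoc, γ_mul_sym]

/-- Left multiplication by `γ g` fixes `u`, and on leading terms it is the action of `g`. -/
theorem isInv_comp_theta {n : ℤ} {u : B} (hu : u ∈ A.sph n) :
    IsInv A.act (comp n (A.theta u)) := fun g ↦ by
  have h := A.comp_theta_mul (A.γ_mem_filt g) hu.2.2
  rw [γ_mul_of_sym_mul hu.1, zero_add, Finset.sum_eq_single g] at h
  · rw [coord_γ, Pi.single_eq_same, comp_one, one_mul] at h
    exact h.symm
  · intro h _ hg
    rw [coord_γ, Pi.single_eq_of_ne hg, map_zero, zero_mul]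
  · simp

/-- Right multiplication by spherical elements has the expected symbol. -/
theorem comp_theta_mul_sph {m n : ℤ} {c u : B} (hc : A.theta c ∈ degLE m) (hu : u ∈ A.sph n) :
    comp (m + n) (A.theta (c * u)) = comp m (A.theta c) * comp n (A.theta u) := by
  have h1 : c * A.sym ∈ A.filt m := fun g ↦ by
    rw [coord_mul_sym]
    exact Submodule.smul_mem _ _ hc
  have h2 := A.comp_theta_mul h1 hu.2.2
  rw [mul_assoc, hu.1] at h2
  rw [h2]
  simp only [coord_mul_sym, isInv_comp_theta hu _, map_smul, smul_mul_assoc]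
  rw [← Finset.smul_sum, invCard_smul_sum]

variable (A) in
/-- The section sending a polynomial to a spherical element. -/
def sphLift : MvPolynomial ι k →ₗ[k] B :=
  LinearMap.mulLeft k A.sym ∘ₗ LinearMap.mulRight k A.sym ∘ₗ A.lift

theorem theta_lift_mul_sym (p : MvPolynomial ι k) : A.theta (A.lift p * A.sym) = p := by
  rw [theta_mul_sym, theta_lift]

theorem sphLift_mem {n : ℤ} {p : MvPolynomial ι k} (hp : p ∈ degLE n) : A.sphLift p ∈ A.sph n := by
  change A.sym * (A.lift p * A.sym) ∈ A.sph n
  refine ⟨by rw [← mul_assoc, sym_mul_sym], by rw [mul_assoc, mul_assoc, sym_mul_sym], ?_⟩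
  have := A.theta_mul_mem A.sym_mem_filt (c := A.lift p * A.sym) (n := n)
    (by rwa [theta_lift_mul_sym])
  rwa [zero_add] at this

theorem comp_theta_sphLift {n : ℤ} {p : MvPolynomial ι k} (hp : comp n p = p)
    (hinv : IsInv A.act p) : comp n (A.theta (A.sphLift p)) = p := by
  have h := A.comp_theta_mul A.sym_mem_filt (c := A.lift p * A.sym) (n := n)
    (by rw [theta_lift_mul_sym]; exact mem_degLE_of_comp_eq hp)
  rw [theta_lift_mul_sym, zero_add] at h
  refine h.trans ?_
  have h1 (g : Γ) : A.coord A.sym g = A.invCard • 1 := by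
    have h1 : A.theta 1 = 1 := by
      rw [theta_apply, ← map_one A.γ]
      simp only [coord_γ]
      simp
    have := A.coord_mul_sym 1 g
    rwa [one_mul, h1] at this
  simp only [h1, map_smul, comp_one, hp, hinv _, smul_mul_assoc, one_mul]
  rw [← Finset.smul_sum, invCard_smul_sum]

/-- An invariant symbol lifts to an element commuting with the group. -/
theorem exists_mem_words_of_inv {n : ℕ} {p : MvPolynomial ι k} (hp : comp n p = p)
    (hinv : IsInv A.act p) : ∃ b, (b, p) ∈ A.words n ∧ A.sym * b = b * A.sym := by
  obtain ⟨b, hb⟩ := exists_mem_words (A := A) hp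
  refine ⟨A.invCard • ∑ g, A.γ g * b * A.γ g⁻¹, ?_, ?_⟩
  · have h1 : A.invCard • ∑ g, (A.γ g * b * A.γ g⁻¹, A.act g p) ∈ A.words n :=
      Submodule.smul_mem _ _ (sum_mem fun g _ ↦ conj_mem_words g hb)
    convert h1 using 1
    ext1
    · simp [Prod.fst_sum]
    · simp only [Prod.smul_snd, Prod.snd_sum, hinv _, A.invCard_smul_sum]
  · rw [mul_smul_comm, smul_mul_assoc, Finset.mul_sum, Finset.sum_mul]
    congr 1
    have h1 (g : Γ) : A.sym * (A.γ g * b * A.γ g⁻¹) = A.sym * b * A.γ g⁻¹ := by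
      rw [← mul_assoc, ← mul_assoc, sym_mul_γ]
    have h2 (g : Γ) : A.γ g * b * A.γ g⁻¹ * A.sym = A.γ g * b * A.sym := by
      rw [mul_assoc, γ_mul_sym]
    simp only [h1, h2]
    rw [← Finset.mul_sum, ← Finset.sum_mul, ← Finset.sum_mul, sym, smul_mul_assoc, smul_mul_assoc,
      mul_smul_comm]
    congr 2
    exact Fintype.sum_equiv (Equiv.inv Γ) _ _ fun _ ↦ rfl

theorem mul_sym_mem_sph {n : ℕ} {b : B} {p : MvPolynomial ι k} (hb : (b, p) ∈ A.words n)
    (hs : A.sym * b = b * A.sym) :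
    b * A.sym ∈ A.sph n ∧ comp n (A.theta (b * A.sym)) = p := by
  have h1 : A.theta b - p ∈ degLE ((n : ℤ) - 1) := theta_sub_mem hb
  have h2 := comp_of_mem_words hb
  refine ⟨⟨by rw [← mul_assoc, hs, mul_assoc, sym_mul_sym], by rw [mul_assoc, sym_mul_sym], ?_⟩, ?_⟩
  · rw [theta_mul_sym, ← sub_add_cancel (A.theta b) p]
    exact add_mem (degLE_mono (by omega) h1) (mem_degLE_of_comp_eq h2)
  · rw [theta_mul_sym, ← sub_add_cancel (A.theta b) p, map_add, comp_eq_zero (by omega) h1, zero_add,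
      h2]

theorem exists_mem_sph {u : B} (h1 : A.sym * u = u) (h2 : u * A.sym = u) :
    ∃ n : ℕ, u ∈ A.sph n := by
  obtain ⟨n, hn⟩ := exists_mem_degLE (A.theta u)
  exact ⟨n, h1, h2, hn⟩

/-- Lift the leading symbols to elements commuting with the symmetriser. Their commutator has
leading term the bracket of the symbols under `form 1`, which is zero; the errors have lower degree
and are treated by induction. -/
theorem comm_mem_sph_three [IsDomain k] (h0 : ∀ i j, A.form 1 i j = 0) {m n : ℤ} {u v : B}
    (hu : u ∈ A.sph m) (hv : v ∈ A.sph n) : u * v - v * u ∈ A.sph (m + n - 3) := by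
  obtain ⟨N, hN⟩ : ∃ N : ℕ, m + n < N := ⟨(m + n + 1).toNat, by omega⟩
  induction N generalizing m n u v with
  | zero =>
    rcases lt_or_ge m 0 with hm | hm
    · simp [eq_zero_of_mem_sph hm hu]
    · simp [eq_zero_of_mem_sph (by push_cast at hN; omega) hv]
  | succ N ih =>
  rcases lt_or_ge m 0 with hm | hm
  · simp [eq_zero_of_mem_sph hm hu]
  rcases lt_or_ge n 0 with hn | hn
  · simp [eq_zero_of_mem_sph hn hv]
  lift m to ℕ using hm
  lift n to ℕ using hn
  obtain ⟨b, hb, hbs⟩ := exists_mem_words_of_inv (comp_comp (m : ℤ) (A.theta u))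
    (isInv_comp_theta hu)
  obtain ⟨c, hc, hcs⟩ := exists_mem_words_of_inv (comp_comp (n : ℤ) (A.theta v))
    (isInv_comp_theta hv)
  obtain ⟨hb1, hb2⟩ := mul_sym_mem_sph hb hbs
  obtain ⟨hc1, hc2⟩ := mul_sym_mem_sph hc hcs
  have h1 : u - b * A.sym ∈ A.sph ((m : ℤ) - 1) :=
    mem_sph_sub_one (sub_mem hu hb1) (by rw [map_sub, map_sub, hb2, sub_self])
  have h2 : v - c * A.sym ∈ A.sph ((n : ℤ) - 1) :=
    mem_sph_sub_one (sub_mem hv hc1) (by rw [map_sub, map_sub, hc2, sub_self])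
  have h3 : (b * A.sym) * (c * A.sym) - (c * A.sym) * (b * A.sym) = (b * c - c * b) * A.sym := by
    rw [mul_assoc b, ← mul_assoc A.sym c, hcs, mul_assoc c A.sym A.sym, sym_mul_sym,
      mul_assoc c A.sym (b * A.sym), ← mul_assoc A.sym b, hbs, mul_assoc b A.sym A.sym, sym_mul_sym,
      sub_mul, mul_assoc, mul_assoc]
  have h4 : (b * A.sym) * (c * A.sym) - (c * A.sym) * (b * A.sym) ∈ A.sph ((m : ℤ) + n - 3) := by
    refine ⟨?_, ?_, ?_⟩
    · exact (sub_mem (mul_mem_sph hb1 hc1) (add_comm (n : ℤ) m ▸ mul_mem_sph hc1 hb1)).1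
    · exact (sub_mem (mul_mem_sph hb1 hc1) (add_comm (n : ℤ) m ▸ mul_mem_sph hc1 hb1)).2.1
    · rw [h3, theta_mul_sym]
      have := theta_comm_sub_mem_of_inv hb hc (isInv_comp_theta hu) (isInv_comp_theta hv)
      simpa only [h0, zero_smul, Finset.sum_const_zero, sub_zero] using this
  have h5 : u * v - v * u = ((u - b * A.sym) * v - v * (u - b * A.sym)) +
      ((b * A.sym) * (v - c * A.sym) - (v - c * A.sym) * (b * A.sym)) +
      ((b * A.sym) * (c * A.sym) - (c * A.sym) * (b * A.sym)) := by
    noncomm_ring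
  rw [h5]
  refine add_mem (add_mem ?_ ?_) h4
  · exact sph_mono (by omega) (ih h1 hv (by push_cast at hN; omega))
  · exact sph_mono (by omega) (ih hb1 h2 (by push_cast at hN; omega))

end

section

variable {k ι Γ B : Type*} [Field k] [Fintype ι] [Group Γ] [Fintype Γ]
  [DecidableEq Γ] [Ring B] [Algebra k B] {A : PBWAlgebra k ι Γ B}

variable (A) in
/-- The components of degree `-d` of the commutator of spherical elements, on homogeneous
polynomials of given degrees. -/
def commComp (d : ℕ) (m n : ℕ) : MvPolynomial ι k →ₗ[k] MvPolynomial ι k →ₗ[k] MvPolynomial ι k :=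
  ((LinearMap.mul k B - (LinearMap.mul k B).flip).compl₁₂ A.sphLift A.sphLift).compr₂
    (comp ((m : ℤ) + n - d) ∘ₗ A.theta)

variable (A) in
/-- The component of degree `-d` of the commutator of spherical elements, as a bracket on
polynomials. -/
def commBracket (d : ℕ) : MvPolynomial ι k →ₗ[k] MvPolynomial ι k →ₗ[k] MvPolynomial ι k :=
  glue fun m ↦ (glue fun n ↦ (A.commComp d m n).flip).flip

/-- Two lifts of the same symbol differ by an element of lower degree, whose commutators do not
reach degree `m + n - d`. So the bracket may be computed with any lifts. -/
theorem commBracket_eq {d : ℕ} (hd : ∀ m n : ℤ, ∀ u ∈ A.sph m, ∀ v ∈ A.sph n,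
      u * v - v * u ∈ A.sph (m + n - d)) {m n : ℕ} {u v : B} {p q : MvPolynomial ι k}
    (hu : u ∈ A.sph m) (hv : v ∈ A.sph n) (hp : comp m (A.theta u) = p)
    (hq : comp n (A.theta v) = q) :
    A.commBracket d p q = comp ((m : ℤ) + n - d) (A.theta (u * v - v * u)) := by
  have hp1 : comp m p = p := by rw [← hp, comp_comp]
  have hq1 : comp n q = q := by rw [← hq, comp_comp]
  have hpi : IsInv A.act p := hp ▸ isInv_comp_theta hu
  have hqi : IsInv A.act q := hq ▸ isInv_comp_theta hv
  have hp2 := sphLift_mem (A := A) (mem_degLE_of_comp_eq hp1)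
  have hq2 := sphLift_mem (A := A) (mem_degLE_of_comp_eq hq1)
  rw [commBracket, glue_apply _ hp1, LinearMap.flip_apply, glue_apply _ hq1, LinearMap.flip_apply]
  change comp ((m : ℤ) + n - d) (A.theta (A.sphLift p * A.sphLift q - A.sphLift q * A.sphLift p)) = _
  rw [← sub_eq_zero, ← map_sub, ← map_sub]
  have h1 : A.sphLift p - u ∈ A.sph ((m : ℤ) - 1) := mem_sph_sub_one (sub_mem hp2 hu)
    (by rw [map_sub, map_sub, comp_theta_sphLift hp1 hpi, hp, sub_self])
  have h2 : A.sphLift q - v ∈ A.sph ((n : ℤ) - 1) := mem_sph_sub_one (sub_mem hq2 hv)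
    (by rw [map_sub, map_sub, comp_theta_sphLift hq1 hqi, hq, sub_self])
  have h3 : A.sphLift p * A.sphLift q - A.sphLift q * A.sphLift p - (u * v - v * u) =
      ((A.sphLift p - u) * A.sphLift q - A.sphLift q * (A.sphLift p - u)) +
      (u * (A.sphLift q - v) - (A.sphLift q - v) * u) := by noncomm_ring
  rw [h3]
  refine comp_eq_zero (m := (m : ℤ) + n - d - 1) (by omega) ?_
  refine (add_mem (sph_mono ?_ (hd _ _ _ h1 _ hq2)) (sph_mono ?_ (hd _ _ _ hu _ h2))).2.2
  all_goals omega

variable [CharZero k]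

/-- The part of degree `-d` of the commutator inherits antisymmetry and the Leibniz rule from
commutators. It is a biderivation of the invariants, and `biderivation_eq_zero` kills it for `d ≥
3`. -/
theorem comm_mem_sph_succ (hgen : IsGenericAction A.act) {d : ℕ} (h3 : 3 ≤ d)
    (hd : ∀ m n : ℤ, ∀ u ∈ A.sph m, ∀ v ∈ A.sph n, u * v - v * u ∈ A.sph (m + n - d))
    (m n : ℤ) (u : B) (hu : u ∈ A.sph m) (v : B) (hv : v ∈ A.sph n) :
    u * v - v * u ∈ A.sph (m + n - (d + 1 : ℕ)) := by
  rcases lt_or_ge m 0 with hm | hm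
  · simp [eq_zero_of_mem_sph hm hu]
  rcases lt_or_ge n 0 with hn | hn
  · simp [eq_zero_of_mem_sph hn hv]
  lift m to ℕ using hm
  lift n to ℕ using hn
  have hgr := fun g n p ↦ A.comp_act g n p
  have hlift {m : ℕ} {p : MvPolynomial ι k} (hp : comp m p = p) : A.sphLift p ∈ A.sph m :=
    sphLift_mem (mem_degLE_of_comp_eq hp)
  have hanti (f q : MvPolynomial ι k) (hf : IsInv A.act f) (hq : IsInv A.act q) :
      A.commBracket d f q = - A.commBracket d q f := by
    refine hf.induction hgr (motive := fun f ↦ A.commBracket d f q = - A.commBracket d q f)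
      (by simp) (fun p p' hp hp' ↦ by simp [hp, hp', add_comm]) fun m f hf hm ↦ ?_
    refine hq.induction hgr (motive := fun q ↦ A.commBracket d f q = - A.commBracket d q f)
      (by simp) (fun p p' hp hp' ↦ by simp [hp, hp', add_comm]) fun n q hq hn ↦ ?_
    rw [commBracket_eq hd (hlift hm) (hlift hn) (comp_theta_sphLift hm hf)
      (comp_theta_sphLift hn hq), commBracket_eq hd (hlift hn) (hlift hm) (comp_theta_sphLift hn hq)
      (comp_theta_sphLift hm hf), ← map_neg, ← map_neg, neg_sub, add_comm (m : ℤ)]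
  have hleib (f g q : MvPolynomial ι k) (hf : IsInv A.act f) (hg : IsInv A.act g)
      (hq : IsInv A.act q) : A.commBracket d (f * g) q =
        f * A.commBracket d g q + g * A.commBracket d f q := by
    refine hf.induction hgr (motive := fun f ↦ A.commBracket d (f * g) q =
        f * A.commBracket d g q + g * A.commBracket d f q)
      (by simp) (fun p p' hp hp' ↦ ?_) fun m f hf hm ↦ ?_
    · simp only [add_mul, map_add, LinearMap.add_apply, hp, hp']
      ring
    refine hg.induction hgr (motive := fun g ↦ A.commBracket d (f * g) q =
        f * A.commBracket d g q + g * A.commBracket d f q)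
      (by simp) (fun p p' hp hp' ↦ ?_) fun m' g hg hm' ↦ ?_
    · simp only [mul_add, add_mul, map_add, LinearMap.add_apply, hp, hp']
      ring
    refine hq.induction hgr (motive := fun q ↦ A.commBracket d (f * g) q =
        f * A.commBracket d g q + g * A.commBracket d f q)
      (by simp) (fun p p' hp hp' ↦ ?_) fun n q hq hn ↦ ?_
    · simp only [map_add, hp, hp']
      ring
    have e1 := comp_theta_sphLift (A := A) hm hf
    have e2 := comp_theta_sphLift (A := A) hm' hg
    have e3 := comp_theta_sphLift (A := A) hn hq
    have hu := hlift hm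
    have hu' := hlift hm'
    have hv := hlift hn
    have hc := comp_theta_mul_sph hu.2.2 hu'
    rw [e1, e2] at hc
    rw [commBracket_eq hd (m := m + m') (by exact_mod_cast mul_mem_sph hu hu') hv
      (by exact_mod_cast hc) e3, commBracket_eq hd hu' hv e2 e3, commBracket_eq hd hu hv e1 e3]
    set u := A.sphLift f
    set u' := A.sphLift g
    set v := A.sphLift q
    have h4 : u * u' * v - v * (u * u') = u * (u' * v - v * u') + (u * v - v * u) * u' := by
      noncomm_ring
    have h5 := comp_theta_mul_sph hu.2.2 (hd _ _ _ hu' _ hv)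
    have h6 := comp_theta_mul_sph (hd _ _ _ hu _ hv).2.2 hu'
    rw [e1] at h5
    rw [e2] at h6
    rw [h4, map_add, map_add, ← h5, mul_comm g, ← h6]
    congr 3
    · push_cast; ring
    · push_cast; ring
  have h0 : A.commBracket d (comp m (A.theta u)) (comp n (A.theta v)) = 0 := by
    refine hgen.biderivation_eq_zero hgr (d := d) (by exact_mod_cast h3) hleib
      (fun q f g hq hf hg ↦ ?_) (fun m n f q hf hq hm hn ↦ ?_) (isInv_comp_theta hu)
      (isInv_comp_theta hv)
    · rw [hanti _ _ hq (hf.mul hg), hleib _ _ _ hf hg hq, hanti _ _ hq hf, hanti _ _ hq hg]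
      ring
    · rw [commBracket_eq hd (hlift hm) (hlift hn) (comp_theta_sphLift hm hf)
        (comp_theta_sphLift hn hq)]
      exact comp_mem _ _
  rw [commBracket_eq hd hu hv rfl rfl] at h0
  have := mem_sph_sub_one (hd _ _ _ hu _ hv) h0
  rwa [show (m : ℤ) + n - d - 1 = m + n - (d + 1 : ℕ) by push_cast; ring] at this

/-- The spherical subalgebra is commutative if the component of the commutators of letters at the
unit of the group vanishes. -/
theorem spherical_comm (hgen : IsGenericAction A.act) (h0 : ∀ i j, A.form 1 i j = 0) {u v : B}
    (hu : A.sym * u = u) (hu' : u * A.sym = u) (hv : A.sym * v = v) (hv' : v * A.sym = v) :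
    u * v = v * u := by
  have key (d : ℕ) : ∀ m n : ℤ, ∀ u ∈ A.sph m, ∀ v ∈ A.sph n,
      u * v - v * u ∈ A.sph (m + n - (d + 3 : ℕ)) := by
    induction d with
    | zero => exact fun m n u hu v hv ↦ by simpa using comm_mem_sph_three h0 hu hv
    | succ d ih => exact comm_mem_sph_succ hgen (by omega) ih
  obtain ⟨m, hm⟩ := exists_mem_sph hu hu'
  obtain ⟨n, hn⟩ := exists_mem_sph hv hv'
  -- With `d = m + n` the commutator has degree at most `-3`.
  exact sub_eq_zero.1 (eq_zero_of_mem_sph (by push_cast; omega) (key (m + n) m n u hm v hn))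

end

end PBWAlgebra

end

/-! ### The double centraliser property -/

noncomputable section

open MvPolynomial InvariantTheory

namespace PBWAlgebra

variable {k ι Γ B : Type*} [Field k] [Fintype ι] [Group Γ] [Fintype Γ]
  [DecidableEq Γ] [Ring B] [Algebra k B] {A : PBWAlgebra k ι Γ B}

/-- The algebra acts faithfully on the projective module given by the symmetriser. -/
theorem eq_zero_of_theta_mul (hgen : IsGenericAction A.act) {b : B}
    (h : ∀ c, A.theta (b * c) = 0) : b = 0 := by
  have step (m : ℤ) (hb : b ∈ A.filt m) : b ∈ A.filt (m - 1) := by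
    -- The leading coefficients of `b` form a combination of group elements annihilating every
    -- polynomial, so they vanish by independence of characters.
    have h1 : (fun g ↦ comp m (A.coord b g)) = fun _ ↦ 0 := hgen.ext fun p ↦ by
      obtain ⟨N, hN⟩ := exists_mem_degLE p
      rw [← sum_comp hN]
      simp only [map_sum, Finset.mul_sum]
      rw [Finset.sum_comm, Finset.sum_comm (s := Finset.univ)]
      refine Finset.sum_congr rfl fun n _ ↦ ?_
      have h2 := A.comp_theta_mul hb (c := A.lift (comp n p)) (n := n)
        (by rw [theta_lift]; exact comp_mem _ _)
      rw [h, map_zero, theta_lift, comp_comp] at h2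
      rw [← h2]
      simp
    exact fun g ↦ mem_degLE_sub_one (hb g) (congrFun h1 g)
  obtain ⟨n, hn⟩ := A.exists_mem_filt b
  have h1 (j : ℕ) : b ∈ A.filt (n - j) := by
    induction j with
    | zero => simpa using hn
    | succ j ih =>
      have := step _ ih
      rwa [show (n : ℤ) - j - 1 = n - (j + 1 : ℕ) by push_cast; ring] at this
  exact A.eq_zero_of_mem_filt (by push_cast; omega) (h1 (n + 1))

/-- Right multiplication by `u = sym * u` depends only on the class of `c` in `B e`. -/
theorem theta_mul_of_sym_mul {u : B} (hu : A.sym * u = u) (c : B) :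
    A.theta (c * u) = A.theta (A.lift (A.theta c) * u) := by
  rw [← hu, ← mul_assoc, mul_sym, mul_assoc]

/-- The leading term of a linear map over the spherical subalgebra comes from the algebra. -/
theorem exists_theta_mul_sub_mem (hgen : IsGenericAction A.act)
    {F : MvPolynomial ι k →ₗ[k] MvPolynomial ι k}
    (hF : ∀ p u, A.sym * u = u → u * A.sym = u →
      F (A.theta (A.lift p * u)) = A.theta (A.lift (F p) * u)) {n : ℤ}
    (hn : ∀ (m : ℤ) p, p ∈ degLE m → F p ∈ degLE (m + n)) :
    ∃ b ∈ A.filt n, ∀ (m : ℤ) p, p ∈ degLE m → F p - A.theta (b * A.lift p) ∈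
      degLE (m + (n - 1)) := by
  have hgr := fun g n p ↦ A.comp_act g n p
  let G : MvPolynomial ι k →ₗ[k] MvPolynomial ι k := glue fun m ↦ comp ((m : ℤ) + n) ∘ₗ F
  have hG {m : ℕ} {p : MvPolynomial ι k} (hp : comp m p = p) : G p = comp ((m : ℤ) + n) (F p) :=
    glue_apply _ hp
  have hlin (f p : MvPolynomial ι k) (hf : IsInv A.act f) : G (f * p) = f * G p := by
    refine hf.induction hgr (motive := fun f ↦ G (f * p) = f * G p) (by simp)
      (fun f f' h h' ↦ by rw [add_mul, map_add, h, h', add_mul]) fun l f hf hl ↦ ?_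
    obtain ⟨N, hN⟩ := exists_mem_degLE p
    rw [← sum_comp hN, Finset.mul_sum, map_sum, map_sum, Finset.mul_sum]
    refine Finset.sum_congr rfl fun m _ ↦ ?_
    have hm := comp_comp (m : ℤ) p
    set q := comp (m : ℤ) p
    have hu : A.sphLift f ∈ A.sph l := sphLift_mem (mem_degLE_of_comp_eq hl)
    have hfu := comp_theta_sphLift (A := A) hl hf
    have hq : A.theta (A.lift q) ∈ degLE (m : ℤ) := by
      rw [theta_lift]; exact mem_degLE_of_comp_eq hm
    have h1 := comp_theta_mul_sph hq hu
    have h2 := comp_theta_mul_sph (c := A.lift (F q)) (m := (m : ℤ) + n)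
      (by rw [theta_lift]; exact hn _ _ (mem_degLE_of_comp_eq hm)) hu
    rw [theta_lift, hfu, hm] at h1
    rw [theta_lift, hfu, ← hF q _ hu.1 hu.2.1] at h2
    have h3 : f * q - A.theta (A.lift q * A.sphLift f) ∈ degLE ((m : ℤ) + l - 1) := by
      refine mem_degLE_sub_one (sub_mem (mul_mem_degLE (mem_degLE_of_comp_eq hl)
        (mem_degLE_of_comp_eq hm) (by omega)) ?_) ?_
      · have := A.theta_mul_mem (A.lift_mem (mem_degLE_of_comp_eq hm)) hu.2.2
        exact this
      · rw [map_sub, h1, mul_comm f, comp_mul_of_comp_eq hm hl, sub_self]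
    have h4 : comp (m + l : ℤ) (f * q) = f * q := by
      rw [mul_comm f, comp_mul_of_comp_eq hm hl]
    rw [hG hm, hG (m := m + l) (by exact_mod_cast h4), mul_comm f (comp ((m : ℤ) + n) (F q)), ← h2,
      ← sub_eq_zero, show ((m + l : ℕ) : ℤ) + n = m + n + l by push_cast; ring, ← map_sub, ← map_sub]
    exact comp_eq_zero (by omega) (hn _ _ h3)
  obtain ⟨a, ha⟩ := hgen.exists_eq_sum hlin
  -- The required element is assembled from the components of degree `n` of the coefficients of `G`.
  have hcoord (g : Γ) : A.coord (∑ h, A.lift (comp n (a h)) * A.γ h) g = comp n (a g) := by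
    rw [map_sum]
    simp only [coord_lift_mul_γ]
    rw [Finset.sum_apply, Finset.sum_pi_single]
    simp
  have hb : ∑ h, A.lift (comp n (a h)) * A.γ h ∈ A.filt n := fun g ↦ by
    rw [hcoord]
    exact comp_mem _ _
  refine ⟨_, hb, fun m p hp ↦ ?_⟩
  rcases lt_or_ge m 0 with hm | hm
  · rw [eq_zero_of_mem_degLE hm hp]
    simp
  lift m to ℕ using hm
  rw [show (m : ℤ) + (n - 1) = m + n - 1 by ring]
  refine mem_degLE_sub_one (sub_mem (hn _ _ hp) ?_) ?_
  · rw [add_comm]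
    exact A.theta_mul_mem hb (by rwa [theta_lift])
  · have h1 : comp ((m : ℤ) + n) (F (comp m p)) = comp ((m : ℤ) + n) (F p) := by
      rw [← sub_eq_zero, ← neg_eq_zero, ← map_sub, ← map_neg, ← map_sub, ← map_neg, neg_sub]
      exact comp_eq_zero (by omega) (hn _ _ (sub_comp_mem hp))
    have h2 := A.comp_theta_mul hb (c := A.lift p) (n := m) (by rwa [theta_lift])
    rw [theta_lift] at h2
    rw [map_sub, sub_eq_zero, add_comm (m : ℤ), h2, add_comm n, ← h1,
      ← comp_comp, ← hG (comp_comp _ _), ha, map_sum]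
    refine Finset.sum_congr rfl fun g _ ↦ ?_
    rw [add_comm (m : ℤ), comp_mul_right (by rw [hgr, comp_comp]), hcoord, comp_comp]

/-- Linear maps of finite order over the spherical subalgebra come from the algebra. -/
theorem exists_theta_mul_eq (hgen : IsGenericAction A.act)
    {F : MvPolynomial ι k →ₗ[k] MvPolynomial ι k}
    (hF : ∀ p u, A.sym * u = u → u * A.sym = u →
      F (A.theta (A.lift p * u)) = A.theta (A.lift (F p) * u)) {n : ℤ}
    (hn : ∀ (m : ℤ) p, p ∈ degLE m → F p ∈ degLE (m + n)) :
    ∃ b, ∀ p, F p = A.theta (b * A.lift p) := by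
  obtain ⟨N, hN⟩ : ∃ N : ℕ, n < N := ⟨(n + 1).toNat, by omega⟩
  induction N generalizing n F with
  | zero =>
    refine ⟨0, fun p ↦ ?_⟩
    -- In negative order the approximating element is zero, so the order of `F` itself drops by one;
    -- repeating this, `F` lowers degrees by any amount.
    have h1 (j : ℕ) : ∀ (m : ℤ) p, p ∈ degLE m → F p ∈ degLE (m + (n - j)) := by
      induction j with
      | zero => simpa using hn
      | succ j ih =>
        obtain ⟨b, hb, hb'⟩ := exists_theta_mul_sub_mem hgen hF ih
        have hb0 := A.eq_zero_of_mem_filt (by push_cast at hN; omega) hb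
        intro m p hp
        have := hb' m p hp
        rw [hb0, zero_mul, map_zero, sub_zero] at this
        exact degLE_mono (by push_cast; omega) this
    obtain ⟨m, hm⟩ := exists_mem_degLE p
    rw [zero_mul, map_zero]
    exact eq_zero_of_mem_degLE (by push_cast at hN; omega) (h1 m m p hm)
  | succ N ih =>
    obtain ⟨b, hb, hb'⟩ := exists_theta_mul_sub_mem hgen hF hn
    obtain ⟨b', h'⟩ := ih (F := F - A.theta ∘ₗ LinearMap.mulLeft k b ∘ₗ A.lift) (n := n - 1)
      (fun p u hu hu' ↦ by
        change F _ - A.theta (b * A.lift _) = A.theta (A.lift (F p - A.theta (b * A.lift p)) * u)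
        rw [hF p u hu hu', ← theta_mul, map_sub, sub_mul, map_sub, ← theta_mul_of_sym_mul hu,
          mul_assoc])
      hb' (by push_cast at hN; omega)
    refine ⟨b + b', fun p ↦ ?_⟩
    rw [add_mul, map_add, ← h' p]
    change F p = A.theta (b * A.lift p) + (F p - A.theta (b * A.lift p))
    ring

/-- The elements of a commutative spherical subalgebra come from the centre. -/
theorem exists_central (hgen : IsGenericAction A.act)
    (hcomm : ∀ u v, A.sym * u = u → u * A.sym = u → A.sym * v = v → v * A.sym = v →
      u * v = v * u) {a : B} (ha : A.sym * a = a) (ha' : a * A.sym = a) :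
    ∃ b, (∀ y, b * y = y * b) ∧ b * A.sym = a := by
  obtain ⟨n, hn⟩ := exists_mem_sph ha ha'
  -- Right multiplication by `a` is linear over the spherical subalgebra because the latter is
  -- commutative, so it is left multiplication by some `b`.
  obtain ⟨b, hb⟩ := exists_theta_mul_eq hgen (n := n)
    (F := A.theta ∘ₗ LinearMap.mulRight k a ∘ₗ A.lift)
    (fun p u hu hu' ↦ by
      change A.theta (A.lift (A.theta (A.lift p * u)) * a) =
        A.theta (A.lift (A.theta (A.lift p * a)) * u)
      rw [← theta_mul_of_sym_mul ha, ← theta_mul_of_sym_mul hu, mul_assoc, hcomm u a hu hu' ha ha',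
        mul_assoc])
    (fun m p hp ↦ A.theta_mul_mem (A.lift_mem hp) hn.2.2)
  have hb (c : B) : A.theta (c * a) = A.theta (b * c) := by
    rw [theta_mul_of_sym_mul ha, A.theta_mul b c]
    exact hb _
  -- On `B e`, `b` acts as a right multiplication and thus commutes with every left multiplication;
  -- faithfulness makes it central.
  refine ⟨b, fun y ↦ sub_eq_zero.1 (eq_zero_of_theta_mul hgen fun c ↦ ?_), ?_⟩
  · rw [sub_mul, map_sub, mul_assoc, mul_assoc, ← hb, A.theta_mul_congr y (hb c).symm, mul_assoc,
      sub_self]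
  · have h1 := hb 1
    rw [one_mul, mul_one] at h1
    rw [← A.mul_sym_congr h1, ha']

/-- A central `b` with `b e = 0` acts by zero on `B e`. -/
theorem eq_zero_of_central (hgen : IsGenericAction A.act) {b : B} (hb : ∀ y, b * y = y * b)
    (h : b * A.sym = 0) : b = 0 :=
  eq_zero_of_theta_mul hgen fun c ↦ by
    rw [hb, ← theta_mul_sym, mul_assoc, h, mul_zero, map_zero]

end PBWAlgebra

end

/-! ### Brackets from deformations, and their comparison in a corner -/

noncomputable section

section

variable {𝒜 A : Type*} [Ring 𝒜] [Ring A] {τ : 𝒜} {π : 𝒜 →+* A}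

/-- The Poisson structure on the centre of an algebra given by a deformation. -/
theorem exists_isHayashiBracket {k : Type*} [CommRing k] [Algebra k A]
    (hπ : Function.Surjective π) (hτ : ∀ a, τ * a = a * τ) (hker : ∀ a, π a = 0 ↔ τ ∣ a)
    (hreg : ∀ a, τ * a = 0 → a = 0)
    (hk : ∀ r : k, ∃ ρ : 𝒜, (∀ a, ρ * a = a * ρ) ∧ π ρ = algebraMap k A r) :
    ∃ P : PoissonStructure k (Subalgebra.center k A),
      IsHayashiBracket τ π (fun z w ↦ P.bracket z w) := by
  have e1 (x y : 𝒜) : τ * (x * y) = (τ * x) * y := (mul_assoc _ _ _).symm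
  have e2 (x y : 𝒜) : τ * (x * y) = x * (τ * y) := by rw [← mul_assoc, hτ, mul_assoc]
  have hcen (z : Subalgebra.center k A) (a : A) : z.1 * a = a * z.1 :=
    (Subalgebra.mem_center_iff.1 z.2 a).symm
  have hinj {a b : 𝒜} (h : τ * a = τ * b) : a = b :=
    sub_eq_zero.1 (hreg _ (by rw [mul_sub, h, sub_self]))
  have hdvd {u : 𝒜} {z : Subalgebra.center k A} (hu : π u = z) (v : 𝒜) :
      ∃ d, u * v - v * u = τ * d := by
    refine (hker _).1 ?_
    rw [map_sub, map_mul, map_mul, hu, hcen, sub_self]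
  choose l hl using fun z : Subalgebra.center k A ↦ hπ z.1
  choose D hD using fun z w : Subalgebra.center k A ↦ hdvd (hl z) (l w)
  -- Jacobi identity for commutators, with one factor `τ` taken out.
  have hmid {u v w d x y : 𝒜} (h : u * v - v * u = τ * d) (hx : u * w - w * u = τ * x)
      (hy : v * w - w * v = τ * y) :
      τ * (d * w - w * d) = τ * ((u * y - y * u) - (v * x - x * v)) := by
    have h1 : τ * (d * w - w * d) = (τ * d) * w - w * (τ * d) := by
      rw [mul_sub, e1 d, e2 w]
    have h2 (u y : 𝒜) : τ * (u * y - y * u) = u * (τ * y) - (τ * y) * u := by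
      rw [mul_sub, e2 u, e1 y]
    rw [h1, mul_sub, h2, h2, ← h, ← hx, ← hy]
    noncomm_ring
  -- The commutator of `D z w` with `a` is a difference of commutators of `l z` and `l w`, again
  -- divisible by `τ` as these are central modulo `τ`; so the bracket is central.
  have hDc (z w : Subalgebra.center k A) : π (D z w) ∈ Subalgebra.center k A := by
    refine Subalgebra.mem_center_iff.2 fun a ↦ ?_
    obtain ⟨a, rfl⟩ := hπ a
    obtain ⟨x, hx⟩ := hdvd (hl z) a
    obtain ⟨y, hy⟩ := hdvd (hl w) a
    obtain ⟨x', hx'⟩ := hdvd (hl w) x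
    obtain ⟨y', hy'⟩ := hdvd (hl z) y
    have h1 := hinj (hmid (hD z w) hx hy)
    rw [hx', hy', ← mul_sub] at h1
    have h2 : π (D z w * a - a * D z w) = 0 := (hker _).2 ⟨_, h1⟩
    rw [map_sub, map_mul, map_mul, sub_eq_zero] at h2
    exact h2.symm
  let br (z w : Subalgebra.center k A) : Subalgebra.center k A := ⟨π (D z w), hDc z w⟩
  -- Changing a lift by `τ * a` changes `d` by a commutator with a lift of a central element, which
  -- vanishes modulo `τ`.
  have key {z w : Subalgebra.center k A} {u v d : 𝒜} (hu : π u = z) (hv : π v = w)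
      (h : u * v - v * u = τ * d) : (br z w : A) = π d := by
    obtain ⟨a, ha⟩ := (hker (u - l z)).1 (by rw [map_sub, hu, hl, sub_self])
    obtain ⟨b, hb⟩ := (hker (v - l w)).1 (by rw [map_sub, hv, hl, sub_self])
    obtain ⟨x, hx⟩ := hdvd hv a
    obtain ⟨y, hy⟩ := hdvd (hl z) b
    have h1 : d = D z w + τ * (y - x) := by
      refine hinj ?_
      rw [mul_add, mul_sub τ y, ← hy, ← hx, mul_sub τ, mul_sub τ (l z * b), mul_sub τ (v * a),
        e1 a, e2 _ a, e2 _ b, e1 b, ← hD, ← h, ← ha, ← hb]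
      noncomm_ring
    rw [h1, map_add, (hker _).2 ⟨_, rfl⟩, add_zero]
  have hanti (z w : Subalgebra.center k A) : br z w = - br w z := by
    refine Subtype.ext ?_
    have := key (hl z) (hl w) (d := - D w z) (by rw [mul_neg, ← hD, neg_sub])
    rw [this, map_neg]
    rfl
  have hadd (z z' w : Subalgebra.center k A) : br (z + z') w = br z w + br z' w := by
    refine Subtype.ext ((key (u := l z + l z') (v := l w) (d := D z w + D z' w)
      (by rw [map_add, hl, hl]; rfl) (hl w) ?_).trans (map_add _ _ _))
    rw [mul_add τ, ← hD, ← hD]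
    noncomm_ring
  have hsmul (r : k) (z w : Subalgebra.center k A) : br (r • z) w = r • br z w := by
    obtain ⟨ρ, hρ, hρ'⟩ := hk r
    refine Subtype.ext ((key (u := ρ * l z) (v := l w) (d := ρ * D z w)
      (by rw [map_mul, hl, hρ', ← Algebra.smul_def]; rfl) (hl w) ?_).trans ?_)
    · rw [e2 ρ, ← hD, mul_sub, ← mul_assoc (l w), ← hρ (l w), mul_assoc, mul_assoc]
    · rw [map_mul, hρ', ← Algebra.smul_def]
      rfl
  let B : Subalgebra.center k A →ₗ[k] Subalgebra.center k A →ₗ[k] Subalgebra.center k A :=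
    LinearMap.mk₂ k br hadd hsmul
      (fun z w w' ↦ by rw [hanti, hadd, hanti z w, hanti z w', neg_add])
      (fun r z w ↦ by rw [hanti, hsmul, hanti z w, smul_neg])
  have hB (z w : Subalgebra.center k A) : B z w = br z w := rfl
  refine ⟨⟨fun a b ↦ Subtype.ext (hcen a b.1), B, fun z ↦ ?_, fun x y z ↦ ?_, fun x y z ↦ ?_⟩, ?_⟩
  · refine Subtype.ext ((key (hl z) (hl z) (d := 0) (by simp)).trans (map_zero π))
  · have h (x y z : Subalgebra.center k A) : ∃ E, (br x (br y z) : A) = π E ∧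
        τ * (τ * E) = l x * (l y * l z - l z * l y) - (l y * l z - l z * l y) * l x := by
      obtain ⟨E, hE⟩ := hdvd (hl x) (D y z)
      refine ⟨E, key (hl x) rfl hE, ?_⟩
      rw [← hE, mul_sub, e2 (l x), e1 (D y z), ← hD]
    obtain ⟨E, hE, hE'⟩ := h x y z
    obtain ⟨F, hF, hF'⟩ := h y z x
    obtain ⟨G, hG, hG'⟩ := h z x y
    -- This is the Jacobi identity for the lifts after two cancellations of `τ`.
    have h0 : E + F + G = 0 := by
      refine hreg _ (hreg _ ?_)
      rw [mul_add, mul_add, mul_add, mul_add, hE', hF', hG']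
      noncomm_ring
    refine Subtype.ext ?_
    change (br x (br y z) : A) + (br y (br z x) : A) + (br z (br x y) : A) = 0
    rw [hE, hF, hG, ← map_add, ← map_add, h0, map_zero]
  · refine Subtype.ext ((key (u := l x) (v := l y * l z) (d := D x y * l z + l y * D x z) (hl x)
      (by rw [map_mul, hl, hl]; rfl) ?_).trans ?_)
    · rw [mul_add τ, e1 (D x y), e2 (l y), ← hD, ← hD]
      noncomm_ring
    · rw [map_add, map_mul, map_mul, hl, hl]
      rfl
  · intro u v hu hv
    exact ⟨hdvd (z := ⟨π u, hu⟩) rfl v, fun d hd ↦ key rfl rfl hd⟩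

/-- Comparison of the commutators of lifts of central elements `z`, `w` and of the elements
`z e`, `w e` of a corner. -/
theorem map_corner_commutator (hτ : ∀ a, τ * a = a * τ) (hker : ∀ a, π a = 0 ↔ τ ∣ a)
    (hreg : ∀ a, τ * a = 0 → a = 0) {e : 𝒜} (he : e * e = e)
    (hcomm : ∀ a b, e * a = a → a * e = a → e * b = b → b * e = b → π (a * b) = π (b * a))
    {z w u v D d : 𝒜} (hz : ∀ x, π z * x = x * π z) (hw : ∀ x, π w * x = x * π w)
    (hu : e * u = u) (hu' : u * e = u) (hv : e * v = v) (hv' : v * e = v)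
    (huz : π u = π z * π e) (hvw : π v = π w * π e) (hD : z * w - w * z = τ * D)
    (hd : u * v - v * u = τ * d) : π d = π (e * D * e) := by
  have hinj {a b : 𝒜} (h : τ * a = τ * b) : a = b :=
    sub_eq_zero.1 (hreg _ (by rw [mul_sub, h, sub_self]))
  have hee : π e * π e = π e := by rw [← map_mul, he]
  have hmid (p q r : 𝒜) : p * (τ * q) * r = τ * (p * q * r) := by
    rw [← mul_assoc, ← hτ p, mul_assoc τ, mul_assoc τ]
  -- A lift of `z e` lying in the corner differs from `e * z * e` by `τ` times an element of the
  -- corner.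
  have hcor {z u : 𝒜} (hz : ∀ x, π z * x = x * π z) (hu : e * u = u) (hu' : u * e = u)
      (huz : π u = π z * π e) : ∃ a, u = e * z * e + τ * a ∧ e * a = a ∧ a * e = a := by
    obtain ⟨a, ha⟩ := (hker (u - e * z * e)).1 (by
      rw [map_sub, map_mul, map_mul, huz, ← hz, mul_assoc, hee, sub_self])
    refine ⟨a, by rw [← ha]; abel, hinj ?_, hinj ?_⟩
    · rw [← mul_assoc, hτ, mul_assoc, ← ha, mul_sub, hu, ← mul_assoc, ← mul_assoc, he]
    · rw [← mul_assoc, ← ha, sub_mul, hu', mul_assoc, he]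
  -- `s` measures the failure of `e` to commute with the lift `z`. Its corner part vanishes because
  -- `e * (z * e - e * z) * e = 0`.
  have hres {z : 𝒜} (hz : ∀ x, π z * x = x * π z) : ∃ s, e * z = z * e - τ * s ∧ e * s * e = 0 := by
    obtain ⟨s, hs⟩ := (hker (z * e - e * z)).1 (by rw [map_sub, map_mul, map_mul, hz, sub_self])
    refine ⟨s, by rw [← hs]; abel, hreg _ ?_⟩
    rw [← hmid, ← hs, mul_sub, sub_mul, ← mul_assoc, mul_assoc (e * z), he, ← mul_assoc e e, he,
      sub_self]
  obtain ⟨a, rfl, ha, ha'⟩ := hcor hz hu hu' huz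
  obtain ⟨b, rfl, hb, hb'⟩ := hcor hw hv hv' hvw
  obtain ⟨s, hs, hs'⟩ := hres hz
  obtain ⟨r, hr, hr'⟩ := hres hw
  have hc {a b : 𝒜} (ha : e * a = a) (ha' : a * e = a) (hb : e * b = b) (hb' : b * e = b) :
      π (a * b - b * a) = 0 := by rw [map_sub, hcomm a b ha ha' hb hb', sub_self]
  have hu0 : e * (e * z * e) = e * z * e := by rw [← mul_assoc, ← mul_assoc, he]
  have hu0' : e * z * e * e = e * z * e := by rw [mul_assoc, he]
  have h1 : (e * z * e) * (e * w * e) = e * (z * w) * e - τ * (e * z * r * e) := by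
    have : (e * z * e) * (e * w * e) = e * z * (e * w) * e := by
      rw [mul_assoc (e * z), ← mul_assoc e (e * w), ← mul_assoc e e, he, ← mul_assoc]
    rw [this, hr, mul_sub, sub_mul, hmid, ← mul_assoc, mul_assoc _ e e, he, mul_assoc e z w]
  have h2 : (e * w * e) * (e * z * e) = e * (w * z) * e - τ * (e * w * s * e) := by
    have : (e * w * e) * (e * z * e) = e * w * (e * z) * e := by
      rw [mul_assoc (e * w), ← mul_assoc e (e * z), ← mul_assoc e e, he, ← mul_assoc]
    rw [this, hs, mul_sub, sub_mul, hmid, ← mul_assoc, mul_assoc _ e e, he, mul_assoc e w z]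
  have h3 : d = e * D * e - e * z * r * e + e * w * s * e +
      (a * (e * w * e + τ * b) - (e * w * e + τ * b) * a) +
      ((e * z * e) * b - b * (e * z * e)) := by
    refine hinj ?_
    have e1 (x y : 𝒜) : τ * (x * y) = (τ * x) * y := (mul_assoc _ _ _).symm
    have e2 (x y : 𝒜) : τ * (x * y) = x * (τ * y) := by rw [← mul_assoc, hτ, mul_assoc]
    have h4 : e * (z * w) * e - e * (w * z) * e = τ * (e * D * e) := by
      rw [← sub_mul, ← mul_sub, hD, hmid]
    rw [← hd, mul_add τ, mul_add τ, mul_add τ, mul_sub τ (e * D * e), mul_sub τ (a * _),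
      mul_sub τ (e * z * e * b), ← h4, e1 a, e2 _ a, e2 _ b, e1 b]
    have h5 : τ * (e * z * r * e) = e * (z * w) * e - (e * z * e) * (e * w * e) := by
      rw [h1]; abel
    have h6 : τ * (e * w * s * e) = e * (w * z) * e - (e * w * e) * (e * z * e) := by
      rw [h2]; abel
    rw [h5, h6]
    noncomm_ring
  -- Modulo `τ` the factor `z` is central and can be pulled out, leaving `e * r * e = 0`.
  have h4 : π (e * z * r * e) = 0 := by
    have := congrArg π hr'
    simp only [map_mul, map_zero] at this ⊢
    rw [← hz, mul_assoc (π z), mul_assoc (π z), this, mul_zero]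
  have h5 : π (e * w * s * e) = 0 := by
    have := congrArg π hs'
    simp only [map_mul, map_zero] at this ⊢
    rw [← hw, mul_assoc (π w), mul_assoc (π w), this, mul_zero]
  rw [h3, map_add, map_add, map_add, map_sub, h4, h5, hc ha ha' hv hv', hc hu0 hu0' hb hb']
  simp

end

end

/-! ### Torsion-freeness of the family and nonvanishing of the spherical bracket -/

noncomputable section

open MvPolynomial InvariantTheory

namespace MvPolynomial

theorem comp_map {ι k K : Type*} [CommRing k] [CommRing K] (f : k →+* K) (n : ℤ)
    (p : MvPolynomial ι k) : comp n (map f p) = map f (comp n p) := by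
  ext d
  rw [coeff_comp, coeff_map, coeff_map, coeff_comp]
  split_ifs
  · rfl
  · rw [map_zero]

end MvPolynomial

namespace SympRefl

variable {V : Type*} [AddCommGroup V] [Module ℂ V] {ω : LinearMap.BilinForm ℂ V}
  {Γ : Subgroup (V ≃ₗ[ℂ] V)} [Fintype Γ] (c : invariantFunctions Γ)

variable {ι : Type*} [Fintype ι] (b : Module.Basis ι ℂ V)

theorem map_linPoly {k : Type*} [CommRing k] [Algebra ℂ k] (v : V) :
    map (algebraMap ℂ k) (linPoly ℂ b v) = linPoly k b v := by
  simp only [linPoly_eq, smul_eq_C_mul, map_sum, map_mul, map_C, map_X, Algebra.algebraMap_self,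
    RingHom.id_apply]

theorem map_polyAct {k : Type*} [CommRing k] [Algebra ℂ k] (g : V ≃ₗ[ℂ] V) (p : MvPolynomial ι ℂ) :
    map (algebraMap ℂ k) (polyAct ℂ b g p) = polyAct k b g (map (algebraMap ℂ k) p) := by
  induction p using MvPolynomial.induction_on with
  | C r =>
    rw [map_C, ← algebraMap_eq, ← algebraMap_eq, AlgHom.commutes, AlgHom.commutes, algebraMap_eq,
      algebraMap_eq, map_C]
  | add p q hp hq => simp only [map_add, hp, hq]
  | mul_X p i hp => simp only [map_mul, hp, map_X, polyAct_X, map_linPoly]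

variable [LinearOrder ι]

theorem H.pbw_sym [DecidableEq Γ] (hω : ω.IsAlt) (hΓ : ∀ g ∈ Γ, ∀ x y, ω (g x) (g y) = ω x y)
    (t : ℂ) : (H.pbw c b hω hΓ t).sym = e ω Γ t c := by
  rw [e, symmetriser, map_smul, map_sum]
  rfl

theorem Family.pbw_sym [DecidableEq Γ] (hω : ω.IsAlt)
    (hΓ : ∀ g ∈ Γ, ∀ x y, ω (g x) (g y) = ω x y) :
    (Family.pbw c b hω hΓ).sym = familyE ω Γ c := by
  have h : familyE ω Γ c = (Polynomial.C (Fintype.card Γ : ℂ)⁻¹ : Polynomial ℂ) •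
      Family.mk ω Γ c (Polynomial.C (∑ g : Γ, ofGrp Γ g)) := by
    rw [familyE, symmetriser, Family.smul_mk, Polynomial.map_C, ← map_mul, ← Algebra.smul_def]
  rw [h, map_sum, map_sum]
  rfl

section

variable {c b} [DecidableEq Γ]

theorem param_theta {hω : ω.IsAlt} {hΓ : ∀ g ∈ Γ, ∀ x y, ω (g x) (g y) = ω x y}
    (a : Family ω Γ c) : (Family.pbw c b hω hΓ).theta (param ω Γ c * a) =
    (Polynomial.X : Polynomial ℂ) • (Family.pbw c b hω hΓ).theta a := by
  rw [← Family.X_smul, map_smul]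

/-- By PBW the family is a module of polynomials over `ℂ[t]`, on which `t` is a nonzero divisor. -/
theorem eq_zero_of_param_mul (b : Module.Basis ι ℂ V) (hω : ω.IsAlt)
    (hΓ : ∀ g ∈ Γ, ∀ x y, ω (g x) (g y) = ω x y) {a : Family ω Γ c} (h : param ω Γ c * a = 0) : a = 0 := by
  rw [← Family.X_smul] at h
  apply (Family.pbw c b hω hΓ).coord.injective
  have h1 := congrArg (Family.pbw c b hω hΓ).coord h
  rw [map_smul, map_zero] at h1
  rw [map_zero]
  exact (smul_eq_zero.1 h1).resolve_left Polynomial.X_ne_zero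

/-- The Poisson bracket on the spherical algebra does not vanish. -/
theorem exists_comm_not_dvd (hω : ω.IsAlt) (hnd : ω.Nondegenerate)
    (hΓ : ∀ g ∈ Γ, ∀ x y, ω (g x) (g y) = ω x y) {i j : ι} (hij : ω (b i) (b j) ≠ 0) :
    ∃ u v : Family ω Γ c, familyE ω Γ c * u = u ∧ u * familyE ω Γ c = u ∧
      familyE ω Γ c * v = v ∧ v * familyE ω Γ c = v ∧
      ∀ d, u * v - v * u ≠ param ω Γ c * (param ω Γ c * d) := by
  let A := Family.pbw c b hω hΓ
  have hA : A.sym = familyE ω Γ c := Family.pbw_sym c b hω hΓ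
  obtain ⟨m, n, f, q, hf, hq, hm, hn, h0⟩ := (isGenericAction b hω hnd hΓ).exists_pairing_ne_zero
    (fun g n p ↦ (H.pbw c b hω hΓ 0).comp_act g n p) (a := fun i j ↦ ω (b i) (b j)) hij
  let ρ : ℂ →+* Polynomial ℂ := algebraMap ℂ (Polynomial ℂ)
  have hinv {f : MvPolynomial ι ℂ} (hf : IsInv ((polyAct ℂ b).comp Γ.subtype) f) :
      IsInv A.act (map ρ f) := fun g ↦
    (map_polyAct b (g : V ≃ₗ[ℂ] V) f).symm.trans (congrArg (map ρ) (hf g))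
  obtain ⟨u, hu, hu'⟩ := A.exists_mem_words_of_inv ((comp_map ρ m f).trans (congrArg _ hm))
    (hinv hf)
  obtain ⟨v, hv, hv'⟩ := A.exists_mem_words_of_inv ((comp_map ρ n q).trans (congrArg _ hn))
    (hinv hq)
  have hs := A.sym_mul_sym
  refine ⟨u * A.sym, v * A.sym, ?_, ?_, ?_, ?_, fun d hd ↦ h0 ?_⟩
  · rw [← hA, ← mul_assoc, hu', mul_assoc, hs]
  · rw [← hA, mul_assoc, hs]
  · rw [← hA, ← mul_assoc, hv', mul_assoc, hs]
  · rw [← hA, mul_assoc, hs]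
  set s := ∑ i, ∑ j, ω (b i) (b j) • (pderiv i f * pderiv j q) with hsdef
  have hscomp : comp ((m : ℤ) - 1 + (n - 1)) s = s := by
    simp only [hsdef, map_sum, map_smul,
      comp_mul_of_comp_eq (comp_pderiv _ hm) (comp_pderiv _ hn)]
  have hform (i j : ι) : A.form 1 i j = ω (b i) (b j) • (Polynomial.X : Polynomial ℂ) :=
    kappaForm_one _ _ _ _ _ _
  have hS : ∑ i, ∑ j, A.form 1 i j • (pderiv i (map ρ f) * pderiv j (map ρ q)) =
      (Polynomial.X : Polynomial ℂ) • map ρ s := by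
    simp only [hsdef, map_sum, Finset.smul_sum, hform, pderiv_map, ← map_mul]
    refine Finset.sum_congr rfl fun i _ ↦ Finset.sum_congr rfl fun j _ ↦ ?_
    rw [smul_eq_C_mul (_ * _) (ω (b i) (b j)), map_mul (map ρ) (C _), map_C, ← smul_eq_C_mul,
      smul_smul, mul_comm Polynomial.X, ← Algebra.smul_def]
  have h1 := A.theta_comm_sub_mem_of_inv hu hv (hinv hf) (hinv hq)
  have h2 : (u * A.sym) * (v * A.sym) - (v * A.sym) * (u * A.sym) = (u * v - v * u) * A.sym := by
    rw [mul_assoc u, ← mul_assoc A.sym, hv', mul_assoc v, hs, mul_assoc v, ← mul_assoc A.sym, hu',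
      mul_assoc u, hs, sub_mul, mul_assoc, mul_assoc]
  -- In degree `m + n - 2` the commutator has leading term `t` times the pairing `s`. If it were
  -- divisible by `t ^ 2`, cancelling one `t` and evaluating at `t = 0` would give `s = 0`.
  have h3 := comp_eq_zero (n := (m : ℤ) - 1 + (n - 1)) (by omega) h1
  rw [← A.theta_mul_sym, ← h2, hd, param_theta, param_theta, hS, map_sub, map_smul, map_smul,
    map_smul, MvPolynomial.comp_map, hscomp, ← smul_sub] at h3
  have h4 := sub_eq_zero.1 ((smul_eq_zero.1 h3).resolve_left Polynomial.X_ne_zero)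
  have h5 := congrArg (map (Polynomial.evalRingHom (0 : ℂ))) h4
  rw [smul_eq_C_mul, map_mul, map_C, Polynomial.coe_evalRingHom, Polynomial.eval_X, C_0, zero_mul,
    map_map] at h5
  have h6 : (Polynomial.evalRingHom (0 : ℂ)).comp ρ = RingHom.id ℂ := by
    ext r
    simp [ρ]
  rw [h6, map_id] at h5
  exact h5.symm

/-- When `V = 0` the group is trivial and the family is generated by `1` over `ℂ[t]`. This is the
case in which no greatest exponent exists. -/
theorem family_comm_of_isEmpty (b : Module.Basis ι ℂ V) (hω : ω.IsAlt)
    (hΓ : ∀ g ∈ Γ, ∀ x y, ω (g x) (g y) = ω x y) [IsEmpty ι] (u v : Family ω Γ c) : u * v = v * u := by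
  let A := Family.pbw c b hω hΓ
  have : Subsingleton V := ⟨fun x y ↦ b.ext_elem fun i ↦ isEmptyElim i⟩
  have : Subsingleton Γ := ⟨fun g h ↦ Subtype.ext (LinearEquiv.ext fun x ↦ Subsingleton.elim _ _)⟩
  have h (u : Family ω Γ c) : ∃ r : Polynomial ℂ, u = r • (A.lift 1 * A.γ 1) := by
    refine ⟨coeff 0 (A.coord u 1), ?_⟩
    conv_lhs => rw [A.eq_sum_lift u, Fintype.sum_subsingleton _ 1, eq_C_of_isEmpty (A.coord u 1)]
    rw [← smul_mul_assoc, ← map_smul, smul_eq_C_mul, mul_one]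
  obtain ⟨r, rfl⟩ := h u
  obtain ⟨s, rfl⟩ := h v
  rw [smul_mul_smul_comm, smul_mul_smul_comm, mul_comm]

end

end SympRefl

end

/-! ### Transport of the bracket and the isomorphism with the centre -/

noncomputable section

namespace PoissonStructure

/-- Transport of a Poisson structure along an isomorphism of algebras. -/
def map {k A B : Type*} [CommRing k] [Ring A] [Algebra k A] [Ring B] [Algebra k B]
    (P : PoissonStructure k A) (φ : A ≃ₐ[k] B) : PoissonStructure k B where
  commutative a b := φ.symm.injective (by rw [map_mul, map_mul, P.commutative])
  bracket := LinearMap.mk₂ k (fun a b ↦ φ (P.bracket (φ.symm a) (φ.symm b)))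
    (fun a b c ↦ by simp) (fun r a b ↦ by simp) (fun a b c ↦ by simp) (fun r a b ↦ by simp)
  alternating a := by simp [P.alternating]
  jacobi a b c := by
    simp only [LinearMap.mk₂_apply, AlgEquiv.symm_apply_apply, ← map_add, P.jacobi, map_zero]
  leibniz a b c := by simp [P.leibniz]

theorem map_bracket {k A B : Type*} [CommRing k] [Ring A] [Algebra k A] [Ring B] [Algebra k B]
    (P : PoissonStructure k A) (φ : A ≃ₐ[k] B) (a b : B) :
    (P.map φ).bracket a b = φ (P.bracket (φ.symm a) (φ.symm b)) := rfl

end PoissonStructure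

namespace SympRefl

variable {V : Type*} [AddCommGroup V] [Module ℂ V] {ω : LinearMap.BilinForm ℂ V}
  {Γ : Subgroup (V ≃ₗ[ℂ] V)} [Fintype Γ] (c : invariantFunctions Γ)

theorem mem_corner {R : Type*} [Ring R] {e : R} {he : IsIdempotentElem e} (a : he.Corner) :
    e * a.1 = a.1 ∧ a.1 * e = a.1 := (Subsemigroup.mem_corner_iff he).1 a.2

theorem sphericalParam_mul (d : SphericalFamily ω Γ c) :
    (sphericalParam ω Γ c * d).1 = param ω Γ c * d.1 := by
  obtain ⟨h1, h2⟩ := mem_corner d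
  change familyE ω Γ c * param ω Γ c * familyE ω Γ c * d.1 = _
  rw [mul_assoc, h1, ← param_comm, mul_assoc, h1]

/-- Multiplication by the symmetriser, from the centre to the spherical subalgebra. -/
def centerHom : Subalgebra.center ℂ (H ω Γ 0 c) →ₐ[ℂ] Spherical ω Γ 0 c :=
  have he : e ω Γ 0 c * e ω Γ 0 c = e ω Γ 0 c := e_idem ω Γ 0 c
  have hc (z : Subalgebra.center ℂ (H ω Γ 0 c)) (a : H ω Γ 0 c) : a * z.1 = z.1 * a :=
    Subalgebra.mem_center_iff.1 z.2 a
  AlgHom.ofLinearMap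
    { toFun := fun z ↦ ⟨z.1 * e ω Γ 0 c, z.1, by
        change e ω Γ 0 c * z.1 * e ω Γ 0 c = _
        rw [hc, mul_assoc, he]⟩
      map_add' := fun z w ↦ Subtype.ext (add_mul z.1 w.1 _)
      map_smul' := fun r z ↦ Subtype.ext (smul_mul_assoc r z.1 _) }
    (Subtype.ext (one_mul _))
    (fun z w ↦ Subtype.ext (by
      change z.1 * w.1 * e ω Γ 0 c = z.1 * e ω Γ 0 c * (w.1 * e ω Γ 0 c)
      rw [mul_assoc z.1 (e ω Γ 0 c), ← mul_assoc (e ω Γ 0 c) w.1, hc w (e ω Γ 0 c),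
        mul_assoc w.1 _ (e ω Γ 0 c), he, mul_assoc]))

section

variable {ι : Type*} [Fintype ι] [LinearOrder ι] [DecidableEq Γ]

/-- At `t = 0` the unit component of the commutator form is `0 • ω`, as the abstract commutativity
result requires. -/
theorem spherical_comm (b : Module.Basis ι ℂ V) (hω : ω.IsAlt) (hnd : ω.Nondegenerate)
    (hΓ : ∀ g ∈ Γ, ∀ x y, ω (g x) (g y) = ω x y) {u v : H ω Γ 0 c}
    (hu : e ω Γ 0 c * u = u) (hu' : u * e ω Γ 0 c = u) (hv : e ω Γ 0 c * v = v)
    (hv' : v * e ω Γ 0 c = v) : u * v = v * u := by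
  rw [← H.pbw_sym c b hω hΓ] at hu hu' hv hv'
  exact PBWAlgebra.spherical_comm (isGenericAction b hω hnd hΓ)
    (fun i j ↦ (kappaForm_one _ _ _ _ _ _).trans (smul_zero _)) hu hu' hv hv'

theorem centerHom_bijective (b : Module.Basis ι ℂ V) (hω : ω.IsAlt) (hnd : ω.Nondegenerate)
    (hΓ : ∀ g ∈ Γ, ∀ x y, ω (g x) (g y) = ω x y) : Function.Bijective (centerHom (ω := ω) c) := by
  have hgen := isGenericAction b hω hnd hΓ
  have hs := H.pbw_sym c b hω hΓ 0
  constructor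
  · rw [injective_iff_map_eq_zero]
    intro z hz
    refine Subtype.ext (PBWAlgebra.eq_zero_of_central (A := H.pbw c b hω hΓ 0) hgen
      (fun y ↦ (Subalgebra.mem_center_iff.1 z.2 y).symm) ?_)
    rw [hs]
    exact congrArg Subtype.val hz
  · intro a
    obtain ⟨h1, h2⟩ := mem_corner a
    obtain ⟨z, hz, hz'⟩ := PBWAlgebra.exists_central (A := H.pbw c b hω hΓ 0) hgen
      (fun u v ↦ by
        rw [hs]
        exact spherical_comm c b hω hnd hΓ) (a := a.1) (by rw [hs, h1])
      (by rw [hs, h2])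
    refine ⟨⟨z, Subalgebra.mem_center_iff.2 fun y ↦ (hz y).symm⟩, Subtype.ext ?_⟩
    rwa [hs] at hz'

/-- The Poisson structure on the centre. -/
theorem exists_isHayashiBracket_center (b : Module.Basis ι ℂ V) (hω : ω.IsAlt)
    (hΓ : ∀ g ∈ Γ, ∀ x y, ω (g x) (g y) = ω x y) :
    ∃ P : PoissonStructure ℂ (Subalgebra.center ℂ (H ω Γ 0 c)),
      IsHayashiBracket (param ω Γ c) (reduction ω Γ c) (fun z w ↦ P.bracket z w) :=
  exists_isHayashiBracket (reduction_surjective ω Γ c) (param_comm ω Γ c)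
    (reduction_eq_zero_iff ω Γ c) (fun _ ↦ eq_zero_of_param_mul b hω hΓ) fun r ↦
    ⟨algebraMap (Polynomial ℂ) _ (Polynomial.C r), Algebra.commutes _, by
      refine (reduction_mk ω Γ c _).trans ?_
      rw [Polynomial.coe_mapRingHom, Polynomial.map_C, Polynomial.coeff_C_zero, AlgHom.commutes]⟩

/-- The bracket on the spherical subalgebra is the reduction of the rescaled commutator. -/
theorem map_bracket_eq (b : Module.Basis ι ℂ V) (hω : ω.IsAlt) (hnd : ω.Nondegenerate)
    (hΓ : ∀ g ∈ Γ, ∀ x y, ω (g x) (g y) = ω x y)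
    {P : PoissonStructure ℂ (Subalgebra.center ℂ (H ω Γ 0 c))}
    (hP : IsHayashiBracket (param ω Γ c) (reduction ω Γ c) (fun z w ↦ P.bracket z w))
    {φ : Subalgebra.center ℂ (H ω Γ 0 c) ≃ₐ[ℂ] Spherical ω Γ 0 c}
    (hφ : ∀ z, (φ z).1 = z * e ω Γ 0 c) {u v d : SphericalFamily ω Γ c}
    (h : u * v - v * u = sphericalParam ω Γ c * d) :
    (P.map φ).bracket (sphericalReduction ω Γ c u) (sphericalReduction ω Γ c v) =
      sphericalReduction ω Γ c d := by
  -- The bracket on the spherical side is transported from the centre, so each spherical lift `u`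
  -- needs a companion lift `z` of the corresponding central element.
  have hlift (u : SphericalFamily ω Γ c) : ∃ z : Family ω Γ c,
      ∃ hz : reduction ω Γ c z ∈ Subalgebra.center ℂ (H ω Γ 0 c),
        φ.symm (sphericalReduction ω Γ c u) = ⟨reduction ω Γ c z, hz⟩ ∧
        reduction ω Γ c u.1 = reduction ω Γ c z * reduction ω Γ c (familyE ω Γ c) := by
    obtain ⟨z, hz⟩ := reduction_surjective ω Γ c (φ.symm (sphericalReduction ω Γ c u)).1
    refine ⟨z, hz ▸ (φ.symm (sphericalReduction ω Γ c u)).2, Subtype.ext hz.symm, ?_⟩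
    rw [hz, reduction_familyE, ← hφ, AlgEquiv.apply_symm_apply]
    rfl
  obtain ⟨z, hz, hz', huz⟩ := hlift u
  obtain ⟨w, hw, hw', hvw⟩ := hlift v
  obtain ⟨⟨D, hD⟩, hP⟩ := hP z w hz hw
  have hPD := hP D hD
  refine Subtype.ext ?_
  have hd : u.1 * v.1 - v.1 * u.1 = param ω Γ c * d.1 := by
    rw [← sphericalParam_mul, ← h]
    rfl
  obtain ⟨hu1, hu2⟩ := mem_corner u
  obtain ⟨hv1, hv2⟩ := mem_corner v
  have key := map_corner_commutator (param_comm ω Γ c) (reduction_eq_zero_iff ω Γ c)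
    (fun _ ↦ eq_zero_of_param_mul b hω hΓ) (familyE_idem ω Γ c)
    (fun a a' h1 h2 h3 h4 ↦ by
      rw [map_mul, map_mul]
      exact spherical_comm c b hω hnd hΓ
        (by rw [← reduction_familyE, ← map_mul, h1]) (by rw [← reduction_familyE, ← map_mul, h2])
        (by rw [← reduction_familyE, ← map_mul, h3]) (by rw [← reduction_familyE, ← map_mul, h4]))
    (fun x ↦ (Subalgebra.mem_center_iff.1 hz x).symm)
    (fun x ↦ (Subalgebra.mem_center_iff.1 hw x).symm) hu1 hu2 hv1 hv2 huz hvw hD hd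
  rw [PoissonStructure.map_bracket, hφ, hz', hw', hPD]
  refine Eq.trans ?_ key.symm
  have hcen := Subalgebra.mem_center_iff.1 (hPD ▸ (P.bracket ⟨_, hz⟩ ⟨_, hw⟩).2) (e ω Γ 0 c)
  rw [map_mul, map_mul, reduction_familyE, hcen, mul_assoc, e_idem ω Γ 0 c]

/-- The bracket on the spherical subalgebra is induced by its deformation. -/
theorem isDeformationBracket_map (b : Module.Basis ι ℂ V) (hω : ω.IsAlt) (hnd : ω.Nondegenerate)
    (hΓ : ∀ g ∈ Γ, ∀ x y, ω (g x) (g y) = ω x y)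
    {P : PoissonStructure ℂ (Subalgebra.center ℂ (H ω Γ 0 c))}
    (hP : IsHayashiBracket (param ω Γ c) (reduction ω Γ c) (fun z w ↦ P.bracket z w))
    {φ : Subalgebra.center ℂ (H ω Γ 0 c) ≃ₐ[ℂ] Spherical ω Γ 0 c}
    (hφ : ∀ z, (φ z).1 = z * e ω Γ 0 c) :
    IsDeformationBracket (sphericalParam ω Γ c) (sphericalReduction ω Γ c)
      (fun a b ↦ (P.map φ).bracket a b) := by
  by_cases hij : ∃ i j, ω (b i) (b j) ≠ 0
  · obtain ⟨i, j, hij⟩ := hij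
    -- The exponent is one: commutativity at `t = 0` gives divisibility by `t`, and the nonzero
    -- value of `ω` excludes divisibility by `t ^ 2`.
    refine Or.inl ⟨1, le_rfl, fun u v ↦ ?_, ?_, fun u v d h ↦ ?_⟩
    · rw [pow_one, ← sphericalReduction_eq_zero_iff, map_sub, map_mul, map_mul, sub_eq_zero]
      exact (P.map φ).commutative _ _
    · obtain ⟨u, v, hu, hu', hv, hv', huv⟩ := exists_comm_not_dvd (c := c) hω hnd hΓ hij
      refine ⟨⟨u, (Subsemigroup.mem_corner_iff (familyE_idem ω Γ c)).2 ⟨hu, hu'⟩⟩,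
        ⟨v, (Subsemigroup.mem_corner_iff (familyE_idem ω Γ c)).2 ⟨hv, hv'⟩⟩, ?_⟩
      rintro ⟨d, hd⟩
      refine huv d.1 ?_
      rw [pow_two, mul_assoc] at hd
      rw [← sphericalParam_mul, ← sphericalParam_mul, ← hd]
      rfl
    · rw [pow_one] at h
      exact map_bracket_eq c b hω hnd hΓ hP hφ h
  · push Not at hij
    -- A form that is both zero and nondegenerate forces `V = 0`.
    have hω0 : ω = 0 := LinearMap.ext_basis b b hij
    have : IsEmpty ι := ⟨fun i ↦ (b.ne_zero i) (hnd.1 _ fun y ↦ by rw [hω0]; rfl)⟩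
    have hc (u v : SphericalFamily ω Γ c) : u * v - v * u = 0 :=
      Subtype.ext (sub_eq_zero.2 (family_comm_of_isEmpty b hω hΓ u.1 v.1))
    refine Or.inr ⟨fun m u v ↦ by rw [hc]; exact dvd_zero _, fun a a' ↦ ?_⟩
    obtain ⟨u, rfl⟩ := sphericalReduction_surjective ω Γ c a
    obtain ⟨v, rfl⟩ := sphericalReduction_surjective ω Γ c a'
    exact (map_bracket_eq c b hω hnd hΓ hP hφ (d := 0) (by rw [hc, mul_zero])).trans (map_zero _)

end

end SympRefl

end

open SympRefl in
theorem theorem3p3 {V : Type*} [AddCommGroup V] [Module ℂ V] [FiniteDimensional ℂ V]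
    (ω : LinearMap.BilinForm ℂ V) (hω : ω.IsAlt) (hnd : ω.Nondegenerate)
    (Γ : Subgroup (V ≃ₗ[ℂ] V)) [Fintype Γ] (hΓ : ∀ g ∈ Γ, ∀ x y, ω (g x) (g y) = ω x y)
    (c : invariantFunctions Γ) :
    ∃ (P : PoissonStructure ℂ (Subalgebra.center ℂ (H ω Γ 0 c)))
      (Q : PoissonStructure ℂ (Spherical ω Γ 0 c)),
      IsHayashiBracket (param ω Γ c) (reduction ω Γ c) (fun z w ↦ P.bracket z w) ∧
      IsDeformationBracket (sphericalParam ω Γ c) (sphericalReduction ω Γ c)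
        (fun a b ↦ Q.bracket a b) ∧
      ∃ φ : Subalgebra.center ℂ (H ω Γ 0 c) ≃ₐ[ℂ] Spherical ω Γ 0 c,
        (∀ z, (φ z).1 = z * e ω Γ 0 c) ∧
        ∀ z w, φ (P.bracket z w) = Q.bracket (φ z) (φ w) := by
  classical
  let b := Module.finBasis ℂ V
  obtain ⟨P, hP⟩ := exists_isHayashiBracket_center c b hω hΓ
  let φ := AlgEquiv.ofBijective (centerHom c) (centerHom_bijective c b hω hnd hΓ)
  have hφ (z : Subalgebra.center ℂ (H ω Γ 0 c)) : (φ z).1 = z * e ω Γ 0 c := rfl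
  -- The spherical Poisson structure is defined by transport, so compatibility with `φ` is
  -- automatic; the content is that it is the deformation bracket.
  refine ⟨P, P.map φ, hP, isDeformationBracket_map c b hω hnd hΓ hP hφ, φ, hφ, fun z w ↦ ?_⟩
  rw [P.map_bracket, φ.symm_apply_apply, φ.symm_apply_apply]
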